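/- A (smooth) Weyl structure on a manifold $B$ is a conformal structure together with a torsion-free connection $D$ preserving it; for a representative metric $g$ it is given by the pair $(g,\omega)$ with $Dg=-2\omega\otimes g$, where $(e^{2f}g,\ \omega-df)$ gives the same structure. Let $L^1$ be the line bundle of scalars of weight one, on which $D$ has connection form $\omega$ in the gauge $g$. The structure is \emph{Einstein--Weyl} if the symmetric trace-free part of the Ricci tensor of $D$ vanishes. In dimension three, a \emph{shear-free geodesic congruence} is a weightless unit vector field $\chi$ (a smooth section of $L^{-1}\otimes TB$) with $D\chi=\tau(\mathrm{id}-\chi\otimes\chi)+\kappa\,{*\chi}$; $\tau$ is its divergence and $\kappa$ its twist. It is called a \emph{Toda congruence} if $\kappa=0$. The Einstein--Weyl space is \emph{Toda} if it admits a Toda congruence, and \emph{hyperCR} if it admits a shear-free geodesic congruence with $\tau=0$. \textbf{Theorem.} (1) Let $h$ be a holomorphic function on an open subset $U$ of $S^2$. On every open subset of $\{(p,z)\in U\times\mathbb R : z+h(p)\neq 0\}$ the Weyl structure $$g=(z+h)(z+\bar h)\,g_{S^2}+dz^2,\qquad \omega=-\frac{2z+h+\bar h}{(z+h)(z+\bar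 h)}\,dz,$$ where $g_{S^2}$ is the round metric of the unit sphere, is Einstein--Weyl, and it is both Toda and hyperCR. (2) Conversely, let $B$ be a connected Einstein--Weyl 3-manifold with a Toda congruence $\chi$, and suppose that $B$ is hyperCR. If $D$ is flat and $\chi$ is parallel ($D\chi=0$; a parallel congruence on flat space), then near no point is $(B,\chi)$ of the form described next. In all other cases there is a dense set of points of $B$ (automatically open) each of which has an open neighbourhood that is isomorphic, as a Weyl space, to an open subset of one of the spaces in (1) (for some $U$ and $h$ depending on the point), by an isomorphism carrying $\chi$ to the congruence generated by $\partial/\partial z$. -/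

import Mathlib

open Bundle
open scoped Manifold ContDiff RealInnerProductSpace

noncomputable section

section Weyl

variable {E : Type*} [NormedAddCommGroup E] [NormedSpace ℝ E] [FiniteDimensional ℝ E]
  {H : Type*} [TopologicalSpace H] (I : ModelWithCorners ℝ E H)
  (B : Type*) [TopologicalSpace B] [ChartedSpace H B] [IsManifold I ∞ B]

/-- A smooth Weyl space, written in the gauge of a representative metric `g` of its conformal
structure: a torsion-free affine connection `D` preserving the conformal structure, i.e. with
`D g = -2 ω ⊗ g`, where the 1-form `ω` (the field `om`) is the connection form of `D` on the density line bundle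
`L¹` in the trivialization given by `g`.
(Mathlib writes `D Y x (X x)` for the value of `D_X Y` at `x`.) -/
structure WeylSpace where
  /-- the representative metric -/
  g : ContMDiffRiemannianMetric I ∞ E (fun x : B => TangentSpace I x)
  /-- the connection 1-form on `L¹` in the gauge `g` -/
  om : (x : B) → TangentSpace I x →L[ℝ] ℝ
  smooth_om : ContMDiff I (I.prod 𝓘(ℝ, E →L[ℝ] ℝ)) ∞
    (fun x => TotalSpace.mk' (E →L[ℝ] ℝ) (E := fun x : B => TangentSpace I x →L[ℝ] ℝ) x (om x))
  /-- the Weyl connection -/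
  D : CovariantDerivative I E (fun x : B => TangentSpace I x)
  torsion_free : D.torsion = 0
  conformal : ∀ (Y Z : (x : B) → TangentSpace I x) (x : B) (u : TangentSpace I x),
    MDiffAt (T% Y) x → MDiffAt (T% Z) x →
    mvfderiv I (fun y => g.inner y (Y y) (Z y)) x u
        - g.inner x (D Y x u) (Z x) - g.inner x (Y x) (D Z x u)
      = -2 * om x u * g.inner x (Y x) (Z x)

namespace WeylSpace

variable {I B}
variable (W : WeylSpace I B)

/-- The curvature `R(u, v) w = D_U D_V W - D_V D_U W - D_[U,V] W` of the Weyl connection at `x`,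
computed with vector fields extending the tangent vectors `u`, `v`, `w` smoothly near `x`. -/
def curvature (x : B) (u v w : TangentSpace I x) : TangentSpace I x :=
  W.D (fun y => W.D (FiberBundle.extend E w) y (FiberBundle.extend E v y)) x u
    - W.D (fun y => W.D (FiberBundle.extend E w) y (FiberBundle.extend E u y)) x v
    - W.D (FiberBundle.extend E w) x
        (VectorField.mlieBracket I (FiberBundle.extend E u) (FiberBundle.extend E v) x)

/-- The Ricci tensor `Ric(v, w) = tr (u ↦ R(u, v) w)` of the Weyl connection. -/
def ricci (x : B) (v w : TangentSpace I x) : ℝ :=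
  let b : Module.Basis (Fin (Module.finrank ℝ E)) ℝ (TangentSpace I x) := Module.finBasis ℝ E
  ∑ i, b.coord i (W.curvature x (b i) v w)

/-- Einstein-Weyl: the symmetric trace-free part of the Ricci tensor of `D` vanishes, i.e. the
symmetric part is pointwise a multiple of the metric. -/
def IsEinsteinWeyl : Prop :=
  ∀ x : B, ∃ s : ℝ, ∀ v w : TangentSpace I x,
    (W.ricci x v w + W.ricci x w v) / 2 = s * W.g.inner x v w

/-- The Weyl connection is flat. -/
def IsFlat : Prop :=
  ∀ (x : B) (u v w : TangentSpace I x), W.curvature x u v w = 0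

/-- A congruence: a smooth weightless unit vector field, represented in the gauge `g` by a smooth
`g`-unit vector field `χ`. -/
structure IsCongruence (χ : (x : B) → TangentSpace I x) : Prop where
  smooth : ContMDiff I I.tangent ∞ (fun x => (⟨x, χ x⟩ : TangentBundle I B))
  unit : ∀ x, W.g.inner x (χ x) (χ x) = 1

/-- The derivative `D_u χ` of the section of `L⁻¹ ⊗ TB` (a vector field of weight `-1`) that is
represented by `χ` in the gauge `g`; the connection form on `L⁻¹` is `-ω`. -/
def weightlessD (χ : (x : B) → TangentSpace I x) (x : B) (u : TangentSpace I x) :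
    TangentSpace I x :=
  W.D χ x u - W.om x u • χ x

/-- In dimension three the endomorphism `*χ` (for a unit vector `χ`) is, up to the sign given by
the choice of orientation, the unique skew `J` that annihilates `χ` and is a rotation by a right
angle in the plane orthogonal to `χ`. -/
structure IsStar (x : B) (χ : TangentSpace I x) (J : TangentSpace I x →ₗ[ℝ] TangentSpace I x) :
    Prop where
  ker : J χ = 0
  skew : ∀ u v, W.g.inner x (J u) v = - W.g.inner x u (J v)
  sq : ∀ u, J (J u) = - (u - W.g.inner x χ u • χ)

/-- The congruence `χ` is shear-free and geodesic with divergence `τ` and twist `κ` (`κ` with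
respect to the orientations that are picked by the star operators `J`):
`D χ = τ (id - χ ⊗ χ) + κ *χ`. -/
structure IsShearFreeGeodesic (χ : (x : B) → TangentSpace I x) (τ κ : B → ℝ)
    (J : (x : B) → TangentSpace I x →ₗ[ℝ] TangentSpace I x) : Prop where
  congruence : W.IsCongruence χ
  star : ∀ x, W.IsStar x (χ x) (J x)
  eqn : ∀ (x : B) (u : TangentSpace I x),
    W.weightlessD χ x u = τ x • (u - W.g.inner x (χ x) u • χ x) + κ x • J x u

/-- `χ` is a shear-free geodesic congruence with vanishing twist. -/
def IsTodaCongruence (χ : (x : B) → TangentSpace I x) : Prop :=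
  ∃ τ κ J, W.IsShearFreeGeodesic χ τ κ J ∧ ∀ x, κ x = 0

/-- `χ` is a shear-free geodesic congruence with vanishing divergence. -/
def IsHyperCRCongruence (χ : (x : B) → TangentSpace I x) : Prop :=
  ∃ τ κ J, W.IsShearFreeGeodesic χ τ κ J ∧ ∀ x, τ x = 0

/-- Toda: there is a shear-free geodesic congruence with vanishing twist. -/
def IsToda : Prop := ∃ χ, W.IsTodaCongruence χ

/-- HyperCR: there is a shear-free geodesic congruence with vanishing divergence. -/
def IsHyperCR : Prop := ∃ χ, W.IsHyperCRCongruence χ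

/-- The congruence `χ` is parallel: `D χ = 0`. -/
def IsParallel (χ : (x : B) → TangentSpace I x) : Prop :=
  ∀ (x : B) (u : TangentSpace I x), W.weightlessD χ x u = 0

end WeylSpace

end Weyl

section Model

/-- The unit sphere `S²` in Euclidean `ℝ³`. -/
abbrev S2 : Type := Metric.sphere (0 : EuclideanSpace ℝ (Fin 3)) 1

/-- The model with corners of the (boundaryless) product manifold `S² × ℝ`. -/
abbrev IS2R : ModelWithCorners ℝ (EuclideanSpace ℝ (Fin 2) × ℝ)
    (ModelProd (EuclideanSpace ℝ (Fin 2)) ℝ) := (𝓡 2).prod 𝓘(ℝ, ℝ)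

/-- The tangent vectors of `S²` at `p`, as vectors of `ℝ³`. -/
def S2.toAmbient (p : S2) (v : TangentSpace (𝓡 2) p) : EuclideanSpace ℝ (Fin 3) :=
  mvfderiv (𝓡 2) (fun q : S2 => (q : EuclideanSpace ℝ (Fin 3))) p v

/-- `h` is holomorphic on the set `U ⊆ S²`: it is differentiable there, with differential linear
over `ℂ` with respect to the complex structure `v ↦ p × v` of the tangent plane at `p`. -/
def HolomorphicOnS2 (h : S2 → ℂ) (U : Set S2) : Prop :=
  ∀ p ∈ U, MDifferentiableAt (𝓡 2) 𝓘(ℝ, ℂ) h p ∧ ∀ v w : TangentSpace (𝓡 2) p,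
    (S2.toAmbient p w).ofLp
        = crossProduct (p : EuclideanSpace ℝ (Fin 3)).ofLp (S2.toAmbient p v).ofLp →
      mvfderiv (𝓡 2) h p w = Complex.I * mvfderiv (𝓡 2) h p v

/-- The differential `dp` of the projection `S² × ℝ → S² ⊆ ℝ³`, `(p, z) ↦ p`. -/
def dp (y : S2 × ℝ) (u : TangentSpace IS2R y) : EuclideanSpace ℝ (Fin 3) :=
  mvfderiv IS2R (fun q : S2 × ℝ => (q.1 : EuclideanSpace ℝ (Fin 3))) y u

/-- The differential `dz` of the projection `S² × ℝ → ℝ`, `(p, z) ↦ z`. -/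
def dz (y : S2 × ℝ) (u : TangentSpace IS2R y) : ℝ :=
  mvfderiv IS2R (fun q : S2 × ℝ => q.2) y u

/-- The symmetric form `(z + h)(z + h̄) g_{S²} + dz²` at the point `y = (p, z)` of `S² × ℝ`;
here `g_{S²}` is the metric induced by the inclusion `S² ⊆ ℝ³`. -/
def modelMetric (h : S2 → ℂ) (y : S2 × ℝ) (u v : TangentSpace IS2R y) : ℝ :=
  Complex.normSq ((y.2 : ℂ) + h y.1) * ⟪dp y u, dp y v⟫ + dz y u * dz y v

/-- The 1-form `-(2z + h + h̄) / ((z + h)(z + h̄)) dz` at the point `y = (p, z)` of `S² × ℝ`. -/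
def modelForm (h : S2 → ℂ) (y : S2 × ℝ) (u : TangentSpace IS2R y) : ℝ :=
  -((2 * y.2 + 2 * (h y.1).re) / Complex.normSq ((y.2 : ℂ) + h y.1)) * dz y u

/-- The Weyl space `W` with the congruence `χ` is, near the point `b`, the space with metric
`(z + h)(z + h̄) g_{S²} + dz²`, 1-form `-(2z + h + h̄) / ((z + h)(z + h̄)) dz` and congruence
generated by `∂/∂z`, for a holomorphic function `h` on an open subset `U` of `S²`: there are a
diffeomorphism `φ` from an open neighbourhood of `b` to an open subset of
`{(p, z) | p ∈ U, z + h p ≠ 0}` and a change of gauge `g ↦ e^{2f} g`, `ω ↦ ω - df` that identify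
the two; in the new gauge the unit vector field generating the congruence is `e^{-f} ∂/∂z`. -/
def IsModelNear {B : Type*} [TopologicalSpace B] [ChartedSpace (EuclideanSpace ℝ (Fin 3)) B]
    [IsManifold (𝓡 3) ∞ B] (W : WeylSpace (𝓡 3) B) (χ : (x : B) → TangentSpace (𝓡 3) x)
    (b : B) : Prop :=
  ∃ (U : Set S2) (h : S2 → ℂ) (φ : PartialDiffeomorph (𝓡 3) IS2R B (S2 × ℝ) ∞) (f : B → ℝ),
    IsOpen U ∧ HolomorphicOnS2 h U ∧ b ∈ φ.source ∧
    (∀ y ∈ φ.target, y.1 ∈ U ∧ (y.2 : ℂ) + h y.1 ≠ 0) ∧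
    ContMDiffOn (𝓡 3) 𝓘(ℝ, ℝ) ∞ f φ.source ∧
    ∀ x ∈ φ.source,
      (∀ u v : TangentSpace (𝓡 3) x, W.g.inner x u v = Real.exp (2 * f x)
        * modelMetric h (φ x) (mfderiv (𝓡 3) IS2R φ x u) (mfderiv (𝓡 3) IS2R φ x v)) ∧
      (∀ u : TangentSpace (𝓡 3) x, W.om x u =
        modelForm h (φ x) (mfderiv (𝓡 3) IS2R φ x u) - mvfderiv (𝓡 3) f x u) ∧
      dp (φ x) (mfderiv (𝓡 3) IS2R φ x (χ x)) = 0 ∧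
      dz (φ x) (mfderiv (𝓡 3) IS2R φ x (χ x)) = Real.exp (-f x)

end Model

end

open scoped Topology

section ChartCalculus

variable {E : Type*} [NormedAddCommGroup E] [NormedSpace ℝ E]
  {H : Type*} [TopologicalSpace H] {I : ModelWithCorners ℝ E H}
  {M : Type*} [TopologicalSpace M] [ChartedSpace H M]
  {F : Type*} [NormedAddCommGroup F] [NormedSpace ℝ F]

lemma ContMDiffAt.comp_extChartAt_symm [IsManifold I ∞ M] [I.Boundaryless] {n : WithTop ℕ∞}
    (hn : n ≤ ∞) {f : M → F} {b x : M}
    (hx : x ∈ (chartAt H b).source) (hf : ContMDiffAt I 𝓘(ℝ, F) n f x) :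
    ContDiffAt ℝ n (f ∘ (extChartAt I b).symm) (extChartAt I b x) := by
  rw [← contMDiffAt_iff_contDiffAt]
  have hx' : x ∈ (extChartAt I b).source := by rwa [extChartAt_source]
  have h1 : ContMDiffAt 𝓘(ℝ, E) I n (extChartAt I b).symm (extChartAt I b x) :=
    ((contMDiffOn_extChartAt_symm (n := ∞) b).of_le hn).contMDiffAt
      (extChartAt_target_mem_nhds' ((extChartAt I b).map_source hx'))
  refine ContMDiffAt.comp _ ?_ h1
  rwa [(extChartAt I b).left_inv hx']

lemma MDifferentiableAt.comp_extChartAt_symm [IsManifold I 1 M] [I.Boundaryless] {f : M → F}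
    {b x : M} (hx : x ∈ (chartAt H b).source) (hf : MDifferentiableAt I 𝓘(ℝ, F) f x) :
    DifferentiableAt ℝ (f ∘ (extChartAt I b).symm) (extChartAt I b x) := by
  rw [← mdifferentiableAt_iff_differentiableAt]
  have hx' : x ∈ (extChartAt I b).source := by rwa [extChartAt_source]
  have h1 : MDifferentiableAt 𝓘(ℝ, E) I (extChartAt I b).symm (extChartAt I b x) :=
    ((contMDiffOn_extChartAt_symm (n := 1) b).contMDiffAt
      (extChartAt_target_mem_nhds' ((extChartAt I b).map_source hx'))).mdifferentiableAt one_ne_zero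
  refine MDifferentiableAt.comp _ ?_ h1
  rwa [(extChartAt I b).left_inv hx']

lemma mvfderiv_eq_fderiv_comp_extChartAt [IsManifold I 1 M] [I.Boundaryless] {f : M → F}
    {b x : M} (hx : x ∈ (chartAt H b).source) (hf : MDifferentiableAt I 𝓘(ℝ, F) f x)
    (v : TangentSpace I x) :
    mvfderiv I f x v = fderiv ℝ (f ∘ (extChartAt I b).symm) (extChartAt I b x)
      (mvfderiv I (extChartAt I b) x v) := by
  have hx' : x ∈ (extChartAt I b).source := by rwa [extChartAt_source]
  have h1 : f =ᶠ[𝓝 x] (f ∘ (extChartAt I b).symm) ∘ extChartAt I b := by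
    filter_upwards [extChartAt_source_mem_nhds' hx'] with y hy
    simp only [Function.comp_apply, (extChartAt I b).left_inv hy]
  have h2 : mfderiv I 𝓘(ℝ, F) f x
      = mfderiv I 𝓘(ℝ, F) ((f ∘ (extChartAt I b).symm) ∘ extChartAt I b) x := h1.mfderiv_eq
  have h3 := mfderiv_comp x (hf.comp_extChartAt_symm hx).mdifferentiableAt
    (mdifferentiableAt_extChartAt (I := I) hx)
  rw [mfderiv_eq_fderiv] at h3
  have h4 := congrArg (fun A => A v) (h2.trans h3)
  exact h4

lemma trivializationAt_snd_eq_mvfderiv [IsManifold I 1 M] {b x : M}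
    (hx : x ∈ (chartAt H b).source) (v : TangentSpace I x) :
    (trivializationAt E (TangentSpace I : M → Type _) b ⟨x, v⟩).2
      = mvfderiv I (extChartAt I b) x v := by
  have h := TangentBundle.continuousLinearMapAt_trivializationAt (I := I) (𝕜 := ℝ) hx
  have h2 := congrArg (fun A => A v) h
  rw [Bundle.Trivialization.continuousLinearMapAt_apply] at h2
  rw [Bundle.Trivialization.linearMapAt_apply] at h2
  rw [if_pos (by simpa using hx)] at h2
  exact h2

lemma mvfderiv_extChartAt_bijective [IsManifold I 1 M] {b x : M}
    (hx : x ∈ (chartAt H b).source) :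
    Function.Bijective (mvfderiv I (extChartAt I b) x) := by
  have := (isInvertible_mfderiv_extChartAt (I := I) (x := b) (y := x)
    (by rwa [extChartAt_source])).bijective
  exact this

lemma contMDiffAt_section_iff_mvfderiv [IsManifold I ∞ M] {b x : M}
    (hx : x ∈ (chartAt H b).source) (X : (y : M) → TangentSpace I y) :
    ContMDiffAt I I.tangent ∞ (fun y => (⟨y, X y⟩ : TangentBundle I M)) x ↔
      ContMDiffAt I 𝓘(ℝ, E) ∞ (fun y => mvfderiv I (extChartAt I b) y (X y)) x := by
  refine ((trivializationAt E (TangentSpace I : M → Type _) b).contMDiffAt_section_iff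
    (IB := I) (n := ∞) (s := X) (x₀ := x) (by simpa using hx)).trans ?_
  refine Filter.EventuallyEq.contMDiffAt_iff ?_
  filter_upwards [(chartAt H b).open_source.mem_nhds hx] with y hy
  exact trivializationAt_snd_eq_mvfderiv hy (X y)

lemma mdifferentiableAt_section_iff_mvfderiv [IsManifold I ∞ M] {b x : M}
    (hx : x ∈ (chartAt H b).source) (X : (y : M) → TangentSpace I y) :
    MDifferentiableAt I I.tangent (fun y => (⟨y, X y⟩ : TangentBundle I M)) x ↔
      MDifferentiableAt I 𝓘(ℝ, E) (fun y => mvfderiv I (extChartAt I b) y (X y)) x := by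
  refine ((trivializationAt E (TangentSpace I : M → Type _) b).mdifferentiableAt_section_iff
    I X (b₀ := x) (by simpa using hx)).trans ?_
  refine Filter.EventuallyEq.mdifferentiableAt_iff ?_
  filter_upwards [(chartAt H b).open_source.mem_nhds hx] with y hy
  exact trivializationAt_snd_eq_mvfderiv hy (X y)

lemma ContMDiffAt.eventually_mdifferentiableAt [IsManifold I ∞ M] {f : M → F} {x : M}
    (hf : ContMDiffAt I 𝓘(ℝ, F) ∞ f x) : ∀ᶠ y in 𝓝 x, MDifferentiableAt I 𝓘(ℝ, F) f y := by
  have h1 : ContMDiffAt I 𝓘(ℝ, F) 1 f x := hf.of_le (by norm_cast)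
  filter_upwards [contMDiffAt_iff_contMDiffAt_nhds (by simp) |>.1 h1] with y hy
  exact hy.mdifferentiableAt one_ne_zero

lemma ContMDiffAt.eventually_mvfderiv_eq [IsManifold I ∞ M] [I.Boundaryless] {f : M → F} {x : M}
    (hf : ContMDiffAt I 𝓘(ℝ, F) ∞ f x) :
    ∀ᶠ y in 𝓝 x, ∀ v : TangentSpace I y, mvfderiv I f y v =
      fderiv ℝ (f ∘ (extChartAt I x).symm) (extChartAt I x y) (mvfderiv I (extChartAt I x) y v) := by
  filter_upwards [hf.eventually_mdifferentiableAt,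
    (chartAt H x).open_source.mem_nhds (mem_chart_source H x)] with y hy hy' v
  exact mvfderiv_eq_fderiv_comp_extChartAt hy' hy v

lemma ContDiffAt.fderiv_infty {G : Type*} [NormedAddCommGroup G] [NormedSpace ℝ G] {f : G → F}
    {x : G} (hf : ContDiffAt ℝ ∞ f x) : ContDiffAt ℝ ∞ (fderiv ℝ f) x :=
  hf.fderiv_right (by norm_cast)

lemma contMDiffAt_fderiv_comp_extChartAt [IsManifold I ∞ M] [I.Boundaryless] {f : M → F} {x : M}
    (hf : ContMDiffAt I 𝓘(ℝ, F) ∞ f x) :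
    ContMDiffAt I 𝓘(ℝ, E →L[ℝ] F) ∞
      (fun y => fderiv ℝ (f ∘ (extChartAt I x).symm) (extChartAt I x y)) x := by
  have h1 := (hf.comp_extChartAt_symm le_rfl (mem_chart_source H x)).fderiv_infty
  exact ContMDiffAt.comp x h1.contMDiffAt (contMDiffAt_extChartAt (n := ∞))

/-- The derivative of a smooth function along a smooth vector field is smooth. -/
lemma ContMDiffAt.mvfderiv_vectorField [IsManifold I ∞ M] [I.Boundaryless] {f : M → F} {x : M}
    (hf : ContMDiffAt I 𝓘(ℝ, F) ∞ f x) {X : (y : M) → TangentSpace I y}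
    (hX : ContMDiffAt I I.tangent ∞ (fun y => (⟨y, X y⟩ : TangentBundle I M)) x) :
    ContMDiffAt I 𝓘(ℝ, F) ∞ (fun y => mvfderiv I f y (X y)) x := by
  rw [contMDiffAt_section_iff_mvfderiv (mem_chart_source H x)] at hX
  refine ((contMDiffAt_fderiv_comp_extChartAt hf).clm_apply hX).congr_of_eventuallyEq ?_
  filter_upwards [hf.eventually_mvfderiv_eq] with y hy
  exact hy (X y)

/-- The derivative of a smooth function along a differentiable vector field is differentiable. -/
lemma MDifferentiableAt.mvfderiv_vectorField [IsManifold I ∞ M] [I.Boundaryless] {f : M → F} {x : M}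
    (hf : ContMDiffAt I 𝓘(ℝ, F) ∞ f x) {X : (y : M) → TangentSpace I y}
    (hX : MDifferentiableAt I I.tangent (fun y => (⟨y, X y⟩ : TangentBundle I M)) x) :
    MDifferentiableAt I 𝓘(ℝ, F) (fun y => mvfderiv I f y (X y)) x := by
  rw [mdifferentiableAt_section_iff_mvfderiv (mem_chart_source H x)] at hX
  refine MDifferentiableAt.congr_of_eventuallyEq
    (((contMDiffAt_fderiv_comp_extChartAt hf).mdifferentiableAt (by simp)).clm_apply hX) ?_
  filter_upwards [hf.eventually_mvfderiv_eq] with y hy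
  exact hy (X y)

lemma lieBracketWithin_eq_lieBracket_of_eventuallyEq {U V U' V' : E → E} {s : Set E} {z : E}
    (hs : s = Set.univ) (hU : U =ᶠ[𝓝 z] U') (hV : V =ᶠ[𝓝 z] V') :
    VectorField.lieBracketWithin ℝ U V s z = VectorField.lieBracket ℝ U' V' z := by
  rw [← Filter.EventuallyEq.lieBracket_vectorField_eq hU hV, hs,
    VectorField.lieBracketWithin_univ]

lemma mvfderiv_extChartAt_mlieBracket [IsManifold I ∞ M] [I.Boundaryless] [CompleteSpace E] {x : M}
    (U V : (y : M) → TangentSpace I y) :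
    mvfderiv I (extChartAt I x) x (VectorField.mlieBracket I U V x) =
      VectorField.lieBracket ℝ
        (fun z => mvfderiv I (extChartAt I x) ((extChartAt I x).symm z) (U ((extChartAt I x).symm z)))
        (fun z => mvfderiv I (extChartAt I x) ((extChartAt I x).symm z) (V ((extChartAt I x).symm z)))
        (extChartAt I x x) := by
  have key : ∀ W : (y : M) → TangentSpace I y,
      VectorField.mpullbackWithin 𝓘(ℝ, E) I (extChartAt I x).symm W (Set.range I)
      =ᶠ[𝓝 (extChartAt I x x)] (fun z => mvfderiv I (extChartAt I x) ((extChartAt I x).symm z)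
        (W ((extChartAt I x).symm z))) := by
    intro W
    filter_upwards [extChartAt_target_mem_nhds (I := I) x] with z hz
    have h1 := mfderiv_extChartAt_comp_mfderivWithin_extChartAt_symm (I := I) hz
    have h2 := mfderivWithin_extChartAt_symm_comp_mfderiv_extChartAt (I := I) hz
    rw [VectorField.mpullbackWithin_apply, ContinuousLinearMap.inverse_eq h2 h1]
    rfl
  rw [← VectorField.mlieBracketWithin_univ, VectorField.mlieBracketWithin_apply]
  rw [Set.preimage_univ, Set.univ_inter]
  have hlie : VectorField.lieBracketWithin ℝ
      (VectorField.mpullbackWithin 𝓘(ℝ, E) I (extChartAt I x).symm U (Set.range I))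
      (VectorField.mpullbackWithin 𝓘(ℝ, E) I (extChartAt I x).symm V (Set.range I)) (Set.range I)
      (extChartAt I x x) = VectorField.lieBracket ℝ
        (fun z => mvfderiv I (extChartAt I x) ((extChartAt I x).symm z) (U ((extChartAt I x).symm z)))
        (fun z => mvfderiv I (extChartAt I x) ((extChartAt I x).symm z) (V ((extChartAt I x).symm z)))
        (extChartAt I x x) := by
    exact lieBracketWithin_eq_lieBracket_of_eventuallyEq I.range_eq_univ (key U) (key V)
  rw [hlie]
  have hinv : ∀ w : TangentSpace 𝓘(ℝ, E) (extChartAt I x x), mvfderiv I (extChartAt I x) x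
      ((mfderiv I 𝓘(ℝ, E) (extChartAt I x) x).inverse w) = w := by
    intro w
    obtain ⟨e, he⟩ := isInvertible_mfderiv_extChartAt (I := I) (mem_extChartAt_source (I := I) x)
    rw [← he, ContinuousLinearMap.inverse_equiv]
    exact (congrArg (fun A => A (e.symm w)) he.symm).trans (e.apply_symm_apply w)
  exact hinv _

/-- The Lie bracket of vector fields is the commutator of the derivations. -/
lemma mvfderiv_mlieBracket [IsManifold I ∞ M] [I.Boundaryless] [CompleteSpace E] {f : M → F} {x : M}
    (hf : ContMDiffAt I 𝓘(ℝ, F) ∞ f x) {U V : (y : M) → TangentSpace I y}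
    (hU : MDifferentiableAt I I.tangent (fun y => (⟨y, U y⟩ : TangentBundle I M)) x)
    (hV : MDifferentiableAt I I.tangent (fun y => (⟨y, V y⟩ : TangentBundle I M)) x) :
    mvfderiv I (fun y => mvfderiv I f y (V y)) x (U x)
      - mvfderiv I (fun y => mvfderiv I f y (U y)) x (V x)
      = mvfderiv I f x (VectorField.mlieBracket I U V x) := by
  have hx := mem_chart_source H x
  have hf1 : ContDiffAt ℝ ∞ (f ∘ (extChartAt I x).symm) (extChartAt I x x) :=
    hf.comp_extChartAt_symm le_rfl hx
  have hself : ∀ U : (y : M) → TangentSpace I y,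
      mvfderiv I (extChartAt I x) ((extChartAt I x).symm (extChartAt I x x))
        (U ((extChartAt I x).symm (extChartAt I x x))) = mvfderiv I (extChartAt I x) x (U x) :=
    fun U => congrArg (fun y => mvfderiv I (extChartAt I x) y (U y)) (extChartAt_to_inv x)
  have key : ∀ (U V : (y : M) → TangentSpace I y),
    (MDifferentiableAt I I.tangent (fun y => (⟨y, V y⟩ : TangentBundle I M)) x) →
    mvfderiv I (fun y => mvfderiv I f y (V y)) x (U x) =
      fderiv ℝ (fderiv ℝ (f ∘ (extChartAt I x).symm)) (extChartAt I x x)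
        (mvfderiv I (extChartAt I x) x (U x)) (mvfderiv I (extChartAt I x) x (V x))
      + fderiv ℝ (f ∘ (extChartAt I x).symm) (extChartAt I x x)
        (fderiv ℝ (fun z => mvfderiv I (extChartAt I x) ((extChartAt I x).symm z)
          (V ((extChartAt I x).symm z))) (extChartAt I x x)
          (mvfderiv I (extChartAt I x) x (U x))) := by
    intro U V hV
    have h1 := MDifferentiableAt.mvfderiv_vectorField hf hV
    rw [mvfderiv_eq_fderiv_comp_extChartAt hx h1]
    rw [mdifferentiableAt_section_iff_mvfderiv hx] at hV
    have h2 := hV.comp_extChartAt_symm hx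
    have h3 : (fun y => mvfderiv I f y (V y)) ∘ (extChartAt I x).symm =ᶠ[𝓝 (extChartAt I x x)]
        fun z => fderiv ℝ (f ∘ (extChartAt I x).symm) z
          (((fun y => mvfderiv I (extChartAt I x) y (V y)) ∘ (extChartAt I x).symm) z) := by
      have h4 := ((continuousAt_extChartAt_symm (I := I) x).tendsto).eventually
        (by rw [extChartAt_to_inv]; exact hf.eventually_mvfderiv_eq)
      filter_upwards [h4, extChartAt_target_mem_nhds (I := I) x] with z hz hz'
      simp only [Function.comp_apply]
      rw [hz, (extChartAt I x).right_inv hz']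
    rw [h3.fderiv_eq, fderiv_clm_apply (hf1.fderiv_infty.differentiableAt (by simp)) h2]
    simp only [add_apply, ContinuousLinearMap.comp_apply,
      ContinuousLinearMap.flip_apply, Function.comp_apply]
    rw [add_comm, hself]
    rfl
  rw [key U V hV, key V U hU]
  have hs := (hf1.isSymmSndFDerivAt (by simp [minSmoothness_of_isRCLikeNormedField]; norm_cast)).eq (mvfderiv I (extChartAt I x) x (U x))
    (mvfderiv I (extChartAt I x) x (V x))
  rw [hs, mvfderiv_eq_fderiv_comp_extChartAt hx (hf.mdifferentiableAt (by simp)),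
    mvfderiv_extChartAt_mlieBracket]
  simp only [VectorField.lieBracket_eq, map_sub, hself]
  abel

end ChartCalculus

section FrameCalculus

variable {E : Type*} [NormedAddCommGroup E] [NormedSpace ℝ E]
  {H : Type*} [TopologicalSpace H] {I : ModelWithCorners ℝ E H}
  {M : Type*} [TopologicalSpace M] [ChartedSpace H M]
  {E' : Type*} [NormedAddCommGroup E'] [NormedSpace ℝ E']
  {G : Type*} [NormedAddCommGroup G] [NormedSpace ℝ G]

lemma Filter.EventuallyEq.mvfderiv_eq {f g : M → G} {x : M} (h : f =ᶠ[𝓝 x] g) :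
    mvfderiv I f x = mvfderiv I g x := by
  ext u
  exact congrArg (fun A : TangentSpace I x →L[ℝ] G => A u) h.mfderiv_eq

lemma mvfderiv_clm_apply [IsManifold I 1 M] [I.Boundaryless] {T : M → E' →L[ℝ] G} {s : M → E'} {x : M}
    (hT : MDifferentiableAt I 𝓘(ℝ, E' →L[ℝ] G) T x) (hs : MDifferentiableAt I 𝓘(ℝ, E') s x)
    (u : TangentSpace I x) :
    mvfderiv I (fun y => T y (s y)) x u = mvfderiv I T x u (s x) + T x (mvfderiv I s x u) := by
  have hx := mem_chart_source H x
  rw [mvfderiv_eq_fderiv_comp_extChartAt hx hT, mvfderiv_eq_fderiv_comp_extChartAt hx hs,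
    mvfderiv_eq_fderiv_comp_extChartAt hx (hT.clm_apply hs)]
  have h := fderiv_clm_apply (hT.comp_extChartAt_symm hx) (hs.comp_extChartAt_symm hx)
  have h2 := congrArg (fun A => A (mvfderiv I (extChartAt I x) x u)) h
  simp only [add_apply, ContinuousLinearMap.comp_apply,
      ContinuousLinearMap.flip_apply, Function.comp_apply, extChartAt_to_inv] at h2
  rw [add_comm]
  exact h2

/-- The exterior derivative of the one-form `T ∘ dF`, evaluated on a pair of vector fields. -/
lemma mvfderiv_form_mlieBracket [IsManifold I ∞ M] [I.Boundaryless] [CompleteSpace E] {F : M → E'}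
    {T : M → E' →L[ℝ] G} {x : M} (hF : ContMDiffAt I 𝓘(ℝ, E') ∞ F x)
    (hT : MDifferentiableAt I 𝓘(ℝ, E' →L[ℝ] G) T x) {U V : (y : M) → TangentSpace I y}
    (hU : MDifferentiableAt I I.tangent (fun y => (⟨y, U y⟩ : TangentBundle I M)) x)
    (hV : MDifferentiableAt I I.tangent (fun y => (⟨y, V y⟩ : TangentBundle I M)) x) :
    mvfderiv I (fun y => T y (mvfderiv I F y (V y))) x (U x)
      - mvfderiv I (fun y => T y (mvfderiv I F y (U y))) x (V x)
      - T x (mvfderiv I F x (VectorField.mlieBracket I U V x))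
      = mvfderiv I T x (U x) (mvfderiv I F x (V x))
        - mvfderiv I T x (V x) (mvfderiv I F x (U x)) := by
  rw [mvfderiv_clm_apply hT (MDifferentiableAt.mvfderiv_vectorField hF hV),
    mvfderiv_clm_apply hT (MDifferentiableAt.mvfderiv_vectorField hF hU),
    ← mvfderiv_mlieBracket hF hU hV, map_sub]
  abel

/-- The frame that is dual to a smooth coframe is smooth. -/
lemma exists_contMDiffAt_coframe_inverse [IsManifold I ∞ M] [I.Boundaryless] [FiniteDimensional ℝ E]
    {F : M → E'} {T : M → E' →L[ℝ] G} {x : M} (hF : ContMDiffAt I 𝓘(ℝ, E') ∞ F x)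
    (hT : ContMDiffAt I 𝓘(ℝ, E' →L[ℝ] G) ∞ T x)
    (hΦ : Function.Bijective (fun u : TangentSpace I x => T x (mvfderiv I F x u))) :
    ∃ B : M → G →L[ℝ] E, ContMDiffAt I 𝓘(ℝ, G →L[ℝ] E) ∞ B x ∧
      ∀ᶠ y in 𝓝 x, ∀ v, mvfderiv I (extChartAt I x) y v = B y (T y (mvfderiv I F y v)) := by
  set B : M → E →L[ℝ] G := fun y =>
    (T y).comp (fderiv ℝ (F ∘ (extChartAt I x).symm) (extChartAt I x y)) with hB
  have hBs : ContMDiffAt I 𝓘(ℝ, E →L[ℝ] G) ∞ B x :=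
    hT.clm_comp (contMDiffAt_fderiv_comp_extChartAt hF)
  have hev := hF.eventually_mvfderiv_eq
  have : CompleteSpace E := FiniteDimensional.complete ℝ E
  have hBx : ∀ u : E, B x u = T x (mvfderiv I F x (u : TangentSpace I x)) := by
    intro u
    have h1 := hev.self_of_nhds (u : TangentSpace I x)
    have h2 : mvfderiv I (extChartAt I x) x (u : TangentSpace I x) = u :=
      congrArg (fun A => A (u : TangentSpace I x)) (mfderiv_extChartAt_self (I := I) (x := x))
    rw [h1, h2]
    rfl
  have hBbij : Function.Bijective (B x : E →ₗ[ℝ] G) := by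
    have : ((B x : E →ₗ[ℝ] G) : E → G) = (fun u : TangentSpace I x => T x (mvfderiv I F x u)) :=
      funext hBx
    rw [this]; exact hΦ
  have : FiniteDimensional ℝ G :=
    Module.Finite.equiv (LinearEquiv.ofBijective (B x : E →ₗ[ℝ] G) hBbij)
  have hBe : ((LinearEquiv.ofBijective (B x : E →ₗ[ℝ] G) hBbij).toContinuousLinearEquiv :
      E →L[ℝ] G) = B x := by ext u; rfl
  have hinv : ContDiffAt ℝ ∞ (ContinuousLinearMap.inverse : (E →L[ℝ] G) → G →L[ℝ] E) (B x) := by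
    rw [← hBe]; exact contDiffAt_map_inverse (n := ∞) _
  refine ⟨fun y => (B y).inverse, ContMDiffAt.comp x hinv.contMDiffAt hBs, ?_⟩
  have hopen : ∀ᶠ y in 𝓝 x, (B y).IsInvertible := by
    have := (ContinuousLinearEquiv.isOpen (𝕜 := ℝ) (E := E) (F := G)).mem_nhds
      (x := B x) ⟨_, hBe⟩
    exact hBs.continuousAt.eventually this
  filter_upwards [hopen, hev] with y hy hy' v
  obtain ⟨e, he⟩ := hy
  have h1 : T y (mvfderiv I F y v) = B y (mvfderiv I (extChartAt I x) y v) := by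
    rw [hy']; rfl
  rw [h1, ← he, ContinuousLinearMap.inverse_equiv]
  simp

/-- A vector field is differentiable if its components in a smooth frame are. -/
lemma mdifferentiableAt_of_frame [IsManifold I ∞ M] [I.Boundaryless] [FiniteDimensional ℝ E]
    {F : M → E'} {T : M → E' →L[ℝ] G} {x : M} (hF : ContMDiffAt I 𝓘(ℝ, E') ∞ F x)
    (hT : ContMDiffAt I 𝓘(ℝ, E' →L[ℝ] G) ∞ T x)
    (hΦ : Function.Bijective (fun u : TangentSpace I x => T x (mvfderiv I F x u)))
    (Z : (y : M) → TangentSpace I y)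
    (hZ : MDifferentiableAt I 𝓘(ℝ, G) (fun y => T y (mvfderiv I F y (Z y))) x) :
    MDifferentiableAt I I.tangent (fun y => (⟨y, Z y⟩ : TangentBundle I M)) x := by
  rw [mdifferentiableAt_section_iff_mvfderiv (mem_chart_source H x)]
  obtain ⟨B, hB, hev⟩ := exists_contMDiffAt_coframe_inverse hF hT hΦ
  refine MDifferentiableAt.congr_of_eventuallyEq
    ((hB.mdifferentiableAt (by simp)).clm_apply hZ) ?_
  filter_upwards [hev] with y hy
  exact hy (Z y)

/-- A vector field is smooth if its components in a smooth frame are. -/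
lemma contMDiffAt_of_frame [IsManifold I ∞ M] [I.Boundaryless] [FiniteDimensional ℝ E]
    {F : M → E'} {T : M → E' →L[ℝ] G} {x : M} (hF : ContMDiffAt I 𝓘(ℝ, E') ∞ F x)
    (hT : ContMDiffAt I 𝓘(ℝ, E' →L[ℝ] G) ∞ T x)
    (hΦ : Function.Bijective (fun u : TangentSpace I x => T x (mvfderiv I F x u)))
    (Z : (y : M) → TangentSpace I y)
    (hZ : ContMDiffAt I 𝓘(ℝ, G) ∞ (fun y => T y (mvfderiv I F y (Z y))) x) :
    ContMDiffAt I I.tangent ∞ (fun y => (⟨y, Z y⟩ : TangentBundle I M)) x := by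
  rw [contMDiffAt_section_iff_mvfderiv (mem_chart_source H x)]
  obtain ⟨B, hB, hev⟩ := exists_contMDiffAt_coframe_inverse hF hT hΦ
  refine (hB.clm_apply hZ).congr_of_eventuallyEq ?_
  filter_upwards [hev] with y hy
  exact hy (Z y)

end FrameCalculus

section Curvature

variable {E : Type*} [NormedAddCommGroup E] [NormedSpace ℝ E] [FiniteDimensional ℝ E]
  {H : Type*} [TopologicalSpace H] {I : ModelWithCorners ℝ E H}
  {M : Type*} [TopologicalSpace M] [ChartedSpace H M] [IsManifold I ∞ M]
  {E' : Type*} [NormedAddCommGroup E'] [NormedSpace ℝ E']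
  {G : Type*} [NormedAddCommGroup G] [NormedSpace ℝ G]

namespace WeylSpace

variable (W : WeylSpace I M)

/-- In the frame `T ∘ dF` of the tangent space at `x`, the Weyl connection is `d + A ∘ dF`. -/
def HasConnectionFormAt (F : M → E') (T : M → E' →L[ℝ] G) (A : M → E' →L[ℝ] G →L[ℝ] G) (x : M) :
    Prop :=
  ∀ Y : (y : M) → TangentSpace I y, MDifferentiableAt I I.tangent
      (fun y => (⟨y, Y y⟩ : TangentBundle I M)) x → ∀ u : TangentSpace I x,
    T x (mvfderiv I F x (W.D Y x u)) = mvfderiv I (fun y => T y (mvfderiv I F y (Y y))) x u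
      + A x (mvfderiv I F x u) (T x (mvfderiv I F x (Y x)))

variable {W}

lemma HasConnectionFormAt.torsion [I.Boundaryless] {F : M → E'} {T : M → E' →L[ℝ] G}
    {A : M → E' →L[ℝ] G →L[ℝ] G} {x : M} (h : W.HasConnectionFormAt F T A x)
    (hF : ContMDiffAt I 𝓘(ℝ, E') ∞ F x)
    (hT : MDifferentiableAt I 𝓘(ℝ, E' →L[ℝ] G) T x) (u v : TangentSpace I x) :
    mvfderiv I T x u (mvfderiv I F x v) - mvfderiv I T x v (mvfderiv I F x u)
      + A x (mvfderiv I F x u) (T x (mvfderiv I F x v))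
      - A x (mvfderiv I F x v) (T x (mvfderiv I F x u)) = 0 := by
  have : CompleteSpace E := FiniteDimensional.complete ℝ E
  have hU := FiberBundle.mdifferentiableAt_extend I E u
  have hV := FiberBundle.mdifferentiableAt_extend I E v
  have h1 := W.D.torsion_apply_eq_extend u v
  rw [W.torsion_free] at h1
  have h2 := congrArg (fun w => T x (mvfderiv I F x w)) h1
  simp only [map_sub] at h2
  rw [h _ hU, h _ hV] at h2
  have h3 := mvfderiv_form_mlieBracket hF hT hU hV
  simp only [FiberBundle.extend_apply_self] at h2 h3
  rw [← h3]
  have h4 : T x (mvfderiv I F x ((0 : (x : M) → TangentSpace I x →L[ℝ] TangentSpace I x →L[ℝ]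
    TangentSpace I x) x u v)) = 0 := by
    simp
  rw [h4] at h2
  rw [h2]
  abel

/-- The curvature of the Weyl connection in a frame, by the structure equation. -/
theorem HasConnectionFormAt.curvature [I.Boundaryless] {F : M → E'} {T : M → E' →L[ℝ] G}
    {A : M → E' →L[ℝ] G →L[ℝ] G} {x : M} (h : ∀ᶠ y in 𝓝 x, W.HasConnectionFormAt F T A y)
    (hF : ContMDiffAt I 𝓘(ℝ, E') ∞ F x) (hT : ContMDiffAt I 𝓘(ℝ, E' →L[ℝ] G) ∞ T x)
    (hA : ContMDiffAt I 𝓘(ℝ, E' →L[ℝ] G →L[ℝ] G) ∞ A x)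
    (hΦ : Function.Bijective (fun u : TangentSpace I x => T x (mvfderiv I F x u)))
    (u v w : TangentSpace I x) :
    T x (mvfderiv I F x (W.curvature x u v w)) =
      (mvfderiv I A x u (mvfderiv I F x v) - mvfderiv I A x v (mvfderiv I F x u))
        (T x (mvfderiv I F x w))
      + A x (mvfderiv I F x u) (A x (mvfderiv I F x v) (T x (mvfderiv I F x w)))
      - A x (mvfderiv I F x v) (A x (mvfderiv I F x u) (T x (mvfderiv I F x w))) := by
  have : CompleteSpace E := FiniteDimensional.complete ℝ E
  set s : M → G := fun y => T y (mvfderiv I F y (FiberBundle.extend E w y)) with hs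
  have hWs : ContMDiffAt I I.tangent ∞
      (fun y => (⟨y, FiberBundle.extend E w y⟩ : TangentBundle I M)) x :=
    FiberBundle.contMDiffAt_extend I E w
  have hsx : ContMDiffAt I 𝓘(ℝ, G) ∞ s x := hT.clm_apply (ContMDiffAt.mvfderiv_vectorField hF hWs)
  have hWev : ∀ᶠ y in 𝓝 x, MDifferentiableAt I I.tangent
      (fun y => (⟨y, FiberBundle.extend E w y⟩ : TangentBundle I M)) y := by
    obtain ⟨t, ht, ht'⟩ := FiberBundle.exists_contMDiffOn_extend (k := 1) I E w
    filter_upwards [eventually_mem_nhds_iff.2 ht] with y hy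
    exact (ht'.contMDiffAt hy).mdifferentiableAt one_ne_zero
  have key : ∀ V : (y : M) → TangentSpace I y,
      ContMDiffAt I I.tangent ∞ (fun y => (⟨y, V y⟩ : TangentBundle I M)) x →
      ∀ u : TangentSpace I x,
      T x (mvfderiv I F x (W.D (fun y => W.D (FiberBundle.extend E w) y (V y)) x u)) =
        mvfderiv I (fun y => mvfderiv I s y (V y)) x u
        + (mvfderiv I (fun y => A y (mvfderiv I F y (V y))) x u) (s x)
        + A x (mvfderiv I F x (V x)) (mvfderiv I s x u)
        + A x (mvfderiv I F x u) (mvfderiv I s x (V x) + A x (mvfderiv I F x (V x)) (s x)) := by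
    intro V hV u
    set Z : (y : M) → TangentSpace I y := fun y => W.D (FiberBundle.extend E w) y (V y) with hZ
    have hZe : (fun y => T y (mvfderiv I F y (Z y))) =ᶠ[𝓝 x]
        fun y => mvfderiv I s y (V y) + A y (mvfderiv I F y (V y)) (s y) := by
      filter_upwards [h, hWev] with y hy hy'
      exact hy _ hy' (V y)
    have hAV := hA.clm_apply (ContMDiffAt.mvfderiv_vectorField hF hV)
    have hsV := ContMDiffAt.mvfderiv_vectorField hsx hV
    have hAs := (hAV.mdifferentiableAt (by simp)).clm_apply (hsx.mdifferentiableAt (by simp))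
    have hsm : MDifferentiableAt I 𝓘(ℝ, G) (fun y => T y (mvfderiv I F y (Z y))) x :=
      ((hsV.mdifferentiableAt (by simp)).add hAs).congr_of_eventuallyEq hZe
    have hZd := mdifferentiableAt_of_frame hF hT hΦ Z hsm
    rw [h.self_of_nhds Z hZd u]
    have h1 : mvfderiv I (fun y => T y (mvfderiv I F y (Z y))) x u =
        mvfderiv I (fun y => mvfderiv I s y (V y) + A y (mvfderiv I F y (V y)) (s y)) x u :=
      congrArg (fun B => B u) hZe.mvfderiv_eq
    rw [h1, mvfderiv_fun_add (hsV.mdifferentiableAt (by simp)) hAs, add_apply,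
      mvfderiv_clm_apply (hAV.mdifferentiableAt (by simp)) (hsx.mdifferentiableAt (by simp)),
      show T x (mvfderiv I F x (Z x)) = _ from hZe.self_of_nhds]
    abel
  have hU := FiberBundle.mdifferentiableAt_extend I E u
  have hV := FiberBundle.mdifferentiableAt_extend I E v
  unfold WeylSpace.curvature
  rw [map_sub, map_sub, map_sub, map_sub, key _ (FiberBundle.contMDiffAt_extend I E v),
    key _ (FiberBundle.contMDiffAt_extend I E u), h.self_of_nhds _ hWev.self_of_nhds]
  have h1 := mvfderiv_mlieBracket hsx hU hV
  have h2 := mvfderiv_form_mlieBracket hF (hA.mdifferentiableAt (by simp)) hU hV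
  have h3 := congrArg (fun B => B (s x)) h2
  simp only [FiberBundle.extend_apply_self, sub_apply] at h1 h2 h3 ⊢
  have h4 : T x (mvfderiv I F x w) = s x := by simp [hs]
  rw [h4, ← h3, ← h1]
  simp only [map_add]
  abel


open Matrix in
/-- The Ricci tensor of a Weyl connection from the curvature in a conformal frame. -/
theorem ricci_eq_of_frame (W : WeylSpace I M) {x : M} (Φ : TangentSpace I x ≃ₗ[ℝ] (Fin 3 → ℝ))
    (f δ : (Fin 3 → ℝ) →ₗ[ℝ] (Fin 3 → ℝ) →ₗ[ℝ] ℝ) (β : (Fin 3 → ℝ) →ₗ[ℝ] ℝ) (k : ℝ)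
    (h : ∀ u v w, Φ (W.curvature x u v w) = f (Φ u) (Φ v) • Φ w
      + (β (Φ u) • Φ v - β (Φ v) • Φ u - k • (Φ u ⨯₃ Φ v) + δ (Φ u) (Φ v) • Pi.single 0 1) ⨯₃ Φ w)
    (v w : TangentSpace I x) :
    W.ricci x v w = f (Φ w) (Φ v) + β (Φ v ⨯₃ Φ w) + 2 * k * (Φ v ⬝ᵥ Φ w)
      + δ (Pi.single 0 1 ⨯₃ Φ w) (Φ v) := by
  set L : (Fin 3 → ℝ) →ₗ[ℝ] (Fin 3 → ℝ) :=
    (f.flip (Φ v)).smulRight (Φ w) + (crossProduct.flip (Φ w)) ∘ₗ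
      (β.smulRight (Φ v) - β (Φ v) • LinearMap.id - k • (crossProduct.flip (Φ v))
        + (δ.flip (Φ v)).smulRight (Pi.single 0 1)) with hL
  have hLu : ∀ u, W.curvature x u v w = Φ.symm (L (Φ u)) := by
    intro u
    rw [LinearEquiv.eq_symm_apply, h]
    simp [hL]
  set b : Module.Basis (Fin (Module.finrank ℝ E)) ℝ (TangentSpace I x) := Module.finBasis ℝ E
  have h1 : W.ricci x v w = LinearMap.trace ℝ _ (Φ.symm.conj L) := by
    rw [LinearMap.trace_eq_matrix_trace ℝ b]
    unfold WeylSpace.ricci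
    simp only [Matrix.trace, Matrix.diag, LinearMap.toMatrix_apply]
    refine Finset.sum_congr rfl fun i _ => ?_
    rw [hLu]
    rfl
  rw [h1, LinearMap.trace_conj', LinearMap.trace_eq_matrix_trace ℝ (Pi.basisFun ℝ (Fin 3))]
  simp only [Matrix.trace, Matrix.diag, LinearMap.toMatrix_apply, Fin.sum_univ_three, hL,
    Pi.basisFun_apply, Pi.basisFun_repr]
  have hexp : ∀ y : Fin 3 → ℝ, y = y 0 • Pi.single 0 1 + y 1 • Pi.single 1 1
      + y 2 • (Pi.single 2 1 : Fin 3 → ℝ) := by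
    intro y; ext i; fin_cases i <;> simp
  have e1 : (Φ v ⨯₃ Φ w) = (Φ v 1 * Φ w 2 - Φ v 2 * Φ w 1) • Pi.single 0 1
      + (Φ v 2 * Φ w 0 - Φ v 0 * Φ w 2) • Pi.single 1 1
      + (Φ v 0 * Φ w 1 - Φ v 1 * Φ w 0) • (Pi.single 2 1 : Fin 3 → ℝ) := by
    ext i; fin_cases i <;> simp [cross_apply]
  have e2 : ((Pi.single 0 1 : Fin 3 → ℝ) ⨯₃ Φ w) = (- Φ w 2) • Pi.single 1 1
      + Φ w 1 • (Pi.single 2 1 : Fin 3 → ℝ) := by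
    ext i; fin_cases i <;> simp [cross_apply]
  have e3 := hexp (Φ w)
  have e4 : f (Φ w) (Φ v) = Φ w 0 * f (Pi.single 0 1) (Φ v) + Φ w 1 * f (Pi.single 1 1) (Φ v)
      + Φ w 2 * f (Pi.single 2 1) (Φ v) := by
    conv_lhs => rw [e3]
    simp
  rw [e1, e2, e4]
  simp [cross_apply, dotProduct, Fin.sum_univ_three, Matrix.vecHead, Matrix.vecTail]
  ring

end WeylSpace

end Curvature

section CrossProduct

open Matrix

/-- The cross product as a continuous bilinear map. -/
noncomputable def crossL : (Fin 3 → ℝ) →L[ℝ] (Fin 3 → ℝ) →L[ℝ] (Fin 3 → ℝ) :=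
  LinearMap.toContinuousBilinearMap crossProduct

@[simp] lemma crossL_apply (a b : Fin 3 → ℝ) : crossL a b = a ⨯₃ b := rfl

variable {E' : Type*} [NormedAddCommGroup E'] [NormedSpace ℝ E']

/-- The connection form with trace part `om` and skew part `a`. -/
noncomputable def weylForm (om : E' →L[ℝ] ℝ) (a : E' →L[ℝ] (Fin 3 → ℝ)) :
    E' →L[ℝ] (Fin 3 → ℝ) →L[ℝ] (Fin 3 → ℝ) :=
  (ContinuousLinearMap.toSpanSingleton ℝ (ContinuousLinearMap.id ℝ (Fin 3 → ℝ))).comp om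
    + crossL.comp a

@[simp] lemma weylForm_apply (om : E' →L[ℝ] ℝ) (a : E' →L[ℝ] (Fin 3 → ℝ)) (u : E')
    (s : Fin 3 → ℝ) : weylForm om a u s = om u • s + a u ⨯₃ s := by
  simp [weylForm]

lemma structure_equation_identity (ou ov ku kv k au av f δ : ℝ) (X Y S D : Fin 3 → ℝ)
    (hD : D + (ou • Y + (k • X + au • Pi.single 0 1) ⨯₃ Y)
      - (ov • X + (k • Y + av • Pi.single 0 1) ⨯₃ X) = 0) :
    f • S + (ku • Y - kv • X + k • D + δ • Pi.single 0 1) ⨯₃ S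
      + (ou • (ov • S + (k • Y + av • Pi.single 0 1) ⨯₃ S)
        + (k • X + au • Pi.single 0 1) ⨯₃ (ov • S + (k • Y + av • Pi.single 0 1) ⨯₃ S))
      - (ov • (ou • S + (k • X + au • Pi.single 0 1) ⨯₃ S)
        + (k • Y + av • Pi.single 0 1) ⨯₃ (ou • S + (k • X + au • Pi.single 0 1) ⨯₃ S))
    = f • S + ((ku - k * ou) • Y - (kv - k * ov) • X - k ^ 2 • (X ⨯₃ Y)
        + δ • Pi.single 0 1) ⨯₃ S := by
  have hD' : D = (ov • X + (k • Y + av • Pi.single 0 1) ⨯₃ X)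
      - (ou • Y + (k • X + au • Pi.single 0 1) ⨯₃ Y) := by
    rw [← sub_eq_zero, ← hD]; abel
  subst hD'
  ext i
  fin_cases i <;> simp [cross_apply, Matrix.vecHead, Matrix.vecTail] <;> ring

end CrossProduct

section

variable {E : Type*} [NormedAddCommGroup E] [NormedSpace ℝ E]
  {H : Type*} [TopologicalSpace H] {I : ModelWithCorners ℝ E H}
  {M : Type*} [TopologicalSpace M] [ChartedSpace H M]
  {E' : Type*} [NormedAddCommGroup E'] [NormedSpace ℝ E']
  {G : Type*} [NormedAddCommGroup G] [NormedSpace ℝ G]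
  {G' : Type*} [NormedAddCommGroup G'] [NormedSpace ℝ G']

lemma mvfderiv_clm_comp {s : M → G} {x : M} (L : G →L[ℝ] G')
    (hs : MDifferentiableAt I 𝓘(ℝ, G) s x) (u : TangentSpace I x) :
    mvfderiv I (fun y => L (s y)) x u = L (mvfderiv I s x u) := by
  have h := mfderiv_comp x (L.mdifferentiableAt (x := s x)) hs
  rw [ContinuousLinearMap.mfderiv_eq] at h
  exact congrArg (fun A : TangentSpace I x →L[ℝ] G' => A u) h

lemma mvfderiv_clm_apply_const {T : M → E' →L[ℝ] G} {x : M}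
    (hT : MDifferentiableAt I 𝓘(ℝ, E' →L[ℝ] G) T x) (c : E') (u : TangentSpace I x) :
    mvfderiv I (fun y => T y c) x u = mvfderiv I T x u c :=
  mvfderiv_clm_comp (ContinuousLinearMap.apply ℝ G c) hT u

set_option synthInstance.maxHeartbeats 200000 in
lemma ContMDiffAt.weylForm {om : M → E' →L[ℝ] ℝ} {a : M → E' →L[ℝ] (Fin 3 → ℝ)} {x : M}
    (hom : ContMDiffAt I 𝓘(ℝ, E' →L[ℝ] ℝ) ∞ om x)
    (ha : ContMDiffAt I 𝓘(ℝ, E' →L[ℝ] (Fin 3 → ℝ)) ∞ a x) :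
    ContMDiffAt I 𝓘(ℝ, E' →L[ℝ] (Fin 3 → ℝ) →L[ℝ] (Fin 3 → ℝ)) ∞
      (fun y => weylForm (om y) (a y)) x :=
  (contMDiffAt_const.clm_comp hom).add (contMDiffAt_const.clm_comp ha)

lemma mvfderiv_weylForm {om : M → E' →L[ℝ] ℝ} {a : M → E' →L[ℝ] (Fin 3 → ℝ)} {x : M}
    (hom : ContMDiffAt I 𝓘(ℝ, E' →L[ℝ] ℝ) ∞ om x)
    (ha : ContMDiffAt I 𝓘(ℝ, E' →L[ℝ] (Fin 3 → ℝ)) ∞ a x) (u : TangentSpace I x) (e : E')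
    (s : Fin 3 → ℝ) :
    mvfderiv I (fun y => weylForm (om y) (a y)) x u e s =
      mvfderiv I om x u e • s + crossL (mvfderiv I a x u e) s := by
  have hA := ((ContMDiffAt.weylForm hom ha).mdifferentiableAt (by simp))
  have hom' := hom.mdifferentiableAt (by simp)
  have ha' := ha.mdifferentiableAt (by simp)
  have h1 := mvfderiv_clm_apply_const hA e u
  have h2 := mvfderiv_clm_apply_const (hA.clm_apply (mdifferentiableAt_const (c := e))) s u
  rw [← h1, ← h2]
  simp only [weylForm_apply]
  have ho := hom'.clm_apply (mdifferentiableAt_const (c := e))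
  have hae := ha'.clm_apply (mdifferentiableAt_const (c := e))
  have h3 := mvfderiv_clm_comp (crossL.flip s) hae u
  have h4 := mvfderiv_clm_comp (ContinuousLinearMap.toSpanSingleton ℝ s) ho u
  have d3 : MDifferentiableAt I 𝓘(ℝ, Fin 3 → ℝ) (fun y => crossL.flip s (a y e)) x :=
    (crossL.flip s).mdifferentiableAt.comp x hae
  have d4 : MDifferentiableAt I 𝓘(ℝ, Fin 3 → ℝ)
      (fun y => ContinuousLinearMap.toSpanSingleton ℝ s (om y e)) x :=
    (ContinuousLinearMap.toSpanSingleton ℝ s).mdifferentiableAt.comp x ho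
  rw [mvfderiv_clm_apply_const hom'] at h4
  rw [mvfderiv_clm_apply_const ha'] at h3
  have h5 := congrArg (fun A => A u) (mvfderiv_fun_add d4 d3)
  simp only [add_apply, h3, h4] at h5
  exact h5

lemma mvfderiv_smul_add_smulRight {T : M → E' →L[ℝ] G} {κ : M → ℝ} {α : M → E' →L[ℝ] ℝ} {x : M}
    (hT : MDifferentiableAt I 𝓘(ℝ, E' →L[ℝ] G) T x) (hκ : MDifferentiableAt I 𝓘(ℝ, ℝ) κ x)
    (hα : MDifferentiableAt I 𝓘(ℝ, E' →L[ℝ] ℝ) α x) (c : G) (u : TangentSpace I x) (e : E') :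
    mvfderiv I (fun y => κ y • T y + (ContinuousLinearMap.toSpanSingleton ℝ c).comp (α y)) x u e =
      mvfderiv I κ x u • T x e + κ x • mvfderiv I T x u e + mvfderiv I α x u e • c := by
  have d1 : MDifferentiableAt I 𝓘(ℝ, E' →L[ℝ] G) (fun y => κ y • T y) x := hκ.smul hT
  have d2 : MDifferentiableAt I 𝓘(ℝ, E' →L[ℝ] G)
      (fun y => (ContinuousLinearMap.toSpanSingleton ℝ c).comp (α y)) x :=
    mdifferentiableAt_const.clm_comp hα
  rw [mvfderiv_fun_add d1 d2, mvfderiv_fun_smul hκ hT]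
  have h4 := mvfderiv_clm_comp (ContinuousLinearMap.toSpanSingleton ℝ c)
    (hα.clm_apply (mdifferentiableAt_const (c := e))) u
  have h5 := mvfderiv_clm_apply_const d2 e u
  rw [mvfderiv_clm_apply_const hα] at h4
  simp only [ContinuousLinearMap.comp_apply] at h5
  simp only [add_apply, ContinuousLinearMap.smulRight_apply, smul_apply]
  rw [← h5, h4]
  simp
  abel

end

section Ricci

open Matrix

variable {E : Type*} [NormedAddCommGroup E] [NormedSpace ℝ E] [FiniteDimensional ℝ E]
  {H : Type*} [TopologicalSpace H] {I : ModelWithCorners ℝ E H} [I.Boundaryless]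
  {M : Type*} [TopologicalSpace M] [ChartedSpace H M] [IsManifold I ∞ M]
  {E' : Type*} [NormedAddCommGroup E'] [NormedSpace ℝ E']

namespace WeylSpace

variable {W : WeylSpace I M}

/-- The exterior derivative of the one-form `α ∘ dF`. -/
noncomputable def formDeriv (F : M → E') (α : M → E' →L[ℝ] ℝ) (x : M) :
    TangentSpace I x →ₗ[ℝ] TangentSpace I x →ₗ[ℝ] ℝ :=
  LinearMap.mk₂ ℝ (fun u v => mvfderiv I α x u (mvfderiv I F x v)
      - mvfderiv I α x v (mvfderiv I F x u))
    (by intros; simp; ring) (by intros; simp; ring) (by intros; simp; ring) (by intros; simp; ring)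

lemma formDeriv_apply (F : M → E') (α : M → E' →L[ℝ] ℝ) (x : M) (u v : TangentSpace I x) :
    formDeriv F α x u v = mvfderiv I α x u (mvfderiv I F x v)
      - mvfderiv I α x v (mvfderiv I F x u) := rfl

theorem HasConnectionFormAt.ricci {F : M → E'} {T : M → E' →L[ℝ] (Fin 3 → ℝ)}
    {om α : M → E' →L[ℝ] ℝ} {κ : M → ℝ} {x : M}
    (h : ∀ᶠ y in 𝓝 x, W.HasConnectionFormAt F T (fun y => weylForm (om y)
      (κ y • T y + (ContinuousLinearMap.toSpanSingleton ℝ (Pi.single 0 1)).comp (α y))) y)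
    (hF : ContMDiffAt I 𝓘(ℝ, E') ∞ F x)
    (hT : ContMDiffAt I 𝓘(ℝ, E' →L[ℝ] (Fin 3 → ℝ)) ∞ T x)
    (hom : ContMDiffAt I 𝓘(ℝ, E' →L[ℝ] ℝ) ∞ om x)
    (hα : ContMDiffAt I 𝓘(ℝ, E' →L[ℝ] ℝ) ∞ α x)
    (hκ : ContMDiffAt I 𝓘(ℝ, ℝ) ∞ κ x) (Φ : TangentSpace I x ≃ₗ[ℝ] (Fin 3 → ℝ))
    (hΦ : ∀ u, Φ u = T x (mvfderiv I F x u)) :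
    (∀ u v w, Φ (W.curvature x u v w) = formDeriv F om x u v • Φ w
      + ((mvfderiv I κ x u - κ x * om x (mvfderiv I F x u)) • Φ v
        - (mvfderiv I κ x v - κ x * om x (mvfderiv I F x v)) • Φ u - κ x ^ 2 • (Φ u ⨯₃ Φ v)
        + formDeriv F α x u v • Pi.single 0 1) ⨯₃ Φ w) ∧
    ∀ v w, (W.ricci x v w + W.ricci x w v) / 2 = 2 * κ x ^ 2 * (Φ v ⬝ᵥ Φ w)
      + (formDeriv F α x (Φ.symm (Pi.single 0 1 ⨯₃ Φ w)) v
        + formDeriv F α x (Φ.symm (Pi.single 0 1 ⨯₃ Φ v)) w) / 2 := by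
  have hbij : Function.Bijective (fun u : TangentSpace I x => T x (mvfderiv I F x u)) := by
    have : (fun u : TangentSpace I x => T x (mvfderiv I F x u)) = Φ := by
      ext u : 1; exact (hΦ u).symm
    rw [this]; exact Φ.bijective
  have ha : ContMDiffAt I 𝓘(ℝ, E' →L[ℝ] (Fin 3 → ℝ)) ∞ (fun y =>
      κ y • T y + (ContinuousLinearMap.toSpanSingleton ℝ (Pi.single 0 1)).comp (α y)) x :=
    (hκ.smul hT).add (contMDiffAt_const.clm_comp hα)
  have hA := ContMDiffAt.weylForm hom ha
  have hcurv : ∀ u v w, Φ (W.curvature x u v w) = formDeriv F om x u v • Φ w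
      + ((mvfderiv I κ x u - κ x * om x (mvfderiv I F x u)) • Φ v
        - (mvfderiv I κ x v - κ x * om x (mvfderiv I F x v)) • Φ u - κ x ^ 2 • (Φ u ⨯₃ Φ v)
        + formDeriv F α x u v • Pi.single 0 1) ⨯₃ Φ w := by
    intro u v w
    have h1 := HasConnectionFormAt.curvature h hF hT hA hbij u v w
    have h2 := h.self_of_nhds.torsion hF (hT.mdifferentiableAt (by simp)) u v
    have dT := hT.mdifferentiableAt (n := ∞) (by simp)
    have dκ := hκ.mdifferentiableAt (n := ∞) (by simp)
    have dα := hα.mdifferentiableAt (n := ∞) (by simp)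
    simp only [_root_.sub_apply, mvfderiv_weylForm hom ha, mvfderiv_smul_add_smulRight dT dκ dα] at h1
    rw [hΦ, h1]
    simp only [weylForm_apply, _root_.add_apply, _root_.smul_apply, ContinuousLinearMap.comp_apply,
      ContinuousLinearMap.toSpanSingleton_apply, ← hΦ] at h2 ⊢
    rw [← structure_equation_identity (om x (mvfderiv I F x u)) (om x (mvfderiv I F x v))
      (mvfderiv I κ x u) (mvfderiv I κ x v) (κ x) (α x (mvfderiv I F x u))
      (α x (mvfderiv I F x v)) _ _ (Φ u) (Φ v) (Φ w) _ h2]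
    simp only [formDeriv_apply, crossL_apply]
    simp only [map_add, map_smul, map_sub, smul_sub, sub_smul, LinearMap.add_apply,
      LinearMap.sub_apply, LinearMap.smul_apply]
    abel
  refine ⟨hcurv, fun v w => ?_⟩
  set β : (Fin 3 → ℝ) →ₗ[ℝ] ℝ := ((mvfderiv I κ x : TangentSpace I x →L[ℝ] ℝ)
    - κ x • (om x).comp (mvfderiv I F x) : TangentSpace I x →L[ℝ] ℝ).toLinearMap ∘ₗ
      Φ.symm.toLinearMap with hβ
  have hric := fun v w => ricci_eq_of_frame W Φ
    ((formDeriv F om x).compl₁₂ Φ.symm.toLinearMap Φ.symm.toLinearMap)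
    ((formDeriv F α x).compl₁₂ Φ.symm.toLinearMap Φ.symm.toLinearMap) β (κ x ^ 2)
    (by
      intro u v w
      rw [hcurv]
      simp [hβ]) v w
  have hanti : β (Φ w ⨯₃ Φ v) = -β (Φ v ⨯₃ Φ w) := by
    rw [← map_neg, cross_anticomm]
  rw [hric, hric, hanti, dotProduct_comm (Φ w) (Φ v)]
  simp only [LinearMap.compl₁₂_apply, formDeriv_apply, LinearEquiv.coe_coe,
    LinearEquiv.symm_apply_apply]
  ring

end WeylSpace

end Ricci

section TodaFrame

open Matrix

variable {E : Type*} [NormedAddCommGroup E] [NormedSpace ℝ E]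
  {G : Type*} [NormedAddCommGroup G] [NormedSpace ℝ G]

/-- The dot product as a continuous bilinear map. -/
noncomputable def dotL : (Fin 3 → ℝ) →L[ℝ] (Fin 3 → ℝ) →L[ℝ] ℝ :=
  LinearMap.toContinuousBilinearMap (LinearMap.mk₂ ℝ (fun a b => a ⬝ᵥ b) add_dotProduct
    (fun c a b => smul_dotProduct c a b) dotProduct_add (fun c a b => dotProduct_smul c a b))

@[simp] lemma dotL_apply (a b : Fin 3 → ℝ) : dotL a b = a ⬝ᵥ b := rfl

lemma HasFDerivAt.dotProduct {a b : E → Fin 3 → ℝ} {a' b' : E →L[ℝ] Fin 3 → ℝ} {y : E}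
    (ha : HasFDerivAt a a' y) (hb : HasFDerivAt b b' y) :
    HasFDerivAt (fun y => a y ⬝ᵥ b y) (dotL.precompR E (a y) b' + dotL.precompL E a' (b y)) y :=
  dotL.hasFDerivAt_of_bilinear ha hb

lemma HasFDerivAt.crossProduct {a b : E → Fin 3 → ℝ} {a' b' : E →L[ℝ] Fin 3 → ℝ} {y : E}
    (ha : HasFDerivAt a a' y) (hb : HasFDerivAt b b' y) :
    HasFDerivAt (fun y => a y ⨯₃ b y) (crossL.precompR E (a y) b' + crossL.precompL E a' (b y)) y :=
  crossL.hasFDerivAt_of_bilinear ha hb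

lemma HasFDerivAt.clm_apply_const {T : E → E →L[ℝ] G} {y : E} {T' : E →L[ℝ] E →L[ℝ] G}
    (hT : HasFDerivAt T T' y) (v : E) : HasFDerivAt (fun y => T y v) (T'.flip v) y := by
  have := hT.clm_apply (hasFDerivAt_const v y)
  convert this using 1
  ext; simp

/-- The exterior derivative squares to zero on one-forms. -/
lemma fderiv_fderiv_cyclic {N : E → E →L[ℝ] G} {y : E} (hN : ContDiffAt ℝ ∞ N y) (u v w : E) :
    fderiv ℝ (fun y => fderiv ℝ N y u v - fderiv ℝ N y v u) y w
      + fderiv ℝ (fun y => fderiv ℝ N y v w - fderiv ℝ N y w v) y u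
      + fderiv ℝ (fun y => fderiv ℝ N y w u - fderiv ℝ N y u w) y v = 0 := by
  have hs : IsSymmSndFDerivAt ℝ N y := hN.isSymmSndFDerivAt (by simp; exact WithTop.coe_le_coe.2 le_top)
  have hd : HasFDerivAt (fderiv ℝ N) (fderiv ℝ (fderiv ℝ N) y) y :=
    ((hN.fderiv_right (m := 1) (by norm_cast)).differentiableAt one_ne_zero).hasFDerivAt
  have key : ∀ a b c : E, fderiv ℝ (fun y => fderiv ℝ N y a b - fderiv ℝ N y b a) y c =
      fderiv ℝ (fderiv ℝ N) y c a b - fderiv ℝ (fderiv ℝ N) y c b a := by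
    intro a b c
    have h := ((hd.clm_apply_const a).clm_apply (hasFDerivAt_const b y)).fun_sub
      ((hd.clm_apply_const b).clm_apply (hasFDerivAt_const a y))
    rw [h.fderiv]
    simp
  rw [key, key, key, hs.eq w u, hs.eq w v, hs.eq u v]
  abel

lemma fderiv_fderiv_symm {N : E → G} {y : E} (hN : ContDiffAt ℝ ∞ N y) (u v : E) :
    fderiv ℝ (fun y => fderiv ℝ N y v) y u = fderiv ℝ (fun y => fderiv ℝ N y u) y v := by
  have hs : IsSymmSndFDerivAt ℝ N y := hN.isSymmSndFDerivAt (by simp; exact WithTop.coe_le_coe.2 le_top)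
  have hd : HasFDerivAt (fderiv ℝ N) (fderiv ℝ (fderiv ℝ N) y) y :=
    ((hN.fderiv_right (m := 1) (by norm_cast)).differentiableAt one_ne_zero).hasFDerivAt
  rw [(hd.clm_apply_const v).fderiv, (hd.clm_apply_const u).fderiv]
  exact hs.eq u v

lemma exists_eq_smul_add_smul_add_smul_cross {p X : Fin 3 → ℝ} (hp : p ⬝ᵥ p = 1) (hX : X ≠ 0)
    (hXp : X ⬝ᵥ p = 0) (Y : Fin 3 → ℝ) :
    ∃ a b c : ℝ, Y = a • p + b • X + c • (p ⨯₃ X) := by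
  have hN : (p ⨯₃ X) ⬝ᵥ (p ⨯₃ X) = X ⬝ᵥ X := by
    rw [cross_dot_cross, hp, hXp]; ring
  have hne : X ⬝ᵥ X ≠ 0 := by rwa [Ne, dotProduct_self_eq_zero]
  refine ⟨(X ⬝ᵥ X)⁻¹ * (Y ⬝ᵥ (X ⨯₃ (p ⨯₃ X))), (X ⬝ᵥ X)⁻¹ * (Y ⬝ᵥ ((p ⨯₃ X) ⨯₃ p)),
    (X ⬝ᵥ X)⁻¹ * (Y ⬝ᵥ (p ⨯₃ X)), ?_⟩
  simp only [mul_smul, ← smul_add]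
  rw [eq_inv_smul_iff₀ hne, ← hN]
  ext i
  fin_cases i <;> simp [cross_apply, dotProduct, Fin.sum_univ_three, Matrix.vecHead,
    Matrix.vecTail] <;> ring

/-- A solution of the structure equations of an Einstein-Weyl space with a Toda and a hyperCR
congruence: `T` is the conformal coframe that is adapted to the hyperCR congruence, of twist `κ`,
and `-p` are the components of the Toda congruence, of divergence `-τ`. -/
structure IsTodaFrame (Ω : Set E) (T : E → E →L[ℝ] (Fin 3 → ℝ)) (om : E → E →L[ℝ] ℝ)
    (κ τ : E → ℝ) (p : E → Fin 3 → ℝ) : Prop where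
  isOpen : IsOpen Ω
  contDiff_T : ContDiffOn ℝ ∞ T Ω
  contDiff_om : ContDiffOn ℝ ∞ om Ω
  contDiff_κ : ContDiffOn ℝ ∞ κ Ω
  contDiff_τ : ContDiffOn ℝ ∞ τ Ω
  contDiff_p : ContDiffOn ℝ ∞ p Ω
  bijective : ∀ y ∈ Ω, Function.Bijective (T y)
  deriv_T : ∀ y ∈ Ω, ∀ u v, fderiv ℝ T y u v - fderiv ℝ T y v u
    = om y v • T y u - om y u • T y v - (2 * κ y) • (T y u ⨯₃ T y v)
  unit : ∀ y ∈ Ω, p y ⬝ᵥ p y = 1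
  deriv_p : ∀ y ∈ Ω, ∀ u, fderiv ℝ p y u
    = τ y • (T y u - (T y u ⬝ᵥ p y) • p y) + κ y • (p y ⨯₃ T y u)

namespace IsTodaFrame

variable {Ω : Set E} {T : E → E →L[ℝ] (Fin 3 → ℝ)} {om : E → E →L[ℝ] ℝ}
    {κ τ : E → ℝ} {p : E → Fin 3 → ℝ} {y : E}

lemma contDiffAt_T (h : IsTodaFrame Ω T om κ τ p) (hy : y ∈ Ω) : ContDiffAt ℝ ∞ T y :=
  h.contDiff_T.contDiffAt (h.isOpen.mem_nhds hy)
lemma contDiffAt_om (h : IsTodaFrame Ω T om κ τ p) (hy : y ∈ Ω) : ContDiffAt ℝ ∞ om y :=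
  h.contDiff_om.contDiffAt (h.isOpen.mem_nhds hy)
lemma contDiffAt_κ (h : IsTodaFrame Ω T om κ τ p) (hy : y ∈ Ω) : ContDiffAt ℝ ∞ κ y :=
  h.contDiff_κ.contDiffAt (h.isOpen.mem_nhds hy)
lemma contDiffAt_τ (h : IsTodaFrame Ω T om κ τ p) (hy : y ∈ Ω) : ContDiffAt ℝ ∞ τ y :=
  h.contDiff_τ.contDiffAt (h.isOpen.mem_nhds hy)
lemma contDiffAt_p (h : IsTodaFrame Ω T om κ τ p) (hy : y ∈ Ω) : ContDiffAt ℝ ∞ p y :=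
  h.contDiff_p.contDiffAt (h.isOpen.mem_nhds hy)

lemma hasFDerivAt_T (h : IsTodaFrame Ω T om κ τ p) (hy : y ∈ Ω) :
    HasFDerivAt T (fderiv ℝ T y) y :=
  ((h.contDiffAt_T hy).differentiableAt (by simp)).hasFDerivAt
lemma hasFDerivAt_om (h : IsTodaFrame Ω T om κ τ p) (hy : y ∈ Ω) :
    HasFDerivAt om (fderiv ℝ om y) y :=
  ((h.contDiffAt_om hy).differentiableAt (by simp)).hasFDerivAt
lemma hasFDerivAt_κ (h : IsTodaFrame Ω T om κ τ p) (hy : y ∈ Ω) :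
    HasFDerivAt κ (fderiv ℝ κ y) y :=
  ((h.contDiffAt_κ hy).differentiableAt (by simp)).hasFDerivAt
lemma hasFDerivAt_τ (h : IsTodaFrame Ω T om κ τ p) (hy : y ∈ Ω) :
    HasFDerivAt τ (fderiv ℝ τ y) y :=
  ((h.contDiffAt_τ hy).differentiableAt (by simp)).hasFDerivAt
lemma hasFDerivAt_p (h : IsTodaFrame Ω T om κ τ p) (hy : y ∈ Ω) :
    HasFDerivAt p (fderiv ℝ p y) y :=
  ((h.contDiffAt_p hy).differentiableAt (by simp)).hasFDerivAt

/-- The integrability condition `d²T = 0`. -/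
lemma deriv_om_cyclic (h : IsTodaFrame Ω T om κ τ p) (hy : y ∈ Ω) (u v w : E) :
    (fderiv ℝ om y u v - fderiv ℝ om y v u) • T y w
      + (fderiv ℝ om y v w - fderiv ℝ om y w v) • T y u
      + (fderiv ℝ om y w u - fderiv ℝ om y u w) • T y v
    = -(2 * (fderiv ℝ κ y w - κ y * om y w)) • (T y u ⨯₃ T y v)
      - (2 * (fderiv ℝ κ y u - κ y * om y u)) • (T y v ⨯₃ T y w)
      - (2 * (fderiv ℝ κ y v - κ y * om y v)) • (T y w ⨯₃ T y u) := by
  have hT := h.hasFDerivAt_T hy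
  have hom := h.hasFDerivAt_om hy
  have hκ := h.hasFDerivAt_κ hy
  have key : ∀ a b c : E, fderiv ℝ (fun y => fderiv ℝ T y a b - fderiv ℝ T y b a) y c =
      fderiv ℝ om y c b • T y a + om y b • fderiv ℝ T y c a
      - (fderiv ℝ om y c a • T y b + om y a • fderiv ℝ T y c b)
      - ((2 * fderiv ℝ κ y c) • (T y a ⨯₃ T y b)
        + (2 * κ y) • (fderiv ℝ T y c a ⨯₃ T y b + T y a ⨯₃ fderiv ℝ T y c b)) := by
    intro a b c
    have hev : (fun y => fderiv ℝ T y a b - fderiv ℝ T y b a) =ᶠ[𝓝 y]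
        (fun y => om y b • T y a - om y a • T y b - (2 * κ y) • (T y a ⨯₃ T y b)) := by
      filter_upwards [h.isOpen.mem_nhds hy] with z hz using h.deriv_T z hz a b
    have hTa := hT.clm_apply_const a
    have hTb := hT.clm_apply_const b
    have hd := (((hom.clm_apply_const b).fun_smul hTa).fun_sub
      ((hom.clm_apply_const a).fun_smul hTb)).fun_sub
      ((hκ.const_mul 2).fun_smul (hTa.crossProduct hTb))
    rw [hev.fderiv_eq, hd.fderiv]
    simp
    abel
  have h0 := fderiv_fderiv_cyclic (h.contDiffAt_T hy) u v w
  rw [key, key, key] at h0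
  have e1 : fderiv ℝ T y u v = fderiv ℝ T y v u + (om y v • T y u - om y u • T y v
      - (2 * κ y) • (T y u ⨯₃ T y v)) := by rw [← h.deriv_T y hy]; abel
  have e2 : fderiv ℝ T y v w = fderiv ℝ T y w v + (om y w • T y v - om y v • T y w
      - (2 * κ y) • (T y v ⨯₃ T y w)) := by rw [← h.deriv_T y hy]; abel
  have e3 : fderiv ℝ T y w u = fderiv ℝ T y u w + (om y u • T y w - om y w • T y u
      - (2 * κ y) • (T y w ⨯₃ T y u)) := by rw [← h.deriv_T y hy]; abel
  rw [e1, e2, e3] at h0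
  rw [← sub_eq_zero, ← neg_eq_zero, ← h0]
  ext i
  fin_cases i <;> simp [cross_apply, Matrix.vecHead, Matrix.vecTail] <;> ring

/-- The integrability condition `d²p = 0`. -/
lemma deriv_p_symm (h : IsTodaFrame Ω T om κ τ p) (hy : y ∈ Ω) (u v : E) :
    (fderiv ℝ τ y u - τ y * om y u + (τ y ^ 2 + κ y ^ 2) * (T y u ⬝ᵥ p y))
        • (T y v - (T y v ⬝ᵥ p y) • p y)
      + (fderiv ℝ κ y u - κ y * om y u) • (p y ⨯₃ T y v)
    = (fderiv ℝ τ y v - τ y * om y v + (τ y ^ 2 + κ y ^ 2) * (T y v ⬝ᵥ p y))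
        • (T y u - (T y u ⬝ᵥ p y) • p y)
      + (fderiv ℝ κ y v - κ y * om y v) • (p y ⨯₃ T y u) := by
  have hT := h.hasFDerivAt_T hy
  have hκ := h.hasFDerivAt_κ hy
  have hτ := h.hasFDerivAt_τ hy
  have hp := h.hasFDerivAt_p hy
  have key : ∀ a c : E, fderiv ℝ (fun y => fderiv ℝ p y a) y c =
      fderiv ℝ τ y c • (T y a - (T y a ⬝ᵥ p y) • p y)
      + τ y • (fderiv ℝ T y c a
        - ((fderiv ℝ T y c a ⬝ᵥ p y + T y a ⬝ᵥ fderiv ℝ p y c) • p y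
          + (T y a ⬝ᵥ p y) • fderiv ℝ p y c))
      + (fderiv ℝ κ y c • (p y ⨯₃ T y a)
        + κ y • (fderiv ℝ p y c ⨯₃ T y a + p y ⨯₃ fderiv ℝ T y c a)) := by
    intro a c
    have hev : (fun y => fderiv ℝ p y a) =ᶠ[𝓝 y]
        (fun y => τ y • (T y a - (T y a ⬝ᵥ p y) • p y) + κ y • (p y ⨯₃ T y a)) := by
      filter_upwards [h.isOpen.mem_nhds hy] with z hz using h.deriv_p z hz a
    have hTa := hT.clm_apply_const a
    have hd := (hτ.fun_smul (hTa.fun_sub ((hTa.dotProduct hp).fun_smul hp))).fun_add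
      (hκ.fun_smul (hp.crossProduct hTa))
    rw [hev.fderiv_eq, hd.fderiv]
    simp
    abel_nf
  have h0 := fderiv_fderiv_symm (h.contDiffAt_p hy) u v
  rw [key, key] at h0
  have e1 : fderiv ℝ T y u v = fderiv ℝ T y v u + (om y v • T y u - om y u • T y v
      - (2 * κ y) • (T y u ⨯₃ T y v)) := by rw [← h.deriv_T y hy]; abel
  rw [e1, h.deriv_p y hy, h.deriv_p y hy] at h0
  rw [← sub_eq_zero] at h0 ⊢
  rw [← h0]
  ext i
  fin_cases i <;> simp [cross_apply, dotProduct, Fin.sum_univ_three, Matrix.vecHead,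
    Matrix.vecTail] <;> ring

lemma exists_basis (h : IsTodaFrame Ω T om κ τ p) (hy : y ∈ Ω) : ∃ q e f : E, T y q = p y ∧
    T y e ≠ 0 ∧ T y e ⬝ᵥ p y = 0 ∧ T y f = p y ⨯₃ T y e ∧ ∀ u, ∃ a b c : ℝ,
      u = a • q + b • e + c • f := by
  obtain ⟨X, hX, hXp⟩ := exists_ne_zero_dotProduct_eq_zero (p y)
  obtain ⟨q, hq⟩ := (h.bijective y hy).2 (p y)
  obtain ⟨e, he⟩ := (h.bijective y hy).2 X
  obtain ⟨f, hf⟩ := (h.bijective y hy).2 (p y ⨯₃ X)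
  refine ⟨q, e, f, hq, by rwa [he], by rwa [he], by rw [he, hf], fun u => ?_⟩
  obtain ⟨a, b, c, habc⟩ := exists_eq_smul_add_smul_add_smul_cross (h.unit y hy) hX hXp (T y u)
  refine ⟨a, b, c, (h.bijective y hy).1 ?_⟩
  simp [habc, hq, he, hf]

/-- The derivatives of `τ` and `κ` are a solution of the Cauchy-Riemann equations on the planes
orthogonal to `p`, with prescribed values on `p`. -/
lemma cauchyRiemann (h : IsTodaFrame Ω T om κ τ p) (hy : y ∈ Ω) {q e f : E} (hq : T y q = p y)
    (he : T y e ≠ 0) (hep : T y e ⬝ᵥ p y = 0) (hf : T y f = p y ⨯₃ T y e) :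
    fderiv ℝ τ y q - τ y * om y q = -(τ y ^ 2 + κ y ^ 2) ∧
    fderiv ℝ κ y q - κ y * om y q = 0 ∧
    fderiv ℝ κ y f - κ y * om y f = fderiv ℝ τ y e - τ y * om y e ∧
    fderiv ℝ τ y f - τ y * om y f = -(fderiv ℝ κ y e - κ y * om y e) := by
  have hp := h.unit y hy
  have h1 := h.deriv_p_symm hy q e
  have h2 := h.deriv_p_symm hy e f
  have hpp : p y ⨯₃ (p y ⨯₃ T y e) = - T y e := by
    rw [cross_cross_eq_smul_sub_smul', hp, dotProduct_comm, hep]; simp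
  have hfp : T y f ⬝ᵥ p y = 0 := by rw [hf, dotProduct_comm, dot_self_cross]
  rw [hfp, hep, hf, hpp] at h2
  rw [hq, hp, hep, cross_self] at h1
  simp only [mul_one, mul_zero, add_zero, zero_smul, sub_zero, one_smul, sub_self,
    smul_zero] at h1 h2
  have hXX : T y e ⬝ᵥ T y e ≠ 0 := by rwa [Ne, dotProduct_self_eq_zero]
  have hN : (p y ⨯₃ T y e) ⬝ᵥ (p y ⨯₃ T y e) = T y e ⬝ᵥ T y e := by
    rw [cross_dot_cross, hp, hep]; ring
  have hNX : (p y ⨯₃ T y e) ⬝ᵥ T y e = 0 := by rw [dotProduct_comm, dot_cross_self]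
  have a1 := congrArg (fun Z => Z ⬝ᵥ T y e) h1
  have a2 := congrArg (fun Z => Z ⬝ᵥ (p y ⨯₃ T y e)) h1
  have b1 := congrArg (fun Z => Z ⬝ᵥ T y e) h2
  have b2 := congrArg (fun Z => Z ⬝ᵥ (p y ⨯₃ T y e)) h2
  have hXN : T y e ⬝ᵥ (p y ⨯₃ T y e) = 0 := by rw [dotProduct_comm, hNX]
  simp only [add_dotProduct, smul_dotProduct, neg_dotProduct, smul_eq_mul, hN, hNX, hXN,
    smul_neg, mul_zero, add_zero, zero_add, zero_dotProduct, neg_zero] at a1 a2 b1 b2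
  refine ⟨?_, ?_, ?_, ?_⟩ <;> apply mul_right_cancel₀ hXX
  · linear_combination a1
  · linear_combination a2
  · linear_combination -b2
  · linear_combination -b1

lemma deriv_om (h : IsTodaFrame Ω T om κ τ p) (hy : y ∈ Ω) (u v : E) :
    fderiv ℝ om y u v - fderiv ℝ om y v u =
      2 * ((fderiv ℝ τ y u - τ y * om y u) * (T y v ⬝ᵥ p y)
        - (fderiv ℝ τ y v - τ y * om y v) * (T y u ⬝ᵥ p y)) := by
  obtain ⟨q, e, f, hq, he, hep, hf, hb⟩ := h.exists_basis hy
  obtain ⟨c1, c2, c3, c4⟩ := h.cauchyRiemann hy hq he hep hf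
  have hp := h.unit y hy
  have h1 := h.deriv_om_cyclic hy q e f
  have hXX : T y e ⬝ᵥ T y e ≠ 0 := by rwa [Ne, dotProduct_self_eq_zero]
  have hfp : T y f ⬝ᵥ p y = 0 := by rw [hf, dotProduct_comm, dot_self_cross]
  have hN : (p y ⨯₃ T y e) ⬝ᵥ (p y ⨯₃ T y e) = T y e ⬝ᵥ T y e := by
    rw [cross_dot_cross, hp, hep]; ring
  have hNX : (p y ⨯₃ T y e) ⬝ᵥ T y e = 0 := by rw [dotProduct_comm, dot_cross_self]
  have hXN : T y e ⬝ᵥ (p y ⨯₃ T y e) = 0 := by rw [dotProduct_comm, hNX]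
  have hNp : (p y ⨯₃ T y e) ⨯₃ p y = T y e := by
    rw [cross_cross_eq_smul_sub_smul, hp, hep]; simp
  rw [hf, hq, c2, hNp] at h1
  have a0 := congrArg (fun Z => Z ⬝ᵥ p y) h1
  have a1 := congrArg (fun Z => Z ⬝ᵥ T y e) h1
  have a2 := congrArg (fun Z => Z ⬝ᵥ (p y ⨯₃ T y e)) h1
  rw [hf] at hfp
  have hpX : p y ⬝ᵥ T y e = 0 := by rw [dotProduct_comm, hep]
  have hpN : p y ⬝ᵥ (p y ⨯₃ T y e) = 0 := dot_self_cross _ _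
  simp only [add_dotProduct, sub_dotProduct, smul_dotProduct, smul_eq_mul, hN, hNX,
    hXN, hp, hep, hfp, hpX, hpN, mul_zero, add_zero, zero_add, mul_one, sub_zero,
    zero_mul, zero_sub] at a0 a1 a2
  have d1 : fderiv ℝ om y f q - fderiv ℝ om y q f =
      -2 * (fderiv ℝ κ y e - κ y * om y e) := by
    apply mul_right_cancel₀ hXX; linear_combination a1
  have d2 : fderiv ℝ om y q e - fderiv ℝ om y e q =
      -2 * (fderiv ℝ κ y f - κ y * om y f) := by
    apply mul_right_cancel₀ hXX; linear_combination a2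
  obtain ⟨a, b, c, rfl⟩ := hb u
  obtain ⟨a', b', c', rfl⟩ := hb v
  simp only [map_add, map_smul, _root_.add_apply, _root_.smul_apply, hq, hf, add_dotProduct,
    smul_dotProduct, hp, hep, hfp, smul_eq_mul]
  linear_combination (a * b' - a' * b) * d2 - (a * c' - a' * c) * d1 + (b * c' - b' * c) * a0
    - 2 * (a * b' - a' * b) * c3 + 2 * (a * c' - a' * c) * c4

end IsTodaFrame

end TodaFrame

section Stereographic

open Matrix Complex

/-- Stereographic projection from the pole `(ε, 0, 0)` of the unit sphere, `ε = ±1`, with the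
orientation that makes it holomorphic for the complex structure `v ↦ p × v`. -/
noncomputable def stereo (ε : ℝ) (p : Fin 3 → ℝ) : ℂ :=
  (1 - ε * p 0)⁻¹ • ((p 1 : ℂ) - ε * p 2 * I)

/-- The derivative of stereographic projection. -/
noncomputable def dstereo (ε : ℝ) (p : Fin 3 → ℝ) : (Fin 3 → ℝ) →L[ℝ] ℂ :=
  LinearMap.toContinuousLinearMap
  { toFun := fun X => (1 - ε * p 0)⁻¹ • ((X 1 : ℂ) - ε * X 2 * I)
      + (ε * X 0 * ((1 - ε * p 0)⁻¹) ^ 2) • ((p 1 : ℂ) - ε * p 2 * I)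
    map_add' := by intros; simp; ring
    map_smul' := by intros; simp; ring }

lemma dstereo_apply (ε : ℝ) (p X : Fin 3 → ℝ) : dstereo ε p X =
    (1 - ε * p 0)⁻¹ • ((X 1 : ℂ) - ε * X 2 * I)
      + (ε * X 0 * ((1 - ε * p 0)⁻¹) ^ 2) • ((p 1 : ℂ) - ε * p 2 * I) := rfl

/-- The second derivative of stereographic projection. -/
noncomputable def ddstereo (ε : ℝ) (p X Y : Fin 3 → ℝ) : ℂ :=
  (ε * ((1 - ε * p 0)⁻¹) ^ 2 * X 0) • ((Y 1 : ℂ) - ε * Y 2 * I)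
    + (ε * ((1 - ε * p 0)⁻¹) ^ 2 * Y 0) • ((X 1 : ℂ) - ε * X 2 * I)
    + (2 * ε ^ 2 * ((1 - ε * p 0)⁻¹) ^ 3 * X 0 * Y 0) • ((p 1 : ℂ) - ε * p 2 * I)

lemma ddstereo_comm (ε : ℝ) (p X Y : Fin 3 → ℝ) : ddstereo ε p X Y = ddstereo ε p Y X := by
  simp [ddstereo]; ring

lemma ddstereo_add_left (ε : ℝ) (p X X' Y : Fin 3 → ℝ) :
    ddstereo ε p (X + X') Y = ddstereo ε p X Y + ddstereo ε p X' Y := by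
  simp [ddstereo]; ring

lemma ddstereo_smul_left (ε : ℝ) (p : Fin 3 → ℝ) (c : ℝ) (X Y : Fin 3 → ℝ) :
    ddstereo ε p (c • X) Y = c * ddstereo ε p X Y := by
  simp [ddstereo]; ring

variable {E : Type*} [NormedAddCommGroup E] [NormedSpace ℝ E]

lemma HasFDerivAt.comp_apply {p : E → Fin 3 → ℝ} {p' : E →L[ℝ] Fin 3 → ℝ} {y : E}
    (hp : HasFDerivAt p p' y) (i : Fin 3) :
    HasFDerivAt (fun y => p y i) ((ContinuousLinearMap.proj i).comp p') y :=
  (hasFDerivAt_pi'.1 hp) i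

lemma hasFDerivAt_stereo {ε : ℝ} {p : E → Fin 3 → ℝ} {p' : E →L[ℝ] Fin 3 → ℝ} {y : E}
    (hp : HasFDerivAt p p' y) (hD : 1 - ε * p y 0 ≠ 0) :
    HasFDerivAt (fun y => stereo ε (p y)) ((dstereo ε (p y)).comp p') y := by
  have h0 := ((hp.comp_apply 0).const_mul ε).const_sub 1
  have h1 : HasFDerivAt (fun y => (1 - ε * p y 0)⁻¹) _ y := (hasDerivAt_inv hD).comp_hasFDerivAt y h0
  have h2 := (ofRealCLM.hasFDerivAt.comp y (hp.comp_apply 1)).fun_sub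
    (((ofRealCLM.hasFDerivAt.comp y (hp.comp_apply 2)).const_mul (ε : ℂ)).mul_const I)
  have h3 := h1.fun_smul h2
  refine HasFDerivAt.congr_fderiv (f := fun y => stereo ε (p y)) h3 ?_
  ext u
  simp [dstereo_apply]
  ring

lemma hasFDerivAt_dstereo {ε : ℝ} {p X : E → Fin 3 → ℝ} {p' X' : E →L[ℝ] Fin 3 → ℝ} {y : E}
    (hp : HasFDerivAt p p' y) (hX : HasFDerivAt X X' y) (hD : 1 - ε * p y 0 ≠ 0) (u : E) :
    fderiv ℝ (fun y => dstereo ε (p y) (X y)) y u =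
      dstereo ε (p y) (X' u) + ddstereo ε (p y) (p' u) (X y) ∧
    DifferentiableAt ℝ (fun y => dstereo ε (p y) (X y)) y := by
  have h0 := ((hp.comp_apply 0).const_mul ε).const_sub 1
  have h1 : HasFDerivAt (fun y => (1 - ε * p y 0)⁻¹) _ y := (hasDerivAt_inv hD).comp_hasFDerivAt y h0
  have hn : ∀ {q : E → Fin 3 → ℝ} {q' : E →L[ℝ] Fin 3 → ℝ}, HasFDerivAt q q' y → _ :=
    fun {q q'} hq => (ofRealCLM.hasFDerivAt.comp y (HasFDerivAt.comp_apply (p := q) (p' := q') hq 1)).fun_sub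
      (((ofRealCLM.hasFDerivAt.comp y (HasFDerivAt.comp_apply (p := q) (p' := q') hq 2)).const_mul (ε : ℂ)).mul_const I)
  have h3 := (h1.fun_smul (hn hX)).fun_add
    ((((hX.comp_apply 0).const_mul ε).fun_mul (h1.pow 2)).fun_smul (hn hp))
  refine ⟨?_, h3.differentiableAt⟩
  refine (congrArg (fun A => A u) h3.fderiv).trans ?_
  simp [dstereo_apply, ddstereo]
  simp only [← inv_pow]
  ring

section Identities

lemma dstereo_re (ε : ℝ) (p X : Fin 3 → ℝ) : (dstereo ε p X).re =
    (1 - ε * p 0)⁻¹ * X 1 + ε * X 0 * (1 - ε * p 0)⁻¹ ^ 2 * p 1 := by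
  rw [dstereo_apply, add_re, smul_re, smul_re]; simp

lemma dstereo_im (ε : ℝ) (p X : Fin 3 → ℝ) : (dstereo ε p X).im =
    -ε * ((1 - ε * p 0)⁻¹ * X 2 + ε * X 0 * (1 - ε * p 0)⁻¹ ^ 2 * p 2) := by
  rw [dstereo_apply, add_im, smul_im, smul_im]; simp; ring

lemma ddstereo_re (ε : ℝ) (p X Y : Fin 3 → ℝ) : (ddstereo ε p X Y).re =
    ε * (1 - ε * p 0)⁻¹ ^ 2 * X 0 * Y 1 + ε * (1 - ε * p 0)⁻¹ ^ 2 * Y 0 * X 1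
      + 2 * ε ^ 2 * (1 - ε * p 0)⁻¹ ^ 3 * X 0 * Y 0 * p 1 := by
  rw [ddstereo, add_re, add_re, smul_re, smul_re, smul_re]; simp

lemma ddstereo_im (ε : ℝ) (p X Y : Fin 3 → ℝ) : (ddstereo ε p X Y).im =
    -ε * (ε * (1 - ε * p 0)⁻¹ ^ 2 * X 0 * Y 2 + ε * (1 - ε * p 0)⁻¹ ^ 2 * Y 0 * X 2
      + 2 * ε ^ 2 * (1 - ε * p 0)⁻¹ ^ 3 * X 0 * Y 0 * p 2) := by
  rw [ddstereo, add_im, add_im, smul_im, smul_im, smul_im]; simp; ring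

variable {ε : ℝ} {p X Y : Fin 3 → ℝ}

lemma dstereo_self (hD : 1 - ε * p 0 ≠ 0) :
    dstereo ε p p = ((1 - ε * p 0)⁻¹ ^ 2) • ((p 1 : ℂ) - ε * p 2 * I) := by
  have h1 : (1 - ε * p 0) * (1 - ε * p 0)⁻¹ = 1 := mul_inv_cancel₀ hD
  rw [dstereo_apply, ← add_smul]
  congr 1
  generalize (1 - ε * p 0)⁻¹ = r at *
  linear_combination (-r) * h1

lemma dstereo_cross (hε : ε ^ 2 = 1)  (hD : 1 - ε * p 0 ≠ 0) (hp : p ⬝ᵥ p = 1)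
    (hX : X ⬝ᵥ p = 0) : dstereo ε p (p ⨯₃ X) = I * dstereo ε p X := by
  have h1 : (1 - ε * p 0) * (1 - ε * p 0)⁻¹ = 1 := mul_inv_cancel₀ hD
  simp only [dotProduct, Fin.sum_univ_three] at hp hX
  apply Complex.ext
  · simp only [dstereo_re, dstereo_im, cross_apply, mul_re, I_re, I_im]
    generalize (1 - ε * p 0)⁻¹ = r at *
    simp
    clear hD
    grind
  · simp only [dstereo_re, dstereo_im, cross_apply, mul_im, I_re, I_im]
    generalize (1 - ε * p 0)⁻¹ = r at *
    simp
    clear hD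
    grind

lemma normSq_dstereo (hε : ε ^ 2 = 1)  (hD : 1 - ε * p 0 ≠ 0) (hp : p ⬝ᵥ p = 1)
    (hX : X ⬝ᵥ p = 0) : normSq (dstereo ε p X) = (1 - ε * p 0)⁻¹ ^ 2 * (X ⬝ᵥ X) := by
  have h1 : (1 - ε * p 0) * (1 - ε * p 0)⁻¹ = 1 := mul_inv_cancel₀ hD
  simp only [dotProduct, Fin.sum_univ_three] at hp hX
  simp only [dstereo_re, dstereo_im, normSq_apply, dotProduct, Fin.sum_univ_three]
  generalize (1 - ε * p 0)⁻¹ = r at *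
  clear hD
  grind

lemma ddstereo_cross (hε : ε ^ 2 = 1)  (hD : 1 - ε * p 0 ≠ 0) (hp : p ⬝ᵥ p = 1)
    (hX : X ⬝ᵥ p = 0) (hY : Y ⬝ᵥ p = 0) : ddstereo ε p (p ⨯₃ X) Y - ddstereo ε p X (p ⨯₃ Y) =
      2 * (p ⬝ᵥ (X ⨯₃ Y)) * dstereo ε p p := by
  have h1 : (1 - ε * p 0) * (1 - ε * p 0)⁻¹ = 1 := mul_inv_cancel₀ hD
  rw [dstereo_self hD, ddstereo_comm ε p X]
  simp only [dotProduct, Fin.sum_univ_three] at hp hX hY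
  apply Complex.ext
  · simp only [sub_re, ddstereo_re, cross_apply]
    generalize (1 - ε * p 0)⁻¹ = r at *
    simp [dotProduct, Fin.sum_univ_three, -ofReal_pow]
    clear hD
    grind
  · simp only [sub_im, ddstereo_im, cross_apply]
    generalize (1 - ε * p 0)⁻¹ = r at *
    simp [dotProduct, Fin.sum_univ_three, -ofReal_pow]
    clear hD
    have key : ε * r ^ 2 * (p 1 * X 2 - p 2 * X 1) * Y 2 + ε * r ^ 2 * Y 0 * (p 0 * X 1 - p 1 * X 0)
        + 2 * ε ^ 2 * r ^ 3 * (p 1 * X 2 - p 2 * X 1) * Y 0 * p 2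
        - (ε * r ^ 2 * (p 1 * Y 2 - p 2 * Y 1) * X 2 + ε * r ^ 2 * X 0 * (p 0 * Y 1 - p 1 * Y 0)
        + 2 * ε ^ 2 * r ^ 3 * (p 1 * Y 2 - p 2 * Y 1) * X 0 * p 2)
        = 2 * (p 0 * (X 1 * Y 2 - X 2 * Y 1) + p 1 * (X 2 * Y 0 - X 0 * Y 2)
          + p 2 * (X 0 * Y 1 - X 1 * Y 0)) * (r ^ 2 * p 2) := by
      grind
    linear_combination (-ε) * key

end Identities

end Stereographic

section TodaGauge

open Matrix Complex

variable {E : Type*} [NormedAddCommGroup E] [NormedSpace ℝ E]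

namespace IsTodaFrame

variable {Ω : Set E} {T : E → E →L[ℝ] (Fin 3 → ℝ)} {om : E → E →L[ℝ] ℝ}
    {κ τ : E → ℝ} {p : E → Fin 3 → ℝ} {y : E}

lemma mono (h : IsTodaFrame Ω T om κ τ p) {Ω' : Set E} (hΩ : IsOpen Ω') (hs : Ω' ⊆ Ω) :
    IsTodaFrame Ω' T om κ τ p where
  isOpen := hΩ
  contDiff_T := h.contDiff_T.mono hs
  contDiff_om := h.contDiff_om.mono hs
  contDiff_κ := h.contDiff_κ.mono hs
  contDiff_τ := h.contDiff_τ.mono hs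
  contDiff_p := h.contDiff_p.mono hs
  bijective y hy := h.bijective y (hs hy)
  deriv_T y hy := h.deriv_T y (hs hy)
  unit y hy := h.unit y (hs hy)
  deriv_p y hy := h.deriv_p y (hs hy)

/-- The component of the coframe along `p`. -/
noncomputable def eta (T : E → E →L[ℝ] (Fin 3 → ℝ)) (p : E → Fin 3 → ℝ) (y : E) : E →L[ℝ] ℝ :=
  (dotL (p y)).comp (T y)

lemma eta_apply (T : E → E →L[ℝ] (Fin 3 → ℝ)) (p : E → Fin 3 → ℝ) (y u : E) :
    eta T p y u = T y u ⬝ᵥ p y := by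
  rw [dotProduct_comm]; rfl

lemma contDiffOn_eta (h : IsTodaFrame Ω T om κ τ p) : ContDiffOn ℝ ∞ (eta T p) Ω :=
  (dotL.contDiff.comp_contDiffOn h.contDiff_p).clm_comp h.contDiff_T

lemma deriv_eta (h : IsTodaFrame Ω T om κ τ p) (hy : y ∈ Ω) (u v : E) :
    fderiv ℝ (eta T p) y u v - fderiv ℝ (eta T p) y v u =
      om y v * (T y u ⬝ᵥ p y) - om y u * (T y v ⬝ᵥ p y) := by
  have hη : HasFDerivAt (eta T p) (fderiv ℝ (eta T p) y) y :=
    ((h.contDiffOn_eta.contDiffAt (h.isOpen.mem_nhds hy)).differentiableAt (by simp)).hasFDerivAt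
  have hT := h.hasFDerivAt_T hy
  have hp := h.hasFDerivAt_p hy
  have key : ∀ a c : E, fderiv ℝ (eta T p) y c a =
      fderiv ℝ T y c a ⬝ᵥ p y + T y a ⬝ᵥ fderiv ℝ p y c := by
    intro a c
    have h1 := (hη.clm_apply_const a).unique
      (((hT.clm_apply_const a).dotProduct hp).congr_of_eventuallyEq
        (Filter.Eventually.of_forall fun y => eta_apply T p y a))
    have h2 := congrArg (fun A => A c) h1
    simp at h2
    rw [h2, add_comm]
  have e1 : fderiv ℝ T y u v = fderiv ℝ T y v u + (om y v • T y u - om y u • T y v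
      - (2 * κ y) • (T y u ⨯₃ T y v)) := by rw [← h.deriv_T y hy]; abel
  rw [key, key, e1, h.deriv_p y hy, h.deriv_p y hy]
  simp [cross_apply, dotProduct, Fin.sum_univ_three, Matrix.vecHead,
    Matrix.vecTail]
  ring

lemma gauge (h : IsTodaFrame Ω T om κ τ p) {f : E → ℝ} (hf : ContDiffOn ℝ ∞ f Ω) :
    IsTodaFrame Ω (fun y => Real.exp (f y) • T y) (fun y => om y - fderiv ℝ f y)
      (fun y => Real.exp (-f y) * κ y) (fun y => Real.exp (-f y) * τ y) p where
  isOpen := h.isOpen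
  contDiff_T := (Real.contDiff_exp.comp_contDiffOn hf).smul h.contDiff_T
  contDiff_om := h.contDiff_om.sub (hf.fderiv_of_isOpen h.isOpen (by simp))
  contDiff_κ := (Real.contDiff_exp.comp_contDiffOn hf.neg).mul h.contDiff_κ
  contDiff_τ := (Real.contDiff_exp.comp_contDiffOn hf.neg).mul h.contDiff_τ
  contDiff_p := h.contDiff_p
  bijective y hy := by
    have h1 := (LinearEquiv.smulOfNeZero ℝ (Fin 3 → ℝ) _ (Real.exp_ne_zero (f y))).bijective
    exact h1.comp (h.bijective y hy)
  deriv_T y hy u v := by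
    have hT := h.hasFDerivAt_T hy
    have hfy := (hf.contDiffAt (h.isOpen.mem_nhds hy)).differentiableAt (by simp) |>.hasFDerivAt
    have hd := hfy.exp.fun_smul hT
    have e1 : fderiv ℝ T y u v = fderiv ℝ T y v u + (om y v • T y u - om y u • T y v
      - (2 * κ y) • (T y u ⨯₃ T y v)) := by rw [← h.deriv_T y hy]; abel
    have e2 : Real.exp (f y) * Real.exp (-f y) = 1 := by rw [← Real.exp_add]; simp
    rw [hd.fderiv]
    simp only [_root_.add_apply, _root_.smul_apply, ContinuousLinearMap.smulRight_apply, e1,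
      _root_.sub_apply, map_smul, LinearMap.smul_apply]
    generalize Real.exp (f y) = a at *
    generalize Real.exp (-f y) = b at *
    ext i
    simp
    linear_combination (2 * a * κ y * (T y u ⨯₃ T y v) i) * e2
  unit := h.unit
  deriv_p y hy u := by
    have e2 : Real.exp (-f y) * Real.exp (f y) = 1 := by rw [← Real.exp_add]; simp
    have hab : ∀ X : Fin 3 → ℝ, X = Real.exp (-f y) • Real.exp (f y) • X := fun X => by
      rw [smul_smul, e2, one_smul]
    rw [h.deriv_p y hy]
    simp only [_root_.smul_apply, smul_dotProduct, map_smul, mul_smul]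
    rw [smul_comm (Real.exp (-f y)) (τ y), smul_comm (Real.exp (-f y)) (κ y), smul_eq_mul, 
      mul_smul, ← smul_sub, ← hab, ← hab]

/-- The gauge in which the connection form is `2 τ η`. -/
lemma exists_gauge (h : IsTodaFrame Ω T om κ τ p) (hΩ : Convex ℝ Ω) : ∃ f : E → ℝ,
    ContDiffOn ℝ ∞ f Ω ∧ ∀ y ∈ Ω, ∀ u, fderiv ℝ f y u = om y u - 2 * τ y * (T y u ⬝ᵥ p y) := by
  set θ : E → E →L[ℝ] ℝ := fun y => om y - (2 * τ y) • eta T p y with hθ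
  have hθs : ContDiffOn ℝ ∞ θ Ω :=
    h.contDiff_om.sub ((contDiffOn_const.mul h.contDiff_τ).smul h.contDiffOn_eta)
  obtain ⟨f, hf⟩ := hΩ.exists_forall_hasFDerivAt_of_fderiv_symmetric h.isOpen
    (hθs.differentiableOn (by simp)) (by
      intro y hy u v
      have hη : HasFDerivAt (eta T p) (fderiv ℝ (eta T p) y) y :=
        ((h.contDiffOn_eta.contDiffAt (h.isOpen.mem_nhds hy)).differentiableAt
          (by simp)).hasFDerivAt
      have hd := (h.hasFDerivAt_om hy).fun_sub (((h.hasFDerivAt_τ hy).const_mul 2).fun_smul hη)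
      rw [hθ, hd.fderiv]
      simp [eta_apply]
      linear_combination h.deriv_om hy u v - 2 * τ y * h.deriv_eta hy u v)
  refine ⟨f, ?_, fun y hy u => ?_⟩
  · refine contDiffOn_infty_iff_fderiv_of_isOpen h.isOpen |>.2 
      ⟨fun y hy => (hf y hy).differentiableAt.differentiableWithinAt,
        hθs.congr fun y hy => (hf y hy).fderiv⟩
  · rw [(hf y hy).fderiv]
    simp [hθ, eta_apply]

end IsTodaFrame

end TodaGauge

section TodaHolomorphic

open Matrix Complex

variable {E : Type*} [NormedAddCommGroup E] [NormedSpace ℝ E]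

lemma ContDiffOn.dstereo {ε : ℝ} {p X : E → Fin 3 → ℝ} {Ω : Set E} (hp : ContDiffOn ℝ ∞ p Ω)
    (hX : ContDiffOn ℝ ∞ X Ω) (hD : ∀ y ∈ Ω, 1 - ε * p y 0 ≠ 0) :
    ContDiffOn ℝ ∞ (fun y => dstereo ε (p y) (X y)) Ω := by
  have hc : ∀ {q : E → Fin 3 → ℝ}, ContDiffOn ℝ ∞ q Ω → ∀ i, ContDiffOn ℝ ∞ (fun y => q y i) Ω :=
    fun hq i => contDiffOn_pi.1 hq i
  have hr : ContDiffOn ℝ ∞ (fun y => (1 - ε * p y 0)⁻¹) Ω :=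
    (contDiffOn_const.sub (contDiffOn_const.mul (hc hp 0))).inv hD
  have hn : ∀ {q : E → Fin 3 → ℝ}, ContDiffOn ℝ ∞ q Ω →
      ContDiffOn ℝ ∞ (fun y => (q y 1 : ℂ) - ε * q y 2 * I) Ω :=
    fun hq => (ofRealCLM.contDiff.comp_contDiffOn (hc hq 1)).sub
      ((contDiffOn_const.mul (ofRealCLM.contDiff.comp_contDiffOn (hc hq 2))).mul contDiffOn_const)
  exact (hr.smul (hn hX)).add
    (((contDiffOn_const.mul (hc hX 0)).mul (hr.pow 2)).smul (hn hp))

lemma HasFDerivAt.inv_complex {y : E} {f : E → ℂ} {f' : E →L[ℝ] ℂ} (hf : HasFDerivAt f f' y)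
    (hy : f y ≠ 0) : HasFDerivAt (fun y => (f y)⁻¹) (-((f y)⁻¹ ^ 2) • f') y := by
  refine ((hasFDerivAt_inv' (𝕜 := ℝ) hy).comp y hf).congr_fderiv ?_
  refine ContinuousLinearMap.ext fun u => ?_
  simp only [ContinuousLinearMap.comp_apply, _root_.neg_apply, _root_.smul_apply,
    ContinuousLinearMap.mulLeftRight_apply, smul_eq_mul]
  ring

namespace IsTodaFrame

variable {Ω : Set E} {T : E → E →L[ℝ] (Fin 3 → ℝ)} {om : E → E →L[ℝ] ℝ}
    {κ τ : E → ℝ} {p : E → Fin 3 → ℝ} {y : E} {ε : ℝ}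

/-- The complex coframe on the planes orthogonal to the Toda congruence. -/
noncomputable def zetaForm (ε : ℝ) (T : E → E →L[ℝ] (Fin 3 → ℝ)) (p : E → Fin 3 → ℝ) (y : E) :
    E →L[ℝ] ℂ :=
  (dstereo ε (p y)).comp (T y - (eta T p y).smulRight (p y))

lemma zetaForm_apply (ε : ℝ) (T : E → E →L[ℝ] (Fin 3 → ℝ)) (p : E → Fin 3 → ℝ) (y u : E) :
    zetaForm ε T p y u = dstereo ε (p y) (T y u - (T y u ⬝ᵥ p y) • p y) := by
  simp [zetaForm, eta_apply]

/-- The complex combination of divergence and twist. -/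
noncomputable def lam (κ τ : E → ℝ) (y : E) : ℂ := τ y + κ y * I

lemma contDiffOn_lam (h : IsTodaFrame Ω T om κ τ p) : ContDiffOn ℝ ∞ (lam κ τ) Ω :=
  (ofRealCLM.contDiff.comp_contDiffOn h.contDiff_τ).add
    ((ofRealCLM.contDiff.comp_contDiffOn h.contDiff_κ).mul contDiffOn_const)

lemma fderiv_lam (h : IsTodaFrame Ω T om κ τ p) (hy : y ∈ Ω) (u : E) :
    fderiv ℝ (lam κ τ) y u = fderiv ℝ τ y u + fderiv ℝ κ y u * I := by
  have h1 := (ofRealCLM.hasFDerivAt.comp y (h.hasFDerivAt_τ hy)).fun_add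
    ((ofRealCLM.hasFDerivAt.comp y (h.hasFDerivAt_κ hy)).mul_const I)
  refine (congrArg (fun A => A u) h1.fderiv).trans ?_
  simp [mul_comm]

lemma contDiffOn_zetaForm [FiniteDimensional ℝ E] (h : IsTodaFrame Ω T om κ τ p)
    (hD : ∀ y ∈ Ω, 1 - ε * p y 0 ≠ 0) : ContDiffOn ℝ ∞ (zetaForm ε T p) Ω := by
  refine contDiffOn_clm_apply.2 fun u => ?_
  simp only [zetaForm_apply, ← eta_apply T p]
  exact ContDiffOn.dstereo h.contDiff_p ((h.contDiff_T.clm_apply contDiffOn_const).sub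
    ((h.contDiffOn_eta.clm_apply contDiffOn_const).smul h.contDiff_p)) hD

lemma dotProduct_perp (h : IsTodaFrame Ω T om κ τ p) (hy : y ∈ Ω) (X : Fin 3 → ℝ) :
    (X - (X ⬝ᵥ p y) • p y) ⬝ᵥ p y = 0 := by
  rw [sub_dotProduct, smul_dotProduct, h.unit y hy]; simp

lemma dstereo_deriv_p (h : IsTodaFrame Ω T om κ τ p) (hy : y ∈ Ω) (hε : ε ^ 2 = 1)
    (hD : 1 - ε * p y 0 ≠ 0) (u : E) :
    dstereo ε (p y) (fderiv ℝ p y u) = lam κ τ y * zetaForm ε T p y u := by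
  have h1 : p y ⨯₃ T y u = p y ⨯₃ (T y u - (T y u ⬝ᵥ p y) • p y) := by
    simp
  rw [h.deriv_p y hy, h1, map_add, map_smul, map_smul,
    dstereo_cross hε hD (h.unit y hy) (h.dotProduct_perp hy _), ← zetaForm_apply, lam]
  simp
  ring

lemma hasFDerivAt_stereo (h : IsTodaFrame Ω T om κ τ p) (hy : y ∈ Ω) (hε : ε ^ 2 = 1)
    (hD : 1 - ε * p y 0 ≠ 0) :
    HasFDerivAt (fun y => stereo ε (p y)) (lam κ τ y • zetaForm ε T p y) y := by
  refine (_root_.hasFDerivAt_stereo (h.hasFDerivAt_p hy) hD).congr_fderiv ?_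
  ext u
  exact h.dstereo_deriv_p hy hε hD u

lemma zetaForm_eq_zero (h : IsTodaFrame Ω T om κ τ p) (hy : y ∈ Ω) (hε : ε ^ 2 = 1)
    (hD : 1 - ε * p y 0 ≠ 0) {u : E} (hu : zetaForm ε T p y u = 0) :
    T y u = (T y u ⬝ᵥ p y) • p y := by
  rw [zetaForm_apply, ← normSq_eq_zero,
    normSq_dstereo hε hD (h.unit y hy) (h.dotProduct_perp hy _), mul_eq_zero,
    dotProduct_self_eq_zero] at hu
  rcases hu with hu | hu
  · simp [hD] at hu
  · exact sub_eq_zero.1 hu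

/-- In the gauge with connection form `2 τ η`, the complex function `τ + i κ` satisfies
`dλ = λ² η` modulo the complex coframe. -/
lemma exists_fderiv_lam (h : IsTodaFrame Ω T om κ τ p) (hy : y ∈ Ω) (hε : ε ^ 2 = 1)
    (hD : 1 - ε * p y 0 ≠ 0) (hom : ∀ u, om y u = 2 * τ y * (T y u ⬝ᵥ p y)) :
    ∃ c : ℂ, ∀ u, fderiv ℝ (lam κ τ) y u =
      lam κ τ y ^ 2 * (T y u ⬝ᵥ p y) + c * zetaForm ε T p y u := by
  obtain ⟨q, e, f, hq, he, hep, hf, hb⟩ := h.exists_basis hy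
  obtain ⟨c1, c2, c3, c4⟩ := h.cauchyRiemann hy hq he hep hf
  have hp := h.unit y hy
  have hfp : T y f ⬝ᵥ p y = 0 := by rw [hf, dotProduct_comm, dot_self_cross]
  have hqp : T y q ⬝ᵥ p y = 1 := by rw [hq, hp]
  have ze : zetaForm ε T p y e ≠ 0 := fun h0 => he (by
    rw [h.zetaForm_eq_zero hy hε hD h0, hep, zero_smul])
  have zf : zetaForm ε T p y f = I * zetaForm ε T p y e := by
    rw [zetaForm_apply, zetaForm_apply, hfp, hep, hf, zero_smul, sub_zero, sub_zero,
      dstereo_cross hε hD hp hep]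
  have zq : zetaForm ε T p y q = 0 := by
    rw [zetaForm_apply, hqp, hq, one_smul, sub_self, map_zero]
  refine ⟨fderiv ℝ (lam κ τ) y e / zetaForm ε T p y e, fun u => ?_⟩
  have le : fderiv ℝ (lam κ τ) y e / zetaForm ε T p y e * zetaForm ε T p y e
      = fderiv ℝ (lam κ τ) y e := div_mul_cancel₀ _ ze
  obtain ⟨a, b, c, rfl⟩ := hb u
  have hI : I ^ 2 = -1 := I_sq
  simp only [hom, hqp, hep, hfp, mul_one, mul_zero, sub_zero] at c1 c2 c3 c4
  have c1' := congrArg (fun x : ℝ => (x : ℂ)) c1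
  have c2' := congrArg (fun x : ℝ => (x : ℂ)) c2
  have c3' := congrArg (fun x : ℝ => (x : ℂ)) c3
  have c4' := congrArg (fun x : ℝ => (x : ℂ)) c4
  push_cast at c1' c2' c3' c4'
  simp only [map_add, map_smul, add_dotProduct, smul_dotProduct, hqp, hep, hfp, zq, zf, real_smul,
    smul_eq_mul, mul_one, mul_zero, add_zero, zero_add, mul_add]
  have lef : fderiv ℝ (lam κ τ) y e / zetaForm ε T p y e * (c * (I * zetaForm ε T p y e))
      = c * I * fderiv ℝ (lam κ τ) y e := by linear_combination (c * I) * le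
  have leb : fderiv ℝ (lam κ τ) y e / zetaForm ε T p y e * (b * zetaForm ε T p y e)
      = b * fderiv ℝ (lam κ τ) y e := by linear_combination b * le
  rw [lef, leb]
  simp only [h.fderiv_lam hy]
  simp only [lam]
  linear_combination a * c1' + a * I * c2' + c * I * c3' + c * c4' 
    - (c * fderiv ℝ κ y e + a * κ y ^ 2) * hI

/-- In the gauge with connection form `2 τ η`, the exterior derivative of the complex coframe. -/
lemma deriv_zetaForm [FiniteDimensional ℝ E] (h : IsTodaFrame Ω T om κ τ p) (hy : y ∈ Ω)
    (hε : ε ^ 2 = 1)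
    (hD : ∀ y ∈ Ω, 1 - ε * p y 0 ≠ 0) (hom : ∀ u, om y u = 2 * τ y * (T y u ⬝ᵥ p y)) (u v : E) :
    fderiv ℝ (zetaForm ε T p) y u v - fderiv ℝ (zetaForm ε T p) y v u =
      lam κ τ y * ((T y v ⬝ᵥ p y) * zetaForm ε T p y u - (T y u ⬝ᵥ p y) * zetaForm ε T p y v) := by
  have hη : HasFDerivAt (eta T p) (fderiv ℝ (eta T p) y) y :=
    ((h.contDiffOn_eta.contDiffAt (h.isOpen.mem_nhds hy)).differentiableAt (by simp)).hasFDerivAt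
  have hT := h.hasFDerivAt_T hy
  have hp := h.hasFDerivAt_p hy
  have hZ : HasFDerivAt (zetaForm ε T p) (fderiv ℝ (zetaForm ε T p) y) y :=
    (((h.contDiffOn_zetaForm hD).contDiffAt (h.isOpen.mem_nhds hy)).differentiableAt
      (by simp)).hasFDerivAt
  have hDy := hD y hy
  have hpp := h.unit y hy
  set S := dstereo ε (p y) with hS
  have key : ∀ a c : E, fderiv ℝ (zetaForm ε T p) y c a =
      S (fderiv ℝ T y c a) - (fderiv ℝ (eta T p) y c a) * S (p y)
        - (T y a ⬝ᵥ p y) * S (fderiv ℝ p y c)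
        + ddstereo ε (p y) (fderiv ℝ p y c) (T y a - (T y a ⬝ᵥ p y) • p y) := by
    intro a c
    have hX := (hT.clm_apply_const a).fun_sub ((hη.clm_apply_const a).fun_smul hp)
    obtain ⟨h1, h2⟩ := hasFDerivAt_dstereo hp hX hDy c
    have h3 : (fun y => dstereo ε (p y) (T y a - eta T p y a • p y)) =
        fun y => zetaForm ε T p y a := by
      ext y; rw [zetaForm_apply, eta_apply]
    rw [h3, (hZ.clm_apply_const a).fderiv] at h1
    simp only [ContinuousLinearMap.flip_apply] at h1
    rw [h1]
    simp [eta_apply, hS]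
    ring
  have e1 : fderiv ℝ T y u v = fderiv ℝ T y v u + (om y v • T y u - om y u • T y v
      - (2 * κ y) • (T y u ⨯₃ T y v)) := by rw [← h.deriv_T y hy]; abel
  have e2 : fderiv ℝ (eta T p) y u v = fderiv ℝ (eta T p) y v u := by
    rw [← sub_eq_zero, h.deriv_eta hy, hom, hom]; ring
  rw [key, key, e1, e2, h.deriv_p y hy, h.deriv_p y hy]
  have hX := h.dotProduct_perp hy (T y u)
  have hY := h.dotProduct_perp hy (T y v)
  have zu := zetaForm_apply ε T p y u
  have zv := zetaForm_apply ε T p y v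
  have hTu : T y u = (T y u - (T y u ⬝ᵥ p y) • p y) + (T y u ⬝ᵥ p y) • p y := by abel
  have hTv : T y v = (T y v - (T y v ⬝ᵥ p y) • p y) + (T y v ⬝ᵥ p y) • p y := by abel
  rw [hom, hom]
  generalize T y u ⬝ᵥ p y = a at *
  generalize T y v ⬝ᵥ p y = b at *
  generalize T y u - a • p y = X at *
  generalize T y v - b • p y = Y at *
  rw [hTu, hTv, zu, zv]
  have cX := dstereo_cross hε hDy hpp hX
  have cY := dstereo_cross hε hDy hpp hY
  have cXY := ddstereo_cross hε hDy hpp hX hY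
  have hXY : X ⨯₃ Y = (p y ⬝ᵥ (X ⨯₃ Y)) • p y := by
    have h0 : (X ⨯₃ Y) ⨯₃ p y = 0 := by
      rw [cross_cross_eq_smul_sub_smul, hX, hY]; simp
    have h1 := congrArg (fun Z => p y ⨯₃ Z) h0
    simp only [cross_cross_eq_smul_sub_smul', hpp, map_zero, one_smul] at h1
    rw [dotProduct_comm]
    exact sub_eq_zero.1 h1
  have dXY := ddstereo_comm ε (p y) X Y
  have dXY' := ddstereo_comm ε (p y) X (p y ⨯₃ Y)
  rw [← hS] at cX cY cXY
  simp only [map_add, map_smul, map_sub, LinearMap.add_apply, LinearMap.smul_apply, cross_self,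
    smul_zero, add_zero, ddstereo_add_left, ddstereo_smul_left, real_smul, cX, cY]
  rw [hXY, ← cross_anticomm X (p y), ← cross_anticomm (p y) X]
  simp only [map_smul, map_neg, neg_neg, cX, lam, real_smul]
  push_cast
  rw [dXY'] at cXY
  linear_combination κ y * cXY + τ y * dXY

end IsTodaFrame

end TodaHolomorphic

section LocalInverse

variable {E : Type*} [NormedAddCommGroup E] [NormedSpace ℝ E] [FiniteDimensional ℝ E]
  {F : Type*} [NormedAddCommGroup F] [NormedSpace ℝ F]

/-- The inverse function theorem, with a prescribed image of the local inverse. -/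
lemma ContDiffOn.exists_localInverse {G : E → F} {Ω : Set E} (hΩ : IsOpen Ω)
    (hG : ContDiffOn ℝ ∞ G Ω) (hbij : ∀ y ∈ Ω, Function.Bijective (fderiv ℝ G y)) {b : E}
    (hb : b ∈ Ω) : ∃ (e : OpenPartialHomeomorph E F) (r : ℝ), 0 < r ∧ b ∈ e.source ∧
      e.source ⊆ Ω ∧ (∀ y, e y = G y) ∧ e.target = Metric.ball (G b) r ∧
      ContDiffOn ℝ ∞ e.symm e.target := by
  have : CompleteSpace E := FiniteDimensional.complete ℝ E
  have hc : ∀ y ∈ Ω, ContDiffAt ℝ ∞ G y := fun y hy => hG.contDiffAt (hΩ.mem_nhds hy)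
  have hd : ∀ y ∈ Ω, ∃ A : E ≃L[ℝ] F, HasFDerivAt G (A : E →L[ℝ] F) y := by
    intro y hy
    refine ⟨(LinearEquiv.ofBijective (fderiv ℝ G y : E →ₗ[ℝ] F)
      (hbij y hy)).toContinuousLinearEquiv, ?_⟩
    have := ((hc y hy).differentiableAt (by simp)).hasFDerivAt
    convert this using 1
    ext u; rfl
  obtain ⟨A, hA⟩ := hd b hb
  set e₀ := (hc b hb).toOpenPartialHomeomorph G hA (by simp) with he₀
  have he₀G : ∀ y, e₀ y = G y := fun y => rfl
  have hb₀ : b ∈ e₀.source := (hc b hb).mem_toOpenPartialHomeomorph_source hA (by simp)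
  set e₁ := e₀.restrOpen Ω hΩ with he₁
  have hs₁ : e₁.source = e₀.source ∩ Ω := e₀.restrOpen_source Ω hΩ
  have hb₁ : b ∈ e₁.source := by rw [hs₁]; exact ⟨hb₀, hb⟩
  have ht : e₁.target ∈ 𝓝 (G b) := e₁.open_target.mem_nhds (e₁.map_source hb₁)
  obtain ⟨r, hr, hrs⟩ := Metric.mem_nhds_iff.1 ht
  set e := (e₁.symm.restrOpen (Metric.ball (G b) r) Metric.isOpen_ball).symm with he
  have htar : e.target = Metric.ball (G b) r := by
    have : e.target = e₁.target ∩ Metric.ball (G b) r :=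
      e₁.symm.restrOpen_source _ Metric.isOpen_ball
    rw [this, Set.inter_eq_right.2 hrs]
  have hsub : e.source ⊆ e₁.source := by
    intro y hy
    have h1 := e.map_source hy
    rw [htar] at h1
    have h2 := e₁.symm.map_source (hrs h1)
    rwa [show e₁.symm (e y) = e.symm (e y) from rfl, e.left_inv hy] at h2
  have hbe : b ∈ e.source := by
    have h1 : G b ∈ e.target := by rw [htar]; exact Metric.mem_ball_self hr
    have h2 := e.symm.map_source h1
    rwa [show e.symm (G b) = e₁.symm (e₁ b) from rfl, e₁.left_inv hb₁] at h2
  have hsub' : e.source ⊆ Ω := fun y hy => (hs₁ ▸ hsub hy : y ∈ e₀.source ∩ Ω).2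
  refine ⟨e, r, hr, hbe, hsub', fun y => rfl, htar, fun a ha => ?_⟩
  have h1 := e.symm.map_source ha
  obtain ⟨A, hA⟩ := hd _ (hsub' h1)
  exact (e.contDiffAt_symm ha hA (hc _ (hsub' h1))).contDiffWithinAt

/-- A complex function whose derivative is a complex multiple of the derivative of `w` is locally a
holomorphic function of `w`. -/
lemma exists_eq_holomorphic_comp {w q : E → ℂ} {t : E → ℝ} {Ω : Set E} (hΩ : IsOpen Ω)
    (hw : ContDiffOn ℝ ∞ w Ω) (ht : ContDiffOn ℝ ∞ t Ω) (hq : ContDiffOn ℝ ∞ q Ω)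
    (hbij : ∀ y ∈ Ω, Function.Bijective fun u => (fderiv ℝ w y u, fderiv ℝ t y u))
    (hqw : ∀ y ∈ Ω, ∃ c : ℂ, ∀ u, fderiv ℝ q y u = c * fderiv ℝ w y u) {b : E} (hb : b ∈ Ω) :
    ∃ (e : OpenPartialHomeomorph E (ℂ × ℝ)) (r : ℝ) (f : ℂ → ℂ), 0 < r ∧ b ∈ e.source ∧
      e.source ⊆ Ω ∧ (∀ y, e y = (w y, t y)) ∧
      e.target = Metric.ball (w b) r ×ˢ Metric.ball (t b) r ∧ ContDiffOn ℝ ∞ e.symm e.target ∧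
      DifferentiableOn ℂ f (Metric.ball (w b) r) ∧ ∀ y ∈ e.source, q y = f (w y) := by
  have hfd : ∀ y ∈ Ω, ∀ u, fderiv ℝ (fun y => (w y, t y)) y u =
      (fderiv ℝ w y u, fderiv ℝ t y u) := by
    intro y hy u
    have h1 := ((hw.contDiffAt (hΩ.mem_nhds hy)).differentiableAt (by simp)).hasFDerivAt
    have h2 := ((ht.contDiffAt (hΩ.mem_nhds hy)).differentiableAt (by simp)).hasFDerivAt
    rw [(h1.prodMk h2).fderiv]; rfl
  obtain ⟨e, r, hr, hbe, hsub, heG, htar, hsymm⟩ :=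
    ContDiffOn.exists_localInverse hΩ (hw.prodMk ht) (by
      intro y hy
      rw [show ⇑(fderiv ℝ (fun y => (w y, t y)) y) = _ from funext (hfd y hy)]
      exact hbij y hy) hb
  rw [← ball_prod_same] at htar
  have htarget : IsOpen e.target := e.open_target
  have hder : ∀ a ∈ e.target, ∃ c : ℂ, HasFDerivAt (fun a => q (e.symm a))
      (c • ContinuousLinearMap.fst ℝ ℂ ℝ) a := by
    intro a ha
    have hy := hsub (e.map_target ha)
    have h1 := ((hsymm.contDiffAt (htarget.mem_nhds ha)).differentiableAt (by simp)).hasFDerivAt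
    have h2 := ((hw.contDiffAt (hΩ.mem_nhds hy)).differentiableAt (by simp)).hasFDerivAt
    have h3 := ((hq.contDiffAt (hΩ.mem_nhds hy)).differentiableAt (by simp)).hasFDerivAt
    obtain ⟨c, hc⟩ := hqw _ hy
    refine ⟨c, ?_⟩
    have h4 := h2.comp a h1
    have h5 : w ∘ e.symm =ᶠ[𝓝 a] Prod.fst := by
      filter_upwards [htarget.mem_nhds ha] with a' ha'
      have := e.right_inv ha'
      rw [heG] at this
      exact congrArg Prod.fst this
    have h6 := (h4.congr_of_eventuallyEq h5.symm).unique hasFDerivAt_fst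
    refine (h3.comp a h1).congr_fderiv ?_
    refine ContinuousLinearMap.ext fun u => ?_
    have h7 := congrArg (fun A => A u) h6
    simp only [ContinuousLinearMap.comp_apply, smul_apply, smul_eq_mul] at h7 ⊢
    rw [hc, h7]
  have hconst : ∀ z ∈ Metric.ball (w b) r, ∀ s ∈ Metric.ball (t b) r,
      q (e.symm (z, s)) = q (e.symm (z, t b)) := by
    intro z hz s hs
    have hd : ∀ s ∈ Metric.ball (t b) r, HasDerivAt (fun s : ℝ => q (e.symm (z, s))) 0 s := by
      intro s hs
      obtain ⟨c, hc⟩ := hder (z, s) (by rw [htar]; exact ⟨hz, hs⟩)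
      have := hc.comp_hasDerivAt s ((hasDerivAt_const s z).prodMk (hasDerivAt_id s))
      simp at this
      exact this
    exact Metric.isOpen_ball.is_const_of_deriv_eq_zero
      (convex_ball (t b) r).isPreconnected
      (fun s hs => (hd s hs).differentiableAt.differentiableWithinAt)
      (fun s hs => (hd s hs).deriv) hs (Metric.mem_ball_self hr)
  refine ⟨e, r, fun z => q (e.symm (z, t b)), hr, hbe, hsub, heG, htar, hsymm, ?_, ?_⟩
  · intro z hz
    obtain ⟨c, hc⟩ := hder (z, t b) (by rw [htar]; exact ⟨hz, Metric.mem_ball_self hr⟩)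
    have h1 := hc.comp z (hasFDerivAt_prodMk_left (𝕜 := ℝ) z (t b))
    have h2 : HasDerivAt (fun z => q (e.symm (z, t b))) c z := by
      rw [hasDerivAt_iff_hasFDerivAt]
      refine hasFDerivAt_of_restrictScalars ℝ (g' := _) h1 ?_
      ext u
      simp [mul_comm]
    exact h2.differentiableAt.differentiableWithinAt
  · intro y hy
    have h1 := e.map_source hy
    rw [htar, heG] at h1
    have h2 := hconst _ h1.1 _ h1.2
    have h3 := e.left_inv hy
    rw [heG] at h3
    rw [h3] at h2
    exact h2

end LocalInverse

section TodaLocal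

open Matrix Complex

variable {E : Type*} [NormedAddCommGroup E] [NormedSpace ℝ E] [FiniteDimensional ℝ E]

namespace IsTodaFrame

variable {Ω : Set E} {T : E → E →L[ℝ] (Fin 3 → ℝ)} {om : E → E →L[ℝ] ℝ}
    {κ τ : E → ℝ} {p : E → Fin 3 → ℝ} {y : E} {ε : ℝ}

lemma bijective_of_smul_zetaForm (h : IsTodaFrame Ω T om κ τ p) (hy : y ∈ Ω) (hε : ε ^ 2 = 1)
    (hD : 1 - ε * p y 0 ≠ 0) {w' : E →L[ℝ] ℂ} {t' : E →L[ℝ] ℝ} {c : ℂ} (hc : c ≠ 0)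
    (hw : ∀ u, w' u = c * zetaForm ε T p y u) (ht : ∀ u, t' u = -(T y u ⬝ᵥ p y)) :
    Function.Bijective fun u => (w' u, t' u) := by
  have hE : Module.finrank ℝ E = 3 := by
    have := (LinearEquiv.ofBijective (T y : E →ₗ[ℝ] (Fin 3 → ℝ)) (h.bijective y hy)).finrank_eq
    simpa using this
  have hC : Module.finrank ℝ (ℂ × ℝ) = 3 := by simp
  have hinj : Function.Injective ((w'.prod t' : E →L[ℝ] ℂ × ℝ) : E →ₗ[ℝ] ℂ × ℝ) := by
    rw [injective_iff_map_eq_zero]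
    intro u hu
    have h1 : w' u = 0 := congrArg Prod.fst hu
    have h2 : t' u = 0 := congrArg Prod.snd hu
    rw [hw, mul_eq_zero, or_iff_right hc] at h1
    rw [ht, neg_eq_zero] at h2
    have h3 := h.zetaForm_eq_zero hy hε hD h1
    rw [h2, zero_smul, ← map_zero (T y)] at h3
    exact (h.bijective y hy).1 h3
  exact ⟨hinj, (LinearMap.injective_iff_surjective_of_finrank_eq_finrank (hE.trans hC.symm)).1 hinj⟩

/-- Where `τ + i κ` does not vanish, the Toda congruence and the function `z` are coordinates in
which `1 / (τ + i κ) - z` is holomorphic. -/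
lemma exists_chart_of_lam_ne_zero (h : IsTodaFrame Ω T om κ τ p) (hε : ε ^ 2 = 1)
    (hD : ∀ y ∈ Ω, 1 - ε * p y 0 ≠ 0)
    (hom : ∀ y ∈ Ω, ∀ u, om y u = 2 * τ y * (T y u ⬝ᵥ p y)) {z : E → ℝ} (hzs : ContDiffOn ℝ ∞ z Ω)
    (hz : ∀ y ∈ Ω, ∀ u, fderiv ℝ z y u = -(T y u ⬝ᵥ p y)) {b : E} (hb : b ∈ Ω)
    (hlam : lam κ τ b ≠ 0) :
    ∃ (e : OpenPartialHomeomorph E (ℂ × ℝ)) (r : ℝ) (f : ℂ → ℂ), 0 < r ∧ b ∈ e.source ∧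
      e.source ⊆ Ω ∧ (∀ y, e y = (stereo ε (p y), z y)) ∧
      e.target = Metric.ball (stereo ε (p b)) r ×ˢ Metric.ball (z b) r ∧
      ContDiffOn ℝ ∞ e.symm e.target ∧ DifferentiableOn ℂ f (Metric.ball (stereo ε (p b)) r) ∧
      ∀ y ∈ e.source, lam κ τ y ≠ 0 ∧ (lam κ τ y)⁻¹ - z y = f (stereo ε (p y)) := by
  set Ω' := Ω ∩ (lam κ τ) ⁻¹' {0}ᶜ with hΩ'
  have ho : IsOpen Ω' :=
    h.contDiffOn_lam.continuousOn.isOpen_inter_preimage h.isOpen isOpen_compl_singleton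
  have hs : Ω' ⊆ Ω := Set.inter_subset_left
  have h' := h.mono ho hs
  have hne : ∀ y ∈ Ω', lam κ τ y ≠ 0 := fun y hy => hy.2
  have hw : ∀ y ∈ Ω', ∀ u, fderiv ℝ (fun y => stereo ε (p y)) y u =
      lam κ τ y * zetaForm ε T p y u := by
    intro y hy u
    rw [(h'.hasFDerivAt_stereo hy hε (hD y (hs hy))).fderiv]; rfl
  have hws : ContDiffOn ℝ ∞ (fun y => stereo ε (p y)) Ω' := by
    rw [contDiffOn_infty_iff_fderiv_of_isOpen ho]
    refine ⟨fun y hy => (h'.hasFDerivAt_stereo hy hε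
      (hD y (hs hy))).differentiableAt.differentiableWithinAt, ?_⟩
    refine (h'.contDiffOn_lam.smul (h'.contDiffOn_zetaForm fun y hy => hD y (hs hy))).congr ?_
    intro y hy
    exact (h'.hasFDerivAt_stereo hy hε (hD y (hs hy))).fderiv
  obtain ⟨e, r, f, hr, hbe, hsub, heG, htar, hsymm, hf, hq⟩ :=
    exists_eq_holomorphic_comp (q := fun y => (lam κ τ y)⁻¹ - z y) ho hws (hzs.mono hs)
      ((h'.contDiffOn_lam.inv hne).sub (ofRealCLM.contDiff.comp_contDiffOn (hzs.mono hs)))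
      (fun y hy => h'.bijective_of_smul_zetaForm hy hε (hD y (hs hy)) (hne y hy) (hw y hy)
        (hz y (hs hy)))
      (by
        intro y hy
        obtain ⟨c, hc⟩ := h'.exists_fderiv_lam hy hε (hD y (hs hy)) (hom y (hs hy))
        refine ⟨-c / lam κ τ y ^ 3, fun u => ?_⟩
        have h1 := ((h'.contDiffOn_lam.contDiffAt (ho.mem_nhds hy)).differentiableAt
          (by simp)).hasFDerivAt
        have h2 := ((hzs.contDiffAt (h.isOpen.mem_nhds (hs hy))).differentiableAt
          (by simp)).hasFDerivAt
        have h3 := ((h1.inv_complex (hne y hy))).fun_sub (ofRealCLM.hasFDerivAt.comp y h2)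
        refine (congrArg (fun A => A u) h3.fderiv).trans ?_
        have hl := hne y hy
        rw [hw y hy]
        simp [hc, hz y (hs hy)]
        field_simp
        ring) (b := b) ⟨hb, hlam⟩
  exact ⟨e, r, f, hr, hbe, hsub.trans hs, heG, htar, hsymm, hf,
    fun y hy => ⟨hne y (hsub hy), hq y hy⟩⟩

/-- Unique continuation for `τ + i κ`. -/
lemma eventually_lam_eq_zero (h : IsTodaFrame Ω T om κ τ p) (hε : ε ^ 2 = 1)
    (hD : ∀ y ∈ Ω, 1 - ε * p y 0 ≠ 0)
    (hom : ∀ y ∈ Ω, ∀ u, om y u = 2 * τ y * (T y u ⬝ᵥ p y)) {z : E → ℝ} (hzs : ContDiffOn ℝ ∞ z Ω)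
    (hz : ∀ y ∈ Ω, ∀ u, fderiv ℝ z y u = -(T y u ⬝ᵥ p y)) {b : E} (hb : b ∈ Ω)
    (hlam : ∃ᶠ y in 𝓝 b, ∀ᶠ y' in 𝓝 y, lam κ τ y' = 0) : ∀ᶠ y in 𝓝 b, lam κ τ y = 0 := by
  set t : E → ℝ := fun y => z y - z b with ht
  have hts : ContDiffOn ℝ ∞ t Ω := hzs.sub contDiffOn_const
  set m : E → ℂ := fun y => 1 - t y * lam κ τ y with hm
  have hms : ContDiffOn ℝ ∞ m Ω :=
    contDiffOn_const.sub ((ofRealCLM.contDiff.comp_contDiffOn hts).mul h.contDiffOn_lam)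
  have ho' : IsOpen (Ω ∩ m ⁻¹' {0}ᶜ) :=
    hms.continuousOn.isOpen_inter_preimage h.isOpen isOpen_compl_singleton
  have hmb : m b ≠ 0 := by simp [hm, ht]
  obtain ⟨ρ, hρ, hball⟩ := Metric.isOpen_iff.1 ho' b ⟨hb, hmb⟩
  have ho : IsOpen (Metric.ball b ρ) := Metric.isOpen_ball
  have hs : Metric.ball b ρ ⊆ Ω := fun y hy => (hball hy).1
  have hm0 : ∀ y ∈ Metric.ball b ρ, m y ≠ 0 := fun y hy => (hball hy).2
  have h' := h.mono ho hs
  have hD' : ∀ y ∈ Metric.ball b ρ, 1 - ε * p y 0 ≠ 0 := fun y hy => hD y (hs hy)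
  have hdlam : ∀ y ∈ Metric.ball b ρ, HasFDerivAt (lam κ τ) (fderiv ℝ (lam κ τ) y) y :=
    fun y hy => ((h'.contDiffOn_lam.contDiffAt (ho.mem_nhds hy)).differentiableAt
          (by simp)).hasFDerivAt
  have hdt : ∀ y ∈ Metric.ball b ρ, HasFDerivAt (fun y => (t y : ℂ))
      (ofRealCLM.comp (fderiv ℝ z y)) y := by
    intro y hy
    have h2 := ((hzs.contDiffAt (h.isOpen.mem_nhds (hs hy))).differentiableAt
          (by simp)).hasFDerivAt
    exact ofRealCLM.hasFDerivAt.comp y (h2.sub_const (z b))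
  have hdm : ∀ y ∈ Metric.ball b ρ, HasFDerivAt m
      (-((t y : ℂ) • fderiv ℝ (lam κ τ) y + lam κ τ y • ofRealCLM.comp (fderiv ℝ z y))) y :=
    fun y hy => ((hdt y hy).fun_mul (hdlam y hy)).const_sub 1
  set Ψ : E → E →L[ℝ] ℂ := fun y => m y • zetaForm ε T p y with hΨ
  have hZs := h'.contDiffOn_zetaForm hD'
  have hΨs : ContDiffOn ℝ ∞ Ψ (Metric.ball b ρ) := (hms.mono hs).smul hZs
  obtain ⟨w, hw⟩ := (convex_ball b ρ).exists_forall_hasFDerivAt_of_fderiv_symmetric ho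
    (hΨs.differentiableOn (by simp)) (by
      intro y hy u v
      have hZ := ((hZs.contDiffAt (ho.mem_nhds hy)).differentiableAt (by simp)).hasFDerivAt
      have hd := (hdm y hy).fun_smul hZ
      obtain ⟨c, hc⟩ := h'.exists_fderiv_lam hy hε (hD' y hy) (hom y (hs hy))
      have hdz := h'.deriv_zetaForm hy hε hD' (hom y (hs hy)) u v
      rw [hΨ, hd.fderiv]
      simp [hc, hz y (hs hy)]
      have hmy : m y = 1 - t y * lam κ τ y := rfl
      rw [hmy]
      linear_combination (1 - t y * lam κ τ y) * hdz)
  have hw' : ∀ y ∈ Metric.ball b ρ, ∀ u, fderiv ℝ w y u = m y * zetaForm ε T p y u := by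
    intro y hy u
    rw [(hw y hy).fderiv]; rfl
  have hws : ContDiffOn ℝ ∞ w (Metric.ball b ρ) := by
    rw [contDiffOn_infty_iff_fderiv_of_isOpen ho]
    exact ⟨fun y hy => (hw y hy).differentiableAt.differentiableWithinAt,
      hΨs.congr fun y hy => (hw y hy).fderiv⟩
  have hdtz : ∀ y, fderiv ℝ t y = fderiv ℝ z y := fun y => fderiv_sub_const (z b)
  obtain ⟨e, r, f, hr, hbe, hsub, heG, htar, hsymm, hf, hq⟩ :=
    exists_eq_holomorphic_comp (q := fun y => lam κ τ y * (m y)⁻¹) ho hws (hts.mono hs)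
      (h'.contDiffOn_lam.mul ((hms.mono hs).inv hm0))
      (fun y hy => h'.bijective_of_smul_zetaForm hy hε (hD' y hy) (hm0 y hy) (hw' y hy)
        (by rw [hdtz]; exact hz y (hs hy)))
      (by
        intro y hy
        obtain ⟨c, hc⟩ := h'.exists_fderiv_lam hy hε (hD' y hy) (hom y (hs hy))
        refine ⟨c / m y ^ 3, fun u => ?_⟩
        have h3 := (hdlam y hy).fun_mul ((hdm y hy).inv_complex (hm0 y hy))
        refine (congrArg (fun A => A u) h3.fderiv).trans ?_
        have hl := hm0 y hy
        rw [hw' y hy]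
        have hmy : t y * lam κ τ y = 1 - m y := by simp [hm]
        simp [hc, hz y (hs hy)]
        field_simp
        linear_combination (lam κ τ y ^ 2 * ((T y u ⬝ᵥ p y : ℝ) : ℂ) + c * zetaForm ε T p y u) * hmy)
      (Metric.mem_ball_self hρ)
  have hfan : AnalyticOnNhd ℂ f (Metric.ball (w b) r) := hf.analyticOnNhd Metric.isOpen_ball
  obtain ⟨y, hy0, hye⟩ := (hlam.and_eventually (e.open_source.mem_nhds hbe)).exists
  have hwy : w y ∈ Metric.ball (w b) r := by
    have := e.map_source hye
    rw [htar, heG] at this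
    exact this.1
  have hfy : f =ᶠ[𝓝 (w y)] 0 := by
    have h1 : ContinuousAt (fun s : ℂ => e.symm (s, t y)) (w y) := by
      have : ContinuousAt e.symm (w y, t y) := by
        rw [← heG]; exact e.continuousAt_symm (e.map_source hye)
      exact ContinuousAt.comp (f := fun s : ℂ => (s, t y)) this (by fun_prop)
    have h2 : e.symm (w y, t y) = y := by rw [← heG]; exact e.left_inv hye
    have h3 := h1.eventually (p := fun y => lam κ τ y = 0) (by simpa only [h2] using hy0)
    filter_upwards [h3, Metric.isOpen_ball.mem_nhds hwy] with s hs hsb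
    have h4 : (s, t y) ∈ e.target := by
      have := e.map_source hye
      rw [htar, heG] at this
      rw [htar]; exact ⟨hsb, this.2⟩
    have h5 := hq _ (e.map_target h4)
    have h6 := e.right_inv h4
    rw [heG] at h6
    have h7 : w (e.symm (s, t y)) = s := congrArg Prod.fst h6
    rw [h7, hs, zero_mul] at h5
    exact h5.symm
  have hf0 := hfan.eqOn_zero_of_preconnected_of_eventuallyEq_zero
    (convex_ball (w b) r).isPreconnected hwy hfy
  filter_upwards [e.open_source.mem_nhds hbe] with y hy
  have h1 := e.map_source hy
  rw [htar, heG] at h1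
  have h2 := hq y hy
  rw [hf0 h1.1] at h2
  simpa [hm0 y (hsub hy)] using h2

/-- The gauge with connection form `2 τ η`, together with the function `z`. -/
lemma exists_normalized (h : IsTodaFrame Ω T om κ τ p) {b : E} (hb : b ∈ Ω)
    (hD : 1 - ε * p b 0 ≠ 0) : ∃ (Ω' : Set E) (f z : E → ℝ), Ω' ⊆ Ω ∧ b ∈ Ω' ∧
      ContDiffOn ℝ ∞ f Ω' ∧ ContDiffOn ℝ ∞ z Ω' ∧
      IsTodaFrame Ω' (fun y => Real.exp (f y) • T y) (fun y => om y - fderiv ℝ f y)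
        (fun y => Real.exp (-f y) * κ y) (fun y => Real.exp (-f y) * τ y) p ∧
      (∀ y ∈ Ω', 1 - ε * p y 0 ≠ 0) ∧
      (∀ y ∈ Ω', ∀ u, (om y - fderiv ℝ f y) u = 2 * (Real.exp (-f y) * τ y) *
        ((Real.exp (f y) • T y) u ⬝ᵥ p y)) ∧
      ∀ y ∈ Ω', ∀ u, fderiv ℝ z y u = -((Real.exp (f y) • T y) u ⬝ᵥ p y) := by
  have hc : ContinuousOn (fun y => 1 - ε * p y 0) Ω := by
    have := (contDiffOn_pi.1 h.contDiff_p 0).continuousOn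
    exact continuousOn_const.sub (continuousOn_const.mul this)
  obtain ⟨ρ, hρ, hball⟩ := Metric.isOpen_iff.1
    (hc.isOpen_inter_preimage h.isOpen isOpen_compl_singleton) b ⟨hb, hD⟩
  have ho : IsOpen (Metric.ball b ρ) := Metric.isOpen_ball
  have hs : Metric.ball b ρ ⊆ Ω := fun y hy => (hball hy).1
  have h' := h.mono ho hs
  obtain ⟨f, hf, hfd⟩ := h'.exists_gauge (convex_ball b ρ)
  have h1 := h'.gauge hf
  have hom : ∀ y ∈ Metric.ball b ρ, ∀ u, (om y - fderiv ℝ f y) u =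
      2 * (Real.exp (-f y) * τ y) * ((Real.exp (f y) • T y) u ⬝ᵥ p y) := by
    intro y hy u
    have e2 : Real.exp (-f y) * Real.exp (f y) = 1 := by rw [← Real.exp_add]; simp
    rw [_root_.sub_apply, hfd y hy, _root_.smul_apply, smul_dotProduct, smul_eq_mul]
    linear_combination (-2 * τ y * (T y u ⬝ᵥ p y)) * e2
  obtain ⟨z, hz⟩ := (convex_ball b ρ).exists_forall_hasFDerivAt_of_fderiv_symmetric ho
    (h1.contDiffOn_eta.neg.differentiableOn (by simp)) (by
      intro y hy u v
      have := h1.deriv_eta hy u v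
      rw [hom y hy, hom y hy] at this
      simp only [fderiv_fun_neg, _root_.neg_apply]
      linear_combination -this)
  refine ⟨Metric.ball b ρ, f, z, hs, Metric.mem_ball_self hρ, hf, ?_, h1,
    fun y hy => (hball hy).2, hom, fun y hy u => ?_⟩
  · rw [contDiffOn_infty_iff_fderiv_of_isOpen ho]
    exact ⟨fun y hy => (hz y hy).differentiableAt.differentiableWithinAt,
      h1.contDiffOn_eta.neg.congr fun y hy => (hz y hy).fderiv⟩
  · rw [(hz y hy).fderiv, _root_.neg_apply, eta_apply]

theorem exists_holomorphic_chart (h : IsTodaFrame Ω T om κ τ p) (hε : ε ^ 2 = 1) {b : E}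
    (hb : b ∈ Ω) (hD : 1 - ε * p b 0 ≠ 0) (hlam : lam κ τ b ≠ 0) :
    ∃ (e : OpenPartialHomeomorph E (ℂ × ℝ)) (r s : ℝ) (F : ℂ → ℂ) (f z : E → ℝ), b ∈ e.source ∧
      e.source ⊆ Ω ∧ (∀ y, e y = (stereo ε (p y), z y)) ∧
      e.target = Metric.ball (stereo ε (p b)) r ×ˢ Metric.ball s r ∧
      ContDiffOn ℝ ∞ e.symm e.target ∧ DifferentiableOn ℂ F (Metric.ball (stereo ε (p b)) r) ∧
      ContDiffOn ℝ ∞ f e.source ∧ ContDiffOn ℝ ∞ z e.source ∧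
      ∀ y ∈ e.source, 1 - ε * p y 0 ≠ 0 ∧
        lam κ τ y ≠ 0 ∧ z y + F (stereo ε (p y)) = Real.exp (f y) * (lam κ τ y)⁻¹ ∧
        (∀ u, fderiv ℝ f y u = om y u - 2 * τ y * (T y u ⬝ᵥ p y)) ∧
        ∀ u, fderiv ℝ z y u = -(Real.exp (f y) * (T y u ⬝ᵥ p y)) := by
  obtain ⟨Ω', f, z, hs, hb', hf, hz, h', hD', hom, hzd⟩ := h.exists_normalized hb hD
  have hl : ∀ y, lam (fun y => Real.exp (-f y) * κ y) (fun y => Real.exp (-f y) * τ y) y =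
      Real.exp (-f y) * lam κ τ y := by
    intro y; simp [lam]; ring
  obtain ⟨e, r, F, hr, hbe, hsub, heG, htar, hsymm, hF, hq⟩ :=
    h'.exists_chart_of_lam_ne_zero hε hD' hom hz hzd hb' (by
      rw [hl]; exact mul_ne_zero (by exact_mod_cast Real.exp_ne_zero _) hlam)
  refine ⟨e, r, z b, F, f, z, hbe, hsub.trans hs, heG, htar, hsymm, hF, hf.mono hsub,
    hz.mono hsub, fun y hy => ⟨hD' y (hsub hy), ?_, ?_, fun u => ?_, fun u => ?_⟩⟩
  · have := (hq y hy).1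
    rw [hl] at this
    exact right_ne_zero_of_mul this
  · rw [← (hq y hy).2, hl, Real.exp_neg]
    push_cast
    rw [mul_inv, inv_inv]
    ring
  · have := hom y (hsub hy) u
    have e2 : Real.exp (-f y) * Real.exp (f y) = 1 := by rw [← Real.exp_add]; simp
    rw [_root_.sub_apply, _root_.smul_apply, smul_dotProduct, smul_eq_mul] at this
    linear_combination -this - 2 * τ y * (T y u ⬝ᵥ p y) * e2
  · rw [hzd y (hsub hy), _root_.smul_apply, smul_dotProduct, smul_eq_mul]

theorem eventually_eq_zero_of_frequently (h : IsTodaFrame Ω T om κ τ p) (hε : ε ^ 2 = 1) {b : E}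
    (hb : b ∈ Ω) (hD : 1 - ε * p b 0 ≠ 0)
    (hlam : ∃ᶠ y in 𝓝 b, ∀ᶠ y' in 𝓝 y, lam κ τ y' = 0) : ∀ᶠ y in 𝓝 b, lam κ τ y = 0 := by
  obtain ⟨Ω', f, z, hs, hb', hf, hz, h', hD', hom, hzd⟩ := h.exists_normalized hb hD
  have hl : ∀ y, lam (fun y => Real.exp (-f y) * κ y) (fun y => Real.exp (-f y) * τ y) y = 0 ↔
      lam κ τ y = 0 := by
    intro y
    have : lam (fun y => Real.exp (-f y) * κ y) (fun y => Real.exp (-f y) * τ y) y =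
      Real.exp (-f y) * lam κ τ y := by simp [lam]; ring
    rw [this, mul_eq_zero, or_iff_right (by exact_mod_cast Real.exp_ne_zero _)]
  simpa only [hl] using h'.eventually_lam_eq_zero hε hD' hom hz hzd hb'
    (by simpa only [hl] using hlam)

end IsTodaFrame

end TodaLocal

section Sphere

open Matrix Complex

lemma mvfderiv_comp_fderiv {E : Type*} [NormedAddCommGroup E] [NormedSpace ℝ E]
    {H : Type*} [TopologicalSpace H] {I : ModelWithCorners ℝ E H}
    {M : Type*} [TopologicalSpace M] [ChartedSpace H M]
    {G : Type*} [NormedAddCommGroup G] [NormedSpace ℝ G]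
    {G' : Type*} [NormedAddCommGroup G'] [NormedSpace ℝ G'] {f : G → G'} {s : M → G} {x : M}
    (hf : DifferentiableAt ℝ f (s x)) (hs : MDifferentiableAt I 𝓘(ℝ, G) s x)
    (u : TangentSpace I x) :
    mvfderiv I (fun y => f (s y)) x u = fderiv ℝ f (s x) (mvfderiv I s x u) := by
  have h := mfderiv_comp x hf.mdifferentiableAt hs
  rw [mfderiv_eq_fderiv] at h
  exact congrArg (fun A : TangentSpace I x →L[ℝ] G' => A u) h

lemma mvfderiv_comp_mfderiv {E : Type*} [NormedAddCommGroup E] [NormedSpace ℝ E]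
    {H : Type*} [TopologicalSpace H] {I : ModelWithCorners ℝ E H}
    {M : Type*} [TopologicalSpace M] [ChartedSpace H M]
    {G : Type*} [NormedAddCommGroup G] [NormedSpace ℝ G]
    {E' : Type*} [NormedAddCommGroup E'] [NormedSpace ℝ E'] {H' : Type*}
    [TopologicalSpace H'] {I' : ModelWithCorners ℝ E' H'} {M' : Type*} [TopologicalSpace M']
    [ChartedSpace H' M'] {f : M' → M} {g : M → G} {x : M'}
    (hg : MDifferentiableAt I 𝓘(ℝ, G) g (f x)) (hf : MDifferentiableAt I' I f x)
    (v : TangentSpace I' x) :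
    mvfderiv I' (g ∘ f) x v = mvfderiv I g (f x) (mfderiv I' I f x v) :=
  congrArg (fun A : TangentSpace I' x →L[ℝ] G => A v) (mfderiv_comp x hg hf)

lemma exists_one_sub_mul_ne_zero (t : ℝ) : ∃ ε : ℝ, ε ^ 2 = 1 ∧ 1 - ε * t ≠ 0 := by
  by_cases h : t = 1
  · exact ⟨-1, by norm_num, by rw [h]; norm_num⟩
  · exact ⟨1, by norm_num, by rw [one_mul, sub_ne_zero]; exact Ne.symm h⟩

namespace S2

/-- The ambient coordinates of a point of the sphere. -/
def coords (p : S2) : Fin 3 → ℝ := (p : EuclideanSpace ℝ (Fin 3)).ofLp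

/-- The ambient coordinates as a continuous linear equivalence. -/
noncomputable abbrev ofLpL : EuclideanSpace ℝ (Fin 3) ≃L[ℝ] (Fin 3 → ℝ) :=
  EuclideanSpace.equiv (Fin 3) ℝ

lemma inner_eq_dotProduct (x y : EuclideanSpace ℝ (Fin 3)) : ⟪x, y⟫ = x.ofLp ⬝ᵥ y.ofLp := by
  simp [PiLp.inner_apply, dotProduct, mul_comm]

lemma coords_dotProduct_self (p : S2) : coords p ⬝ᵥ coords p = 1 := by
  rw [coords, ← inner_eq_dotProduct, real_inner_self_eq_norm_sq]
  simp

lemma contMDiff_val : ContMDiff (𝓡 2) 𝓘(ℝ, EuclideanSpace ℝ (Fin 3)) ∞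
    (fun q : S2 => (q : EuclideanSpace ℝ (Fin 3))) :=
  haveI : Fact (Module.finrank ℝ (EuclideanSpace ℝ (Fin 3)) = 2 + 1) := ⟨by simp⟩
  contMDiff_coe_sphere

lemma contMDiff_coords : ContMDiff (𝓡 2) 𝓘(ℝ, Fin 3 → ℝ) ∞ coords :=
  ofLpL.contDiff.contMDiff.comp contMDiff_val

lemma mvfderiv_coords (p : S2) (v : TangentSpace (𝓡 2) p) :
    mvfderiv (𝓡 2) coords p v = (toAmbient p v).ofLp :=
  mvfderiv_clm_comp (s := fun q : S2 => (q : EuclideanSpace ℝ (Fin 3)))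
    (ofLpL : EuclideanSpace ℝ (Fin 3) →L[ℝ] Fin 3 → ℝ)
    ((contMDiff_val p).mdifferentiableAt (by simp)) v

lemma toAmbient_dotProduct (p : S2) (v : TangentSpace (𝓡 2) p) :
    (toAmbient p v).ofLp ⬝ᵥ coords p = 0 := by
  have h1 := mvfderiv_comp_fderiv (f := fun X : Fin 3 → ℝ => X ⬝ᵥ X) (s := coords) (x := p)
    ((hasFDerivAt_id _).dotProduct (hasFDerivAt_id _)).differentiableAt
    ((contMDiff_coords p).mdifferentiableAt (by simp)) v
  have h2 : (fun q => coords q ⬝ᵥ coords q) = fun _ => 1 := funext coords_dotProduct_self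
  rw [h2, mvfderiv_const, mvfderiv_coords] at h1
  have h3 := ((hasFDerivAt_id (𝕜 := ℝ) (coords p)).dotProduct (hasFDerivAt_id (coords p))).fderiv
  simp only [id] at h3
  rw [h3] at h1
  simp [dotProduct_comm (coords p)] at h1
  linarith

lemma mem_of_dotProduct {X : Fin 3 → ℝ} (hX : X ⬝ᵥ X = 1) :
    WithLp.toLp 2 X ∈ Metric.sphere (0 : EuclideanSpace ℝ (Fin 3)) 1 := by
  rw [mem_sphere_zero_iff_norm, ← sq_eq_sq₀ (norm_nonneg _) zero_le_one,
    ← real_inner_self_eq_norm_sq, inner_eq_dotProduct]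
  simpa using hX

/-- Inverse stereographic projection, in ambient coordinates. -/
noncomputable def invStereoCoords (ε : ℝ) (z : ℂ) : Fin 3 → ℝ :=
  ![ε * (z.re ^ 2 + z.im ^ 2 - 1) / (z.re ^ 2 + z.im ^ 2 + 1), 2 * z.re / (z.re ^ 2 + z.im ^ 2 + 1),
    - 2 * ε * z.im / (z.re ^ 2 + z.im ^ 2 + 1)]

variable {ε : ℝ}

lemma invStereoCoords_dotProduct_self (hε : ε ^ 2 = 1) (z : ℂ) :
    invStereoCoords ε z ⬝ᵥ invStereoCoords ε z = 1 := by
  have h : z.re ^ 2 + z.im ^ 2 + 1 ≠ 0 := by positivity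
  simp [invStereoCoords, dotProduct, Fin.sum_univ_three]
  field_simp
  linear_combination (4 * z.im ^ 2 + (z.re ^ 2 + z.im ^ 2 - 1) ^ 2) * hε

lemma contDiff_invStereoCoords : ContDiff ℝ ∞ (invStereoCoords ε) := by
  have hre : ContDiff ℝ ∞ Complex.re := reCLM.contDiff
  have him : ContDiff ℝ ∞ Complex.im := imCLM.contDiff
  rw [contDiff_pi]
  have h : ∀ z : ℂ, z.re ^ 2 + z.im ^ 2 + 1 ≠ 0 := fun z => by positivity
  intro i
  fin_cases i <;> simp [invStereoCoords] <;> fun_prop (disch := exact h _)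

/-- Inverse stereographic projection. -/
noncomputable def invStereo (hε : ε ^ 2 = 1) (z : ℂ) : S2 :=
  ⟨WithLp.toLp 2 (invStereoCoords ε z), mem_of_dotProduct (invStereoCoords_dotProduct_self hε z)⟩

lemma coords_invStereo (hε : ε ^ 2 = 1) (z : ℂ) : coords (invStereo hε z) = invStereoCoords ε z :=
  rfl

lemma contMDiff_invStereo (hε : ε ^ 2 = 1) : ContMDiff 𝓘(ℝ, ℂ) (𝓡 2) ∞ (invStereo hε) := by
  have h : ContMDiff 𝓘(ℝ, ℂ) 𝓘(ℝ, EuclideanSpace ℝ (Fin 3)) ∞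
      (fun z => WithLp.toLp 2 (invStereoCoords ε z)) :=
    (ofLpL.symm.contDiff.comp contDiff_invStereoCoords).contMDiff
  have : Fact (Module.finrank ℝ (EuclideanSpace ℝ (Fin 3)) = 2 + 1) := ⟨by simp⟩
  exact h.codRestrict_sphere _

lemma one_sub_invStereoCoords_ne_zero (hε : ε ^ 2 = 1) (z : ℂ) :
    1 - ε * invStereoCoords ε z 0 ≠ 0 := by
  have h : z.re ^ 2 + z.im ^ 2 + 1 ≠ 0 := by positivity
  simp [invStereoCoords]
  field_simp
  rw [hε]; ring_nf; norm_num

lemma stereo_invStereoCoords (hε : ε ^ 2 = 1) (z : ℂ) : stereo ε (invStereoCoords ε z) = z := by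
  have h : z.re ^ 2 + z.im ^ 2 + 1 ≠ 0 := by positivity
  have h2 : 1 - ε * invStereoCoords ε z 0 = 2 / (z.re ^ 2 + z.im ^ 2 + 1) := by
    simp [invStereoCoords]
    field_simp
    rw [hε]; ring
  rw [stereo, h2]
  apply Complex.ext
  · rw [smul_re, sub_re, mul_re, I_re, I_im, ← ofReal_mul, ofReal_re, ofReal_im]
    simp [invStereoCoords]; field_simp
  · rw [smul_im, sub_im, mul_im, I_re, I_im, ← ofReal_mul, ofReal_re, ofReal_im, ofReal_im]
    simp [invStereoCoords]; field_simp
    linear_combination z.im * hε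

lemma invStereoCoords_stereo (hε : ε ^ 2 = 1) {p : Fin 3 → ℝ} (hp : p ⬝ᵥ p = 1)
    (hD : 1 - ε * p 0 ≠ 0) : invStereoCoords ε (stereo ε p) = p := by
  have hre : (stereo ε p).re = p 1 / (1 - ε * p 0) := by
    rw [stereo, smul_re]; simp; ring
  have him : (stereo ε p).im = - ε * p 2 / (1 - ε * p 0) := by
    rw [stereo, smul_im]; simp; ring
  simp only [dotProduct, Fin.sum_univ_three] at hp
  have h1 : (stereo ε p).re ^ 2 + (stereo ε p).im ^ 2 + 1 = 2 / (1 - ε * p 0) := by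
    rw [hre, him]
    field_simp
    grind
  have h2 : (stereo ε p).re ^ 2 + (stereo ε p).im ^ 2 - 1 = 2 * ε * p 0 / (1 - ε * p 0) := by
    have : (stereo ε p).re ^ 2 + (stereo ε p).im ^ 2 - 1 = 2 / (1 - ε * p 0) - 2 := by
      rw [← h1]; ring
    rw [this]
    field_simp
    ring
  unfold invStereoCoords
  rw [h1, h2, hre, him]
  ext i
  fin_cases i <;> simp <;> field_simp <;> grind

lemma invStereo_stereo (hε : ε ^ 2 = 1) {p : S2} (hD : 1 - ε * coords p 0 ≠ 0) :
    invStereo hε (stereo ε (coords p)) = p := by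
  apply Subtype.ext
  apply WithLp.ofLp_injective
  exact invStereoCoords_stereo hε (coords_dotProduct_self p) hD

lemma exists_toAmbient_eq (p : S2) {X : Fin 3 → ℝ} (hX : X ⬝ᵥ coords p = 0) :
    ∃ v : TangentSpace (𝓡 2) p, (toAmbient p v).ofLp = X := by
  have : Fact (Module.finrank ℝ (EuclideanSpace ℝ (Fin 3)) = 2 + 1) := ⟨by simp⟩
  have h := range_mvfderiv_subtypeVal (n := 2) p
  have h1 : WithLp.toLp 2 X ∈ (ℝ ∙ (p : EuclideanSpace ℝ (Fin 3)))ᗮ := by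
    rw [Submodule.mem_orthogonal_singleton_iff_inner_left, inner_eq_dotProduct]
    exact hX
  rw [← h] at h1
  obtain ⟨v, hv⟩ := h1
  exact ⟨v, congrArg WithLp.ofLp hv⟩

lemma toAmbient_injective (p : S2) : Function.Injective (toAmbient p) := by
  have : Fact (Module.finrank ℝ (EuclideanSpace ℝ (Fin 3)) = 2 + 1) := ⟨by simp⟩
  exact injective_mvfderiv_subtypeVal_sphere (n := 2) p

lemma contDiffAt_stereo {X : Fin 3 → ℝ} (hD : 1 - ε * X 0 ≠ 0) :
    ContDiffAt ℝ ∞ (stereo ε) X := by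
  have hc : ∀ i, ContDiffAt ℝ ∞ (fun Y : Fin 3 → ℝ => Y i) X := fun i => by fun_prop
  exact ((contDiffAt_const.sub (contDiffAt_const.mul (hc 0))).inv hD).smul
    ((ofRealCLM.contDiff.contDiffAt.comp X (hc 1)).sub
      ((contDiffAt_const.mul (ofRealCLM.contDiff.contDiffAt.comp X (hc 2))).mul contDiffAt_const))

lemma contMDiffAt_stereo {p : S2} (hD : 1 - ε * coords p 0 ≠ 0) :
    ContMDiffAt (𝓡 2) 𝓘(ℝ, ℂ) ∞ (fun q => stereo ε (coords q)) p :=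
  (contDiffAt_stereo hD).contMDiffAt.comp p (contMDiff_coords p)

lemma mvfderiv_stereo {p : S2} (hD : 1 - ε * coords p 0 ≠ 0) (v : TangentSpace (𝓡 2) p) :
    mvfderiv (𝓡 2) (fun q => stereo ε (coords q)) p v =
      dstereo ε (coords p) (toAmbient p v).ofLp := by
  rw [mvfderiv_comp_fderiv ((contDiffAt_stereo hD).differentiableAt (by simp))
    ((contMDiff_coords p).mdifferentiableAt (by simp)), mvfderiv_coords]
  have h : HasFDerivAt (stereo ε) _ (coords p) :=
    hasFDerivAt_stereo (hasFDerivAt_id (coords p)) hD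
  rw [h.fderiv]
  rfl

lemma isOpen_stereo_mem {B : Set ℂ} (hB : IsOpen B) :
    IsOpen {p : S2 | 1 - ε * coords p 0 ≠ 0 ∧ stereo ε (coords p) ∈ B} := by
  rw [isOpen_iff_mem_nhds]
  rintro p ⟨hp, hpB⟩
  have h0 : Continuous fun q : S2 => 1 - ε * coords q 0 :=
    continuous_const.sub (continuous_const.mul
      ((continuous_apply 0).comp contMDiff_coords.continuous))
  filter_upwards [h0.continuousAt.eventually_ne hp,
    (contMDiffAt_stereo hp).continuousAt.eventually_mem (hB.mem_nhds hpB)] with q h1 h2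
  exact ⟨h1, h2⟩

/-- A holomorphic function of the stereographic coordinate is holomorphic on the sphere. -/
theorem _root_.DifferentiableOn.holomorphicOnS2 (hε : ε ^ 2 = 1) {F : ℂ → ℂ} {B : Set ℂ}
    (hB : IsOpen B) (hF : DifferentiableOn ℂ F B) :
    HolomorphicOnS2 (fun p => F (stereo ε (coords p)))
      {p : S2 | 1 - ε * coords p 0 ≠ 0 ∧ stereo ε (coords p) ∈ B} := by
  rintro p ⟨hp, hpB⟩
  have hd := (hF.differentiableAt (hB.mem_nhds hpB)).hasDerivAt.hasFDerivAt.restrictScalars ℝ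
  have hs := (contMDiffAt_stereo hp).mdifferentiableAt (by simp)
  refine ⟨hd.differentiableAt.mdifferentiableAt.comp p hs, fun v w hvw => ?_⟩
  have hc : ∀ u, mvfderiv (𝓡 2) (fun p => F (stereo ε (coords p))) p u = _ := fun u =>
    mvfderiv_comp_fderiv (s := fun q : S2 => stereo ε (coords q)) hd.differentiableAt hs u
  rw [hc, hc, mvfderiv_stereo hp, mvfderiv_stereo hp, hvw, hd.fderiv]
  have h1 := dstereo_cross hε hp (coords_dotProduct_self p) (toAmbient_dotProduct p v)
  rw [coords] at h1 ⊢
  rw [h1]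
  simp
  ring

lemma toAmbient_mfderiv_invStereo (hε : ε ^ 2 = 1) (z w : ℂ) :
    (toAmbient (invStereo hε z) (mfderiv 𝓘(ℝ, ℂ) (𝓡 2) (invStereo hε) z w)).ofLp =
      fderiv ℝ (invStereoCoords ε) z w := by
  rw [← mvfderiv_coords]
  have h := mvfderiv_comp_mfderiv (I' := 𝓘(ℝ, ℂ)) (f := invStereo hε) (g := coords) (x := z)
    ((contMDiff_coords _).mdifferentiableAt (by simp))
    ((contMDiff_invStereo hε z).mdifferentiableAt (by simp)) w
  rw [← h]
  exact congrArg (fun A : ℂ →L[ℝ] (Fin 3 → ℝ) => A w) mfderiv_eq_fderiv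

lemma fderiv_invStereoCoords_I (hε : ε ^ 2 = 1) (z : ℂ) : fderiv ℝ (invStereoCoords ε) z I =
    invStereoCoords ε z ⨯₃ fderiv ℝ (invStereoCoords ε) z 1 := by
  have hd := ((contDiff_invStereoCoords (ε := ε)).differentiable (by simp) z).hasFDerivAt
  have hD := one_sub_invStereoCoords_ne_zero hε z
  have hpp := invStereoCoords_dotProduct_self hε z
  have h1 := hasFDerivAt_stereo hd hD
  rw [show (fun y => stereo ε (invStereoCoords ε y)) = id from
    funext fun y => stereo_invStereoCoords hε y] at h1
  have h2 := h1.unique (hasFDerivAt_id z)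
  have h3 : ∀ w, dstereo ε (invStereoCoords ε z) (fderiv ℝ (invStereoCoords ε) z w) = w :=
    fun w => congrArg (fun A => A w) h2
  have h4 : ∀ w, fderiv ℝ (invStereoCoords ε) z w ⬝ᵥ invStereoCoords ε z = 0 := by
    intro w
    rw [← toAmbient_mfderiv_invStereo hε]
    exact toAmbient_dotProduct _ _
  have h5 := dstereo_cross hε hD hpp (h4 1)
  rw [h3, mul_one, ← h3 I] at h5
  have h6 : (fderiv ℝ (invStereoCoords ε) z I -
    invStereoCoords ε z ⨯₃ fderiv ℝ (invStereoCoords ε) z 1) ⬝ᵥ invStereoCoords ε z = 0 := by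
    rw [sub_dotProduct, h4, dotProduct_comm, dot_self_cross, sub_zero]
  have h7 := normSq_dstereo hε hD hpp h6
  rw [map_sub, h5, sub_self, map_zero, eq_comm, mul_eq_zero, dotProduct_self_eq_zero] at h7
  rcases h7 with h7 | h7
  · simp [hD] at h7
  · exact sub_eq_zero.1 h7

/-- Holomorphic functions on the sphere are smooth. -/
theorem _root_.HolomorphicOnS2.contMDiffOn {h : S2 → ℂ} {U : Set S2} (hh : HolomorphicOnS2 h U)
    (hU : IsOpen U) : ContMDiffOn (𝓡 2) 𝓘(ℝ, ℂ) ∞ h U := by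
  intro p hp
  obtain ⟨ε, hε, hD⟩ := exists_one_sub_mul_ne_zero (coords p 0)
  set W : Set ℂ := invStereo hε ⁻¹' U with hW
  have hWo : IsOpen W := hU.preimage (contMDiff_invStereo hε).continuous
  have hg : DifferentiableOn ℂ (fun z => h (invStereo hε z)) W := by
    intro z hz
    obtain ⟨h1, h2⟩ := hh _ hz
    have hi := (contMDiff_invStereo hε z).mdifferentiableAt (n := ∞) (by simp)
    have h3 : MDifferentiableAt 𝓘(ℝ, ℂ) 𝓘(ℝ, ℂ) (fun z => h (invStereo hε z)) z := h1.comp z hi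
    have h4 : ∀ w, fderiv ℝ (fun z => h (invStereo hε z)) z w =
        mvfderiv (𝓡 2) h (invStereo hε z) (mfderiv 𝓘(ℝ, ℂ) (𝓡 2) (invStereo hε) z w) := by
      intro w
      have h5 := mvfderiv_comp_mfderiv (I' := 𝓘(ℝ, ℂ)) (f := invStereo hε) (g := h) (x := z) h1 hi w
      rw [← h5]
      exact congrArg (fun A : ℂ →L[ℝ] ℂ => A w) mfderiv_eq_fderiv.symm
    refine (differentiableAt_complex_iff_differentiableAt_real.2
      ⟨mdifferentiableAt_iff_differentiableAt.1 h3, ?_⟩).differentiableWithinAt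
    rw [h4, h4, smul_eq_mul]
    apply h2
    rw [toAmbient_mfderiv_invStereo, toAmbient_mfderiv_invStereo, fderiv_invStereoCoords_I hε]
    rfl
  have hpW : stereo ε (coords p) ∈ W := by
    rw [hW, Set.mem_preimage, invStereo_stereo hε hD]; exact hp
  have hgs : ContDiffAt ℝ ∞ (fun z => h (invStereo hε z)) (stereo ε (coords p)) :=
    ((hg.contDiffOn hWo).contDiffAt (hWo.mem_nhds hpW)).restrict_scalars ℝ
  refine ContMDiffAt.contMDiffWithinAt ?_
  refine ContMDiffAt.congr_of_eventuallyEq (hgs.contMDiffAt.comp p (contMDiffAt_stereo hD)) ?_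
  have h0 : Continuous fun q : S2 => 1 - ε * coords q 0 :=
    continuous_const.sub (continuous_const.mul
      ((continuous_apply 0).comp contMDiff_coords.continuous))
  filter_upwards [h0.continuousAt.eventually_ne hD] with q hq
  exact congrArg h (invStereo_stereo hε hq).symm

end S2

end Sphere

section FormSections

variable {E : Type*} [NormedAddCommGroup E] [NormedSpace ℝ E]
  {H : Type*} [TopologicalSpace H] {I : ModelWithCorners ℝ E H}
  {M : Type*} [TopologicalSpace M] [ChartedSpace H M] [IsManifold I ∞ M]
  {E' : Type*} [NormedAddCommGroup E'] [NormedSpace ℝ E']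
  {G : Type*} [NormedAddCommGroup G] [NormedSpace ℝ G]

lemma mvfderiv_extChartAt_symm_trivializationAt {b x : M} (hx : x ∈ (chartAt H b).source) (v : E) :
    mvfderiv I (extChartAt I b) x
      ((trivializationAt E (TangentSpace I : M → Type _) b).symm x v) = v := by
  rw [← trivializationAt_snd_eq_mvfderiv hx]
  have h := (trivializationAt E (TangentSpace I : M → Type _) b).apply_mk_symm
    (b := x) (by simpa using hx) v
  exact congrArg Prod.snd h

/-- A one-form is smooth if it is the pull-back of a smooth family of forms. -/
lemma contMDiffAt_oneForm [I.Boundaryless] {F : M → E'} {A : M → E' →L[ℝ] ℝ} {x : M}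
    (hF : ContMDiffAt I 𝓘(ℝ, E') ∞ F x) (hA : ContMDiffAt I 𝓘(ℝ, E' →L[ℝ] ℝ) ∞ A x)
    (θ : (y : M) → TangentSpace I y →L[ℝ] ℝ)
    (hθ : ∀ y u, θ y u = A y (mvfderiv I F y u)) :
    ContMDiffAt I (I.prod 𝓘(ℝ, E →L[ℝ] ℝ)) ∞
      (fun y => TotalSpace.mk' (E →L[ℝ] ℝ) (E := fun x : M => TangentSpace I x →L[ℝ] ℝ) y (θ y))
      x := by
  have h : ContMDiffAt I 𝓘(ℝ, E →L[ℝ] ℝ) ∞ (fun y => (A y).comp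
      (fderiv ℝ (F ∘ (extChartAt I x).symm) (extChartAt I x y))) x :=
    hA.clm_comp (contMDiffAt_fderiv_comp_extChartAt hF)
  refine (contMDiffAt_hom_bundle _).2 ⟨contMDiffAt_id, h.congr_of_eventuallyEq ?_⟩
  filter_upwards [hF.eventually_mvfderiv_eq, (chartAt H x).open_source.mem_nhds
    (mem_chart_source H x)] with y hy hy'
  ext v
  rw [ContinuousLinearMap.inCoordinates_eq (by simpa using hy') (by simp)]
  have h2 := hy ((trivializationAt E (TangentSpace I : M → Type _) x).symm y v)
  rw [mvfderiv_extChartAt_symm_trivializationAt hy'] at h2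
  simp [hθ, h2]

lemma contMDiffAt_twoTensor [I.Boundaryless] {F : M → E'} {A : M → E' →L[ℝ] E' →L[ℝ] ℝ} {x : M}
    (hF : ContMDiffAt I 𝓘(ℝ, E') ∞ F x) (hA : ContMDiffAt I 𝓘(ℝ, E' →L[ℝ] E' →L[ℝ] ℝ) ∞ A x)
    (θ : (y : M) → TangentSpace I y →L[ℝ] TangentSpace I y →L[ℝ] ℝ)
    (hθ : ∀ y u v, θ y u v = A y (mvfderiv I F y u) (mvfderiv I F y v)) :
    ContMDiffAt I (I.prod 𝓘(ℝ, E →L[ℝ] E →L[ℝ] ℝ)) ∞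
      (fun y => TotalSpace.mk' (E →L[ℝ] E →L[ℝ] ℝ)
        (E := fun x : M => TangentSpace I x →L[ℝ] TangentSpace I x →L[ℝ] ℝ) y (θ y)) x := by
  have h1 := contMDiffAt_fderiv_comp_extChartAt hF
  have h : ContMDiffAt I 𝓘(ℝ, E →L[ℝ] E →L[ℝ] ℝ) ∞ (fun y => (A y).bilinearComp
      (fderiv ℝ (F ∘ (extChartAt I x).symm) (extChartAt I x y))
      (fderiv ℝ (F ∘ (extChartAt I x).symm) (extChartAt I x y))) x := by
    have h2 := hA.clm_comp h1
    have h3 : ContMDiffAt I 𝓘(ℝ, (E' →L[ℝ] ℝ) →L[ℝ] (E →L[ℝ] ℝ)) ∞ (fun y =>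
        (ContinuousLinearMap.compL ℝ E E' ℝ).flip
          (fderiv ℝ (F ∘ (extChartAt I x).symm) (extChartAt I x y))) x :=
      ContMDiffAt.comp x (ContinuousLinearMap.contMDiff _).contMDiffAt h1
    exact h3.clm_comp h2
  refine (contMDiffAt_hom_bundle _).2 ⟨contMDiffAt_id, h.congr_of_eventuallyEq ?_⟩
  filter_upwards [hF.eventually_mvfderiv_eq, (chartAt H x).open_source.mem_nhds
    (mem_chart_source H x)] with y hy hy'
  ext v w
  rw [inCoordinates_apply_eq₂ (by simpa using hy') (by simpa using hy') (by simp)]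
  simp only [hθ, hy, mvfderiv_extChartAt_symm_trivializationAt hy']
  simp

end FormSections

section FrameWeylSpace

open Matrix

variable {E : Type*} [NormedAddCommGroup E] [NormedSpace ℝ E] [FiniteDimensional ℝ E]
  {H : Type*} [TopologicalSpace H] {I : ModelWithCorners ℝ E H}
  {M : Type*} [TopologicalSpace M] [ChartedSpace H M] [IsManifold I ∞ M]
  {E' : Type*} [NormedAddCommGroup E'] [NormedSpace ℝ E']

lemma mvfderiv_dotProduct [I.Boundaryless] {a b : M → Fin 3 → ℝ} {x : M}
    (ha : MDifferentiableAt I 𝓘(ℝ, Fin 3 → ℝ) a x) (hb : MDifferentiableAt I 𝓘(ℝ, Fin 3 → ℝ) b x)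
    (u : TangentSpace I x) : mvfderiv I (fun y => a y ⬝ᵥ b y) x u =
      mvfderiv I a x u ⬝ᵥ b x + a x ⬝ᵥ mvfderiv I b x u := by
  have h1 : MDifferentiableAt I 𝓘(ℝ, (Fin 3 → ℝ) →L[ℝ] ℝ) (fun y => dotL (a y)) x :=
    dotL.mdifferentiableAt.comp x ha
  have h2 := mvfderiv_clm_apply h1 hb u
  rw [mvfderiv_clm_comp dotL ha] at h2
  exact h2

/-- The coframe `T ∘ dF` with its structure equation: data from which a Weyl connection with
connection form `weylForm om (κ • T)` is obtained. -/
structure IsWeylCoframe (I : ModelWithCorners ℝ E H) (F : M → E') (T : M → E' →L[ℝ] (Fin 3 → ℝ))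
    (om : M → E' →L[ℝ] ℝ) (κ : M → ℝ) : Prop where
  contMDiff_map : ContMDiff I 𝓘(ℝ, E') ∞ F
  contMDiff_coframe : ContMDiff I 𝓘(ℝ, E' →L[ℝ] (Fin 3 → ℝ)) ∞ T
  contMDiff_om : ContMDiff I 𝓘(ℝ, E' →L[ℝ] ℝ) ∞ om
  contMDiff_twist : ContMDiff I 𝓘(ℝ, ℝ) ∞ κ
  bijective : ∀ x, Function.Bijective (fun u : TangentSpace I x => T x (mvfderiv I F x u))
  torsion : ∀ (x : M) (u v : TangentSpace I x),
    mvfderiv I T x u (mvfderiv I F x v) - mvfderiv I T x v (mvfderiv I F x u)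
      + weylForm (om x) (κ x • T x) (mvfderiv I F x u) (T x (mvfderiv I F x v))
      - weylForm (om x) (κ x • T x) (mvfderiv I F x v) (T x (mvfderiv I F x u)) = 0

namespace IsWeylCoframe

variable {F : M → E'} {T : M → E' →L[ℝ] (Fin 3 → ℝ)} {om : M → E' →L[ℝ] ℝ} {κ : M → ℝ}

/-- The coframe as a linear equivalence. -/
noncomputable def equiv (h : IsWeylCoframe I F T om κ) (x : M) :
    TangentSpace I x ≃L[ℝ] (Fin 3 → ℝ) :=
  let Φ : E →ₗ[ℝ] (Fin 3 → ℝ) := ((T x).comp (mvfderiv I F x)).toLinearMap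
  (LinearEquiv.ofBijective Φ (h.bijective x)).toContinuousLinearEquiv

lemma equiv_apply (h : IsWeylCoframe I F T om κ) (x : M) (u : TangentSpace I x) :
    h.equiv x u = T x (mvfderiv I F x u) := rfl

variable [I.Boundaryless]

lemma mdifferentiableAt_components (h : IsWeylCoframe I F T om κ) {Y : (y : M) → TangentSpace I y}
    {x : M} (hY : MDifferentiableAt I I.tangent (fun y => (⟨y, Y y⟩ : TangentBundle I M)) x) :
    MDifferentiableAt I 𝓘(ℝ, Fin 3 → ℝ) (fun y => T y (mvfderiv I F y (Y y))) x :=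
  ((h.contMDiff_coframe x).mdifferentiableAt (by simp)).clm_apply
    (MDifferentiableAt.mvfderiv_vectorField (h.contMDiff_map x) hY)

/-- The metric in which the coframe is orthonormal, as a bilinear form. -/
noncomputable def inner (h : IsWeylCoframe I F T om κ) (x : M) :
    TangentSpace I x →L[ℝ] TangentSpace I x →L[ℝ] ℝ :=
  let Φ : E ≃L[ℝ] (Fin 3 → ℝ) := h.equiv x
  let B : E →L[ℝ] E →L[ℝ] ℝ :=
    dotL.bilinearComp (Φ : E →L[ℝ] (Fin 3 → ℝ)) (Φ : E →L[ℝ] (Fin 3 → ℝ))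
  B

lemma inner_apply (h : IsWeylCoframe I F T om κ) (x : M) (u v : TangentSpace I x) :
    h.inner x u v = h.equiv x u ⬝ᵥ h.equiv x v := rfl

/-- The metric in which the coframe is orthonormal. -/
noncomputable def metric (h : IsWeylCoframe I F T om κ) :
    ContMDiffRiemannianMetric I ∞ E (fun x : M => TangentSpace I x) where
  inner x := h.inner x
  symm x v w := by rw [inner_apply, inner_apply, dotProduct_comm]
  pos x v hv := by
    have h1 : h.equiv x v ≠ 0 := by simpa using hv
    have h2 : 0 ≤ h.equiv x v ⬝ᵥ h.equiv x v := by
      simpa using dotProduct_star_self_nonneg (h.equiv x v)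
    exact lt_of_le_of_ne h2 fun h3 => h1 (dotProduct_self_eq_zero.1 h3.symm)
  isVonNBounded x := by
    have h1 : {v : TangentSpace I x | h.inner x v v < 1} ⊆
        ((h.equiv x).symm : (Fin 3 → ℝ) →L[ℝ] TangentSpace I x) '' Metric.closedBall 0 1 := by
      intro v hv
      refine ⟨h.equiv x v, ?_, by simp⟩
      rw [mem_closedBall_zero_iff, pi_norm_le_iff_of_nonneg zero_le_one]
      intro i
      have h2 : h.equiv x v ⬝ᵥ h.equiv x v < 1 := hv
      have h3 : h.equiv x v i * h.equiv x v i ≤ h.equiv x v ⬝ᵥ h.equiv x v :=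
        Finset.single_le_sum (f := fun i => h.equiv x v i * h.equiv x v i)
          (fun j _ => mul_self_nonneg _) (Finset.mem_univ i)
      rw [Real.norm_eq_abs]
      nlinarith [abs_mul_abs_self (h.equiv x v i), abs_nonneg (h.equiv x v i)]
    exact ((NormedSpace.isVonNBounded_closedBall ℝ _ _).image _).subset h1
  contMDiff x := by
    have h3 : ContMDiffAt I 𝓘(ℝ, ((Fin 3 → ℝ) →L[ℝ] ℝ) →L[ℝ] (E' →L[ℝ] ℝ)) ∞ (fun y =>
        (ContinuousLinearMap.compL ℝ E' (Fin 3 → ℝ) ℝ).flip (T y)) x :=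
      ContMDiffAt.comp x (ContinuousLinearMap.contMDiff _).contMDiffAt (h.contMDiff_coframe x)
    have h4 : ContMDiffAt I 𝓘(ℝ, E' →L[ℝ] (Fin 3 → ℝ) →L[ℝ] ℝ) ∞ (fun y => dotL.comp (T y)) x :=
      contMDiffAt_const.clm_comp (h.contMDiff_coframe x)
    exact contMDiffAt_twoTensor (h.contMDiff_map x) (h3.clm_comp h4) _ fun y u v => rfl

/-- The Weyl connection of a coframe. -/
noncomputable def connection (h : IsWeylCoframe I F T om κ) :
    CovariantDerivative I E (fun x : M => TangentSpace I x) where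
  toFun Y x := ((h.equiv x).symm : (Fin 3 → ℝ) →L[ℝ] TangentSpace I x).comp
    (mvfderiv I (fun y => T y (mvfderiv I F y (Y y))) x
      + ((weylForm (om x) (κ x • T x)).flip (T x (mvfderiv I F x (Y x)))).comp (mvfderiv I F x))
  isCovariantDerivativeOnUniv := by
    constructor
    · intro Y Z x hY hZ _
      have h1 := mvfderiv_add (h.mdifferentiableAt_components hY) (h.mdifferentiableAt_components hZ)
      have h2 : (fun y => T y (mvfderiv I F y ((Y + Z) y))) = 
        (fun y => T y (mvfderiv I F y (Y y))) + fun y => T y (mvfderiv I F y (Z y)) := by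
        ext y : 1; simp
      rw [h2, h1]
      ext u : 1
      simp
      abel
    · intro Y f x hY hf _
      have h1 := mvfderiv_smul hf (h.mdifferentiableAt_components hY)
      have h2 : (fun y => T y (mvfderiv I F y ((f • Y) y))) =
          f • (fun y => T y (mvfderiv I F y (Y y))) := by
        ext y : 1; simp
      rw [h2, h1]
      ext u : 1
      apply (h.equiv x).injective
      have h3 : h.equiv x (Y x) = T x (mvfderiv I F x (Y x)) := rfl
      simp
      rw [h3]
      module

lemma equiv_connection (h : IsWeylCoframe I F T om κ) (Y : (y : M) → TangentSpace I y) (x : M)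
    (u : TangentSpace I x) : h.equiv x (h.connection Y x u) =
      mvfderiv I (fun y => h.equiv y (Y y)) x u
        + weylForm (om x) (κ x • T x) (mvfderiv I F x u) (h.equiv x (Y x)) :=
  (h.equiv x).apply_symm_apply _

/-- The Weyl space of a coframe. -/
noncomputable def weylSpace (h : IsWeylCoframe I F T om κ) : WeylSpace I M where
  g := h.metric
  om x := (om x).comp (mvfderiv I F x)
  smooth_om x := contMDiffAt_oneForm (h.contMDiff_map x) (h.contMDiff_om x) _ fun y u => rfl
  D := h.connection
  torsion_free := by
    have : CompleteSpace E := FiniteDimensional.complete ℝ E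
    ext x u v
    have hU := FiberBundle.mdifferentiableAt_extend I E u
    have hV := FiberBundle.mdifferentiableAt_extend I E v
    apply (h.equiv x).injective
    rw [CovariantDerivative.torsion_apply_eq_extend, map_sub, map_sub, equiv_connection,
      equiv_connection]
    have h3 := mvfderiv_form_mlieBracket (h.contMDiff_map x)
      ((h.contMDiff_coframe x).mdifferentiableAt (by simp)) hU hV
    have h4 := h.torsion x u v
    simp only [FiberBundle.extend_apply_self] at h3 ⊢
    rw [← h3] at h4
    have h5 : h.equiv x ((0 : (x : M) → TangentSpace I x →L[ℝ] TangentSpace I x →L[ℝ]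
      TangentSpace I x) x u v) = 0 := by simp
    rw [h5, ← h4]
    simp only [equiv_apply]
    abel
  conformal Y Z x u hY hZ := by
    have h1 := mvfderiv_dotProduct (h.mdifferentiableAt_components hY)
      (h.mdifferentiableAt_components hZ) u
    have h2 : (fun y => h.metric.inner y (Y y) (Z y)) = fun y =>
      T y (mvfderiv I F y (Y y)) ⬝ᵥ T y (mvfderiv I F y (Z y)) := rfl
    rw [h2, h1]
    change _ - h.equiv x (h.connection Y x u) ⬝ᵥ h.equiv x (Z x) - h.equiv x (Y x) ⬝ᵥ
      h.equiv x (h.connection Z x u) = -2 * om x (mvfderiv I F x u) * (h.equiv x (Y x) ⬝ᵥ h.equiv x (Z x))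
    rw [equiv_connection, equiv_connection]
    simp only [equiv_apply, weylForm_apply]
    generalize mvfderiv I (fun y => T y (mvfderiv I F y (Y y))) x u = a
    generalize mvfderiv I (fun y => T y (mvfderiv I F y (Z y))) x u = b
    generalize T x (mvfderiv I F x (Y x)) = c
    generalize T x (mvfderiv I F x (Z x)) = d
    simp [dotProduct, Fin.sum_univ_three, cross_apply, Matrix.vecHead, Matrix.vecTail]
    ring

lemma hasConnectionFormAt (h : IsWeylCoframe I F T om κ) (x : M) :
    h.weylSpace.HasConnectionFormAt F T (fun y => weylForm (om y) (κ y • T y)) x :=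
  fun Y _ u => h.equiv_connection Y x u

theorem isEinsteinWeyl (h : IsWeylCoframe I F T om κ) : h.weylSpace.IsEinsteinWeyl := by
  intro x
  have h1 := (WeylSpace.HasConnectionFormAt.ricci (W := h.weylSpace) (α := fun _ => 0) (κ := κ)
    (om := om) (T := T) (F := F) (x := x)
    (Filter.Eventually.of_forall fun y => by simpa using h.hasConnectionFormAt y)
    (h.contMDiff_map x) (h.contMDiff_coframe x) (h.contMDiff_om x) contMDiffAt_const
    (h.contMDiff_twist x) (h.equiv x).toLinearEquiv (fun u => rfl)).2
  refine ⟨2 * κ x ^ 2, fun v w => ?_⟩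
  rw [h1]
  have h2 : ∀ u v, WeylSpace.formDeriv (I := I) F (fun _ : M => (0 : E' →L[ℝ] ℝ)) x u v = 0 := by
    intro u v
    simp [WeylSpace.formDeriv_apply, mvfderiv_const]
  rw [h2, h2]
  simp only [add_zero, zero_div]
  rfl

/-- A vector-valued function that satisfies the equation of a shear-free geodesic congruence
in the coframe represents such a congruence. -/
theorem isShearFreeGeodesic (h : IsWeylCoframe I F T om κ) {p : M → Fin 3 → ℝ} {τ σ : M → ℝ}
    (hp : ContMDiff I 𝓘(ℝ, Fin 3 → ℝ) ∞ p) (hpp : ∀ x, p x ⬝ᵥ p x = 1)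
    (hd : ∀ (x : M) (u : TangentSpace I x), mvfderiv I p x u =
      τ x • (h.equiv x u - (p x ⬝ᵥ h.equiv x u) • p x) + σ x • (p x ⨯₃ h.equiv x u)) :
    h.weylSpace.IsShearFreeGeodesic (fun x => (h.equiv x).symm (p x)) τ (fun x => σ x - κ x)
      (fun x => (h.equiv x).symm.toLinearMap ∘ₗ crossProduct (p x) ∘ₗ (h.equiv x).toLinearMap) where
  congruence :=
    { smooth := fun x => contMDiffAt_of_frame (h.contMDiff_map x) (h.contMDiff_coframe x)
        (h.bijective x) _ (by
          have h1 : (fun y => T y (mvfderiv I F y ((h.equiv y).symm (p y)))) = p :=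
            funext fun y => (h.equiv y).apply_symm_apply (p y)
          rw [h1]
          exact hp x)
      unit := fun x => by
        change h.equiv x _ ⬝ᵥ h.equiv x _ = 1
        simp [hpp] }
  star x :=
    { ker := by simp
      skew := fun u v => by
        change h.equiv x _ ⬝ᵥ h.equiv x _ = -(h.equiv x _ ⬝ᵥ h.equiv x _)
        simp only [LinearMap.comp_apply, LinearEquiv.coe_coe,
          ContinuousLinearEquiv.apply_symm_apply, ContinuousLinearEquiv.coe_toLinearEquiv]
        generalize h.equiv x u = a
        generalize h.equiv x v = b
        simp [dotProduct, Fin.sum_univ_three, cross_apply]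
        ring
      sq := fun u => by
        apply (h.equiv x).injective
        have h1 : h.weylSpace.g.inner x ((h.equiv x).symm (p x)) u = p x ⬝ᵥ h.equiv x u := by
          change h.equiv x _ ⬝ᵥ h.equiv x _ = _
          simp
        rw [h1]
        simp only [LinearMap.comp_apply, LinearEquiv.coe_coe, map_neg, map_sub, map_smul,
          ContinuousLinearEquiv.apply_symm_apply, ContinuousLinearEquiv.coe_toLinearEquiv]
        generalize h.equiv x u = a
        have h2 := hpp x
        simp only [dotProduct, Fin.sum_univ_three] at h2
        ext i
        fin_cases i <;>
          simp [dotProduct, Fin.sum_univ_three, cross_apply] <;>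
          grind }
  eqn x u := by
    have h1 : h.weylSpace.g.inner x ((h.equiv x).symm (p x)) u = p x ⬝ᵥ h.equiv x u := by
      change h.equiv x _ ⬝ᵥ h.equiv x _ = _
      simp
    rw [h1]
    apply (h.equiv x).injective
    have h2 := h.equiv_connection (fun x => (h.equiv x).symm (p x)) x u
    simp only [ContinuousLinearEquiv.apply_symm_apply, hd, weylForm_apply] at h2
    change h.equiv x (h.connection _ x u - om x (mvfderiv I F x u) • _) = _
    have h3 : (κ x • T x) (mvfderiv I F x u) = κ x • h.equiv x u := rfl
    rw [h3, map_smul, LinearMap.smul_apply] at h2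
    rw [map_sub, h2, map_smul]
    simp only [LinearMap.comp_apply, LinearEquiv.coe_coe, map_add, map_sub, map_smul,
      ContinuousLinearEquiv.apply_symm_apply, ContinuousLinearEquiv.coe_toLinearEquiv]
    rw [← cross_anticomm (p x)]
    module

end IsWeylCoframe

end FrameWeylSpace

section ModelAlgebra

open Matrix

variable {x P Q : Fin 3 → ℝ}

lemma rotate_cross_rotate (hx : x ⬝ᵥ x = 1) (hP : P ⬝ᵥ x = 0) (hQ : Q ⬝ᵥ x = 0) (m b : ℝ) :
    (m • P + b • (x ⨯₃ P)) ⨯₃ (m • Q + b • (x ⨯₃ Q)) = (m ^ 2 + b ^ 2) • (P ⨯₃ Q) := by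
  have h1 : x ⨯₃ (P ⨯₃ Q) = 0 := by
    rw [cross_cross_eq_smul_sub_smul', hP, dotProduct_comm, hQ]
    simp
  have h2 : P ⨯₃ (x ⨯₃ Q) + (x ⨯₃ P) ⨯₃ Q = 0 := by
    rw [← h1, leibniz_cross x P Q, add_comm]
  have h3 : (x ⨯₃ P) ⨯₃ (x ⨯₃ Q) = P ⨯₃ Q := by
    simp only [dotProduct, Fin.sum_univ_three] at hx hP hQ
    ext i
    fin_cases i <;> simp [cross_apply] <;> grind
  simp only [map_add, map_smul, LinearMap.add_apply, LinearMap.smul_apply, h3, smul_add]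
  have h4 : (x ⨯₃ P) ⨯₃ Q = - (P ⨯₃ (x ⨯₃ Q)) := eq_neg_of_add_eq_zero_right h2
  rw [h4]
  module

lemma rotate_dotProduct_rotate (hx : x ⬝ᵥ x = 1) (hP : P ⬝ᵥ x = 0) (hQ : Q ⬝ᵥ x = 0)
    (m b s t : ℝ) : (m • P + b • (x ⨯₃ P) - s • x) ⬝ᵥ (m • Q + b • (x ⨯₃ Q) - t • x) =
      (m ^ 2 + b ^ 2) * (P ⬝ᵥ Q) + s * t := by
  have h1 : (x ⨯₃ P) ⬝ᵥ x = 0 := by rw [dotProduct_comm, dot_self_cross]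
  have h2 : (x ⨯₃ Q) ⬝ᵥ x = 0 := by rw [dotProduct_comm, dot_self_cross]
  have h3 : (x ⨯₃ P) ⬝ᵥ (x ⨯₃ Q) = P ⬝ᵥ Q := by
    rw [cross_dot_cross, hx, dotProduct_comm x Q, hQ]; ring
  have h4 : (x ⨯₃ P) ⬝ᵥ Q = - (P ⬝ᵥ (x ⨯₃ Q)) := by
    simp [dotProduct, Fin.sum_univ_three, cross_apply]
    ring
  simp only [add_dotProduct, sub_dotProduct, dotProduct_add, dotProduct_sub, smul_dotProduct,
    dotProduct_smul, smul_eq_mul, h1, h2, h3, h4, hP, hQ, hx, dotProduct_comm x, mul_zero]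
  ring

lemma cross_cross_self (hx : x ⬝ᵥ x = 1) (hP : P ⬝ᵥ x = 0) : x ⨯₃ (x ⨯₃ P) = -P := by
  rw [cross_cross_eq_smul_sub_smul', hx, dotProduct_comm, hP]
  simp

lemma model_congruence (hx : x ⬝ᵥ x = 1) (hP : P ⬝ᵥ x = 0) {m b s : ℝ} (hN : m ^ 2 + b ^ 2 ≠ 0) :
    -P = (-(m / (m ^ 2 + b ^ 2))) • ((m • P + b • (x ⨯₃ P) - s • x)
        - ((-x) ⬝ᵥ (m • P + b • (x ⨯₃ P) - s • x)) • (-x))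
      + (-(b / (m ^ 2 + b ^ 2))) • ((-x) ⨯₃ (m • P + b • (x ⨯₃ P) - s • x)) := by
  have h1 : (-x) ⬝ᵥ (m • P + b • (x ⨯₃ P) - s • x) = s := by
    simp [dotProduct_sub, dotProduct_add, hx, dotProduct_comm x P, hP]
  have h2 : (-x) ⨯₃ (m • P + b • (x ⨯₃ P) - s • x) = b • P - m • (x ⨯₃ P) := by
    simp [cross_cross_self hx hP]
    abel
  rw [h1, h2]
  generalize x ⨯₃ P = A
  ext i
  simp
  field_simp
  ring

lemma model_torsion (hx : x ⬝ᵥ x = 1) (hP : P ⬝ᵥ x = 0) (hQ : Q ⬝ᵥ x = 0)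
    {m b s t au av bu bv : ℝ} (hN : m ^ 2 + b ^ 2 ≠ 0)
    (hCR : au • Q - av • P + bu • (x ⨯₃ Q) - bv • (x ⨯₃ P) = 0) :
    ((s + au) • Q + (bu • (x ⨯₃ Q) + b • (P ⨯₃ Q)) - t • P)
      - ((t + av) • P + (bv • (x ⨯₃ P) + b • (Q ⨯₃ P)) - s • Q)
      + ((-(2 * m / (m ^ 2 + b ^ 2)) * s) • (m • Q + b • (x ⨯₃ Q) - t • x)
        + (-(b / (m ^ 2 + b ^ 2)) • (m • P + b • (x ⨯₃ P) - s • x))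
          ⨯₃ (m • Q + b • (x ⨯₃ Q) - t • x))
      - ((-(2 * m / (m ^ 2 + b ^ 2)) * t) • (m • P + b • (x ⨯₃ P) - s • x)
        + (-(b / (m ^ 2 + b ^ 2)) • (m • Q + b • (x ⨯₃ Q) - t • x))
          ⨯₃ (m • P + b • (x ⨯₃ P) - s • x)) = 0 := by
  set X := m • P + b • (x ⨯₃ P) with hX
  set Y := m • Q + b • (x ⨯₃ Q) with hY
  have h1 : X ⨯₃ Y = (m ^ 2 + b ^ 2) • (P ⨯₃ Q) := rotate_cross_rotate hx hP hQ m b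
  have h2 : x ⨯₃ X = m • (x ⨯₃ P) - b • P := by
    rw [hX, map_add, map_smul, map_smul, cross_cross_self hx hP]; module
  have h3 : x ⨯₃ Y = m • (x ⨯₃ Q) - b • Q := by
    rw [hY, map_add, map_smul, map_smul, cross_cross_self hx hQ]; module
  have h4 : Y ⨯₃ X = - ((m ^ 2 + b ^ 2) • (P ⨯₃ Q)) := by rw [← h1, cross_anticomm]
  have h5 : X ⨯₃ x = - (m • (x ⨯₃ P) - b • P) := by rw [← h2, cross_anticomm]
  have h6 : Y ⨯₃ x = - (m • (x ⨯₃ Q) - b • Q) := by rw [← h3, cross_anticomm]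
  have h7 : Q ⨯₃ P = - (P ⨯₃ Q) := (cross_anticomm P Q).symm
  simp only [map_sub, map_smul, LinearMap.sub_apply, LinearMap.smul_apply, h1, h2, h3, h4, h5, h6,
    h7, cross_self]
  rw [← sub_eq_zero.2 hCR, hX, hY]
  generalize x ⨯₃ P = A
  generalize x ⨯₃ Q = B
  generalize P ⨯₃ Q = C
  ext i
  simp
  field_simp
  ring

end ModelAlgebra

section OpenSubmanifold

variable {E : Type*} [NormedAddCommGroup E] [NormedSpace ℝ E]
  {H : Type*} [TopologicalSpace H] {I : ModelWithCorners ℝ E H}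
  {M : Type*} [TopologicalSpace M] [ChartedSpace H M]

lemma mfderiv_subtype_val_injective (V : TopologicalSpace.Opens M) (x : V) :
    Function.Injective (mfderiv I I (Subtype.val : V → M) x) := by
  classical
  set r : M → V := fun y => if hy : y ∈ V then ⟨y, hy⟩ else x with hr
  have h1 : r ∘ (Subtype.val : V → M) = id := by
    ext y
    simp [hr]
  have h2 : ContMDiffAt I I ∞ r x := by
    rw [← ContMDiffAt.subtypeVal_comp_iff]
    refine contMDiffAt_id.congr_of_eventuallyEq ?_
    filter_upwards [V.isOpen.mem_nhds x.2] with y hy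
    have : y ∈ V := hy
    simp [hr, this]
  have h3 := mfderiv_comp x (h2.mdifferentiableAt (by simp))
    ((contMDiff_subtype_val (n := 1) x).mdifferentiableAt one_ne_zero)
  rw [h1, mfderiv_id] at h3
  refine Function.LeftInverse.injective (g := mfderiv I I r x) fun u => ?_
  exact (congrArg (fun A : TangentSpace I x →L[ℝ] TangentSpace I x => A u) h3).symm

end OpenSubmanifold

namespace S2

open Matrix

/-- The map `(p, z) ↦ (p, z)` to `ℝ³ × ℝ`. -/
def prodCoords (y : S2 × ℝ) : (Fin 3 → ℝ) × ℝ := (coords y.1, y.2)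

lemma contMDiff_prodCoords : ContMDiff IS2R 𝓘(ℝ, (Fin 3 → ℝ) × ℝ) ∞ prodCoords :=
  (contMDiff_coords.comp contMDiff_fst).prodMk_space contMDiff_snd

lemma mvfderiv_comp_fst {G : Type*} [NormedAddCommGroup G] [NormedSpace ℝ G] {h : S2 → G}
    {y : S2 × ℝ} (hh : MDifferentiableAt (𝓡 2) 𝓘(ℝ, G) h y.1) (u : TangentSpace IS2R y) :
    mvfderiv IS2R (fun q : S2 × ℝ => h q.1) y u =
      mvfderiv (𝓡 2) h y.1 (u : EuclideanSpace ℝ (Fin 2) × ℝ).1 := by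
  have h1 := mvfderiv_comp_mfderiv (I' := IS2R) (f := Prod.fst) (x := y) hh
    mdifferentiableAt_fst u
  rw [mfderiv_fst] at h1
  exact h1

lemma dp_eq (y : S2 × ℝ) (u : TangentSpace IS2R y) :
    dp y u = toAmbient y.1 (u : EuclideanSpace ℝ (Fin 2) × ℝ).1 :=
  mvfderiv_comp_fst ((contMDiff_val y.1).mdifferentiableAt (by simp)) u

lemma dz_eq (y : S2 × ℝ) (u : TangentSpace IS2R y) :
    dz y u = (u : EuclideanSpace ℝ (Fin 2) × ℝ).2 := by
  have h := mfderiv_snd (I := 𝓡 2) (I' := 𝓘(ℝ, ℝ)) (x := y)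
  exact congrArg (fun A : (EuclideanSpace ℝ (Fin 2) × ℝ) →L[ℝ] ℝ => A u) h

lemma mvfderiv_prodCoords (y : S2 × ℝ) (u : TangentSpace IS2R y) :
    mvfderiv IS2R prodCoords y u = ((dp y u).ofLp, dz y u) := by
  have hd := (contMDiff_prodCoords y).mdifferentiableAt (n := ∞) (by simp)
  have h1 := mvfderiv_clm_comp (ContinuousLinearMap.fst ℝ (Fin 3 → ℝ) ℝ) hd u
  have h2 := mvfderiv_clm_comp (ContinuousLinearMap.snd ℝ (Fin 3 → ℝ) ℝ) hd u
  have h3 := mvfderiv_comp_fst (h := coords) (y := y)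
    ((contMDiff_coords y.1).mdifferentiableAt (by simp)) u
  exact Prod.ext (h1.symm.trans ((h3.trans (mvfderiv_coords _ _)).trans
    (congrArg WithLp.ofLp (dp_eq y u)).symm)) h2.symm

lemma eq_zero_of_dp_dz {y : S2 × ℝ} {u : TangentSpace IS2R y} (h1 : dp y u = 0) (h2 : dz y u = 0) :
    u = 0 := by
  rw [dp_eq] at h1
  rw [dz_eq] at h2
  refine Prod.ext (toAmbient_injective y.1 ?_) h2
  rw [h1]
  exact (map_zero (mvfderiv (𝓡 2) (fun q : S2 => (q : EuclideanSpace ℝ (Fin 3))) y.1)).symm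

end S2

section CauchyRiemann

open Matrix S2

/-- The Cauchy-Riemann equations on the sphere. -/
lemma HolomorphicOnS2.cauchyRiemann {h : S2 → ℂ} {U : Set S2} (hh : HolomorphicOnS2 h U) {p : S2}
    (hp : p ∈ U) (u v : TangentSpace (𝓡 2) p) :
    (mvfderiv (𝓡 2) h p u).re • (toAmbient p v).ofLp - (mvfderiv (𝓡 2) h p v).re • (toAmbient p u).ofLp
      + (mvfderiv (𝓡 2) h p u).im • (coords p ⨯₃ (toAmbient p v).ofLp)
      - (mvfderiv (𝓡 2) h p v).im • (coords p ⨯₃ (toAmbient p u).ofLp) = 0 := by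
  set L : TangentSpace (𝓡 2) p →L[ℝ] EuclideanSpace ℝ (Fin 3) :=
    mvfderiv (𝓡 2) (fun q : S2 => (q : EuclideanSpace ℝ (Fin 3))) p with hL
  have hLa : ∀ w, toAmbient p w = L w := fun w => rfl
  by_cases hu : (toAmbient p u).ofLp = 0
  · have hu0 : u = 0 := by
      apply toAmbient_injective p
      rw [hLa 0, map_zero]
      exact WithLp.ofLp_injective 2 hu
    rw [hu, hu0, map_zero]
    simp
  have hpp := coords_dotProduct_self p
  have hup := toAmbient_dotProduct p u
  obtain ⟨w, hw⟩ := exists_toAmbient_eq p (X := coords p ⨯₃ (toAmbient p u).ofLp)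
    (by rw [dotProduct_comm, dot_self_cross])
  obtain ⟨a, α, β, hab⟩ := exists_eq_smul_add_smul_add_smul_cross hpp hu hup (toAmbient p v).ofLp
  have ha : a = 0 := by
    have h1 := toAmbient_dotProduct p v
    rw [hab, add_dotProduct, add_dotProduct, smul_dotProduct, smul_dotProduct, smul_dotProduct,
      hpp, hup, dotProduct_comm _ (coords p), dot_self_cross] at h1
    simpa using h1
  rw [ha, zero_smul, zero_add] at hab
  have hv : v = α • u + β • w := by
    apply toAmbient_injective p
    apply WithLp.ofLp_injective 2
    rw [hab, hLa (_ + _), map_add, map_smul, map_smul, ← hLa, ← hLa, WithLp.ofLp_add,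
      WithLp.ofLp_smul, WithLp.ofLp_smul, hw]
  have hd := (hh p hp).2 u w hw
  have hdv : mvfderiv (𝓡 2) h p v = α * mvfderiv (𝓡 2) h p u
      + β * (Complex.I * mvfderiv (𝓡 2) h p u) := by
    rw [← hd, hv]; simp
  rw [hab, hdv]
  have h2 := cross_cross_self hpp hup
  rw [map_add, map_smul, map_smul, h2]
  simp
  module

end CauchyRiemann

section ModelSpace

open Matrix S2

/-- The coframe of the model space with conformal factor given by `z + h = η` at `x`. -/
noncomputable def modelCoframe (x : Fin 3 → ℝ) (η : ℂ) : (Fin 3 → ℝ) × ℝ →L[ℝ] (Fin 3 → ℝ) :=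
  (η.re • ContinuousLinearMap.id ℝ (Fin 3 → ℝ) + η.im • crossL x).comp
      (ContinuousLinearMap.fst ℝ (Fin 3 → ℝ) ℝ)
    - (ContinuousLinearMap.snd ℝ (Fin 3 → ℝ) ℝ).smulRight x

@[simp] lemma modelCoframe_apply (x : Fin 3 → ℝ) (η : ℂ) (c : (Fin 3 → ℝ) × ℝ) :
    modelCoframe x η c = η.re • c.1 + η.im • (x ⨯₃ c.1) - c.2 • x := by
  simp [modelCoframe]

section

variable {E : Type*} [NormedAddCommGroup E] [NormedSpace ℝ E]
  {H : Type*} [TopologicalSpace H] {I : ModelWithCorners ℝ E H}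
  {M : Type*} [TopologicalSpace M] [ChartedSpace H M] {x : M → Fin 3 → ℝ} {η : M → ℂ} {y : M}

lemma ContMDiffAt.modelCoframe (hx : ContMDiffAt I 𝓘(ℝ, Fin 3 → ℝ) ∞ x y)
    (hη : ContMDiffAt I 𝓘(ℝ, ℂ) ∞ η y) :
    ContMDiffAt I 𝓘(ℝ, (Fin 3 → ℝ) × ℝ →L[ℝ] (Fin 3 → ℝ)) ∞
      (fun y => _root_.modelCoframe (x y) (η y)) y := by
  have h1 : ContMDiffAt I 𝓘(ℝ, ℝ) ∞ (fun y => (η y).re) y :=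
    Complex.reCLM.contMDiff.contMDiffAt.comp y hη
  have h2 : ContMDiffAt I 𝓘(ℝ, ℝ) ∞ (fun y => (η y).im) y :=
    Complex.imCLM.contMDiff.contMDiffAt.comp y hη
  have h3 : ContMDiffAt I 𝓘(ℝ, (Fin 3 → ℝ) →L[ℝ] (Fin 3 → ℝ)) ∞ (fun y => crossL (x y)) y :=
    crossL.contMDiff.contMDiffAt.comp y hx
  have h4 : ContMDiffAt I 𝓘(ℝ, (Fin 3 → ℝ) × ℝ →L[ℝ] (Fin 3 → ℝ)) ∞
      (fun y => (ContinuousLinearMap.snd ℝ (Fin 3 → ℝ) ℝ).smulRight (x y)) y :=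
    (ContinuousLinearMap.smulRightL ℝ ((Fin 3 → ℝ) × ℝ) (Fin 3 → ℝ)
      (ContinuousLinearMap.snd ℝ (Fin 3 → ℝ) ℝ)).contMDiff.contMDiffAt.comp y hx
  exact ((((h1.smul contMDiffAt_const).add (h2.smul h3)).clm_comp contMDiffAt_const).sub h4)

lemma mvfderiv_modelCoframe (hx : ContMDiffAt I 𝓘(ℝ, Fin 3 → ℝ) ∞ x y)
    (hη : ContMDiffAt I 𝓘(ℝ, ℂ) ∞ η y) (u : TangentSpace I y) (c : (Fin 3 → ℝ) × ℝ) :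
    mvfderiv I (fun y => modelCoframe (x y) (η y)) y u c =
      (mvfderiv I η y u).re • c.1 + ((mvfderiv I η y u).im • (x y ⨯₃ c.1)
        + (η y).im • (mvfderiv I x y u ⨯₃ c.1)) - c.2 • mvfderiv I x y u := by
  have hx' := hx.mdifferentiableAt (by simp)
  have hη' := hη.mdifferentiableAt (by simp)
  rw [← mvfderiv_clm_apply_const ((ContMDiffAt.modelCoframe hx hη).mdifferentiableAt (by simp))]
  simp only [modelCoframe_apply]
  have h1 : MDifferentiableAt I 𝓘(ℝ, ℝ) (fun y => (η y).re) y :=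
    Complex.reCLM.mdifferentiableAt.comp y hη'
  have h2 : MDifferentiableAt I 𝓘(ℝ, ℝ) (fun y => (η y).im) y :=
    Complex.imCLM.mdifferentiableAt.comp y hη'
  have h3 : MDifferentiableAt I 𝓘(ℝ, Fin 3 → ℝ) (fun y => x y ⨯₃ c.1) y :=
    (crossL.flip c.1).mdifferentiableAt.comp y hx'
  have e1 := mvfderiv_clm_comp Complex.reCLM hη' u
  have e2 := mvfderiv_clm_comp Complex.imCLM hη' u
  have e3 := mvfderiv_clm_comp (crossL.flip c.1) hx' u
  simp only [Complex.reCLM_apply, Complex.imCLM_apply, ContinuousLinearMap.flip_apply,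
    crossL_apply] at e1 e2 e3
  have c1 : MDifferentiableAt I 𝓘(ℝ, Fin 3 → ℝ) (fun _ : M => c.1) y := mdifferentiableAt_const
  have c2 : MDifferentiableAt I 𝓘(ℝ, ℝ) (fun _ : M => c.2) y := mdifferentiableAt_const
  have d1 : MDifferentiableAt I 𝓘(ℝ, Fin 3 → ℝ) (fun y => (η y).re • c.1) y := h1.smul c1
  have d2 : MDifferentiableAt I 𝓘(ℝ, Fin 3 → ℝ) (fun y => (η y).im • (x y ⨯₃ c.1)) y := h2.smul h3
  have d3 : MDifferentiableAt I 𝓘(ℝ, Fin 3 → ℝ) (fun y => c.2 • x y) y := c2.smul hx'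
  have d12 : MDifferentiableAt I 𝓘(ℝ, Fin 3 → ℝ)
    (fun y => (η y).re • c.1 + (η y).im • (x y ⨯₃ c.1)) y := d1.add d2
  rw [mvfderiv_fun_sub d12 d3, mvfderiv_fun_add d1 d2, mvfderiv_fun_smul h1 c1,
    mvfderiv_fun_smul h2 h3,
    mvfderiv_fun_smul c2 hx', mvfderiv_const, mvfderiv_const]
  simp [e1, e2, e3]
  abel

end

lemma Complex.contDiff_normSq : ContDiff ℝ ∞ (fun w : ℂ => Complex.normSq w) := by
  simp only [Complex.normSq_apply]
  exact (Complex.reCLM.contDiff.mul Complex.reCLM.contDiff).add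
    (Complex.imCLM.contDiff.mul Complex.imCLM.contDiff)

variable {V : TopologicalSpace.Opens (S2 × ℝ)}

theorem HolomorphicOnS2.isWeylCoframe {h : S2 → ℂ} {U : Set S2} (hh : HolomorphicOnS2 h U)
    (hU : IsOpen U) (hV : ∀ y ∈ V, y.1 ∈ U ∧ (y.2 : ℂ) + h y.1 ≠ 0) :
    IsWeylCoframe IS2R (fun y : V => prodCoords y)
      (fun y : V => modelCoframe (coords y.1.1) (y.1.2 + h y.1.1))
      (fun y : V => (-(2 * ((y.1.2 : ℂ) + h y.1.1).re / Complex.normSq (y.1.2 + h y.1.1))) •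
        ContinuousLinearMap.snd ℝ (Fin 3 → ℝ) ℝ)
      (fun y : V => -(((y.1.2 : ℂ) + h y.1.1).im / Complex.normSq (y.1.2 + h y.1.1))) := by
  have hval : ∀ x : V, ContMDiffAt IS2R IS2R ∞ (Subtype.val : V → S2 × ℝ) x := fun x =>
    contMDiff_subtype_val x
  have hF : ContMDiff IS2R 𝓘(ℝ, (Fin 3 → ℝ) × ℝ) ∞ (fun y : V => prodCoords y) :=
    contMDiff_prodCoords.comp contMDiff_subtype_val
  have hx : ContMDiff IS2R 𝓘(ℝ, Fin 3 → ℝ) ∞ (fun y : V => coords y.1.1) :=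
    (contMDiff_coords.comp contMDiff_fst).comp contMDiff_subtype_val
  have hhx : ∀ x : V, ContMDiffAt (𝓡 2) 𝓘(ℝ, ℂ) ∞ h x.1.1 := fun x =>
    (hh.contMDiffOn hU).contMDiffAt (hU.mem_nhds (hV x x.2).1)
  have hη0 : ∀ x : V, ContMDiffAt IS2R 𝓘(ℝ, ℂ) ∞ (fun y : S2 × ℝ => (y.2 : ℂ) + h y.1) x :=
    fun x => (Complex.ofRealCLM.contMDiff.contMDiffAt.comp x.1 contMDiffAt_snd).add
      (ContMDiffAt.comp x.1 (hhx x) contMDiffAt_fst)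
  have hη : ∀ x : V, ContMDiffAt IS2R 𝓘(ℝ, ℂ) ∞ (fun y : V => (y.1.2 : ℂ) + h y.1.1) x :=
    fun x => ContMDiffAt.comp x (hη0 x) (hval x)
  have hdF : ∀ (x : V) (u : TangentSpace IS2R x), mvfderiv IS2R (fun y : V => prodCoords y) x u =
      ((dp x (mfderiv IS2R IS2R (Subtype.val : V → S2 × ℝ) x u)).ofLp,
        dz x (mfderiv IS2R IS2R (Subtype.val : V → S2 × ℝ) x u)) := by
    intro x u
    rw [← mvfderiv_prodCoords]
    exact mvfderiv_comp_mfderiv (I' := IS2R) (g := prodCoords) (f := (Subtype.val : V → S2 × ℝ))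
      ((contMDiff_prodCoords x.1).mdifferentiableAt (n := ∞) (by simp))
      ((hval x).mdifferentiableAt (by simp)) u
  have hdp : ∀ (x : V) (w : TangentSpace IS2R x.1), (dp x w).ofLp ⬝ᵥ coords x.1.1 = 0 := by
    intro x w
    rw [dp_eq]
    exact toAmbient_dotProduct _ _
  have hN : ∀ x : V, Complex.normSq (x.1.2 + h x.1.1) ≠ 0 := fun x => by
    simpa using (hV x x.2).2
  refine ⟨hF, fun x => ContMDiffAt.modelCoframe (hx x) (hη x), fun x => ?_, fun x => ?_,
    fun x => ?_, fun x u v => ?_⟩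
  · have h1 : ContDiffAt ℝ ∞ (fun w : ℂ => -(2 * w.re / Complex.normSq w)) (x.1.2 + h x.1.1) :=
      ((contDiffAt_const.mul Complex.reCLM.contDiff.contDiffAt).div
        Complex.contDiff_normSq.contDiffAt (hN x)).neg
    have h2 : ContMDiffAt IS2R 𝓘(ℝ, ℝ) ∞ (fun y : V =>
        -(2 * ((y.1.2 : ℂ) + h y.1.1).re / Complex.normSq (y.1.2 + h y.1.1))) x :=
      ContMDiffAt.comp (f := fun y : V => (y.1.2 : ℂ) + h y.1.1)
        (g := fun w : ℂ => -(2 * w.re / Complex.normSq w)) x h1.contMDiffAt (hη x)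
    exact h2.smul contMDiffAt_const
  · have h1 : ContDiffAt ℝ ∞ (fun w : ℂ => -(w.im / Complex.normSq w)) (x.1.2 + h x.1.1) :=
      (Complex.imCLM.contDiff.contDiffAt.div Complex.contDiff_normSq.contDiffAt (hN x)).neg
    exact ContMDiffAt.comp (f := fun y : V => (y.1.2 : ℂ) + h y.1.1)
      (g := fun w : ℂ => -(w.im / Complex.normSq w)) x h1.contMDiffAt (hη x)
  · set Φ : EuclideanSpace ℝ (Fin 2) × ℝ →ₗ[ℝ] (Fin 3 → ℝ) :=
      ((modelCoframe (coords x.1.1) (x.1.2 + h x.1.1)).comp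
        (mvfderiv IS2R (fun y : V => prodCoords y) x)).toLinearMap with hΦ
    have hinj : Function.Injective Φ := by
      rw [injective_iff_map_eq_zero]
      intro (u : TangentSpace IS2R x) hu
      have h1 : modelCoframe (coords x.1.1) (x.1.2 + h x.1.1)
        (mvfderiv IS2R (fun y : V => prodCoords y) x u) = 0 := hu
      rw [hdF, modelCoframe_apply] at h1
      have h2 := rotate_dotProduct_rotate (coords_dotProduct_self x.1.1)
        (hdp x (mfderiv IS2R IS2R (Subtype.val : V → S2 × ℝ) x u))
        (hdp x (mfderiv IS2R IS2R (Subtype.val : V → S2 × ℝ) x u))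
        ((x.1.2 : ℂ) + h x.1.1).re ((x.1.2 : ℂ) + h x.1.1).im
        (dz x (mfderiv IS2R IS2R (Subtype.val : V → S2 × ℝ) x u))
        (dz x (mfderiv IS2R IS2R (Subtype.val : V → S2 × ℝ) x u))
      rw [h1, zero_dotProduct, sq, sq, ← Complex.normSq_apply] at h2
      have h3 : 0 ≤ (dp x (mfderiv IS2R IS2R (Subtype.val : V → S2 × ℝ) x u)).ofLp ⬝ᵥ
          (dp x (mfderiv IS2R IS2R (Subtype.val : V → S2 × ℝ) x u)).ofLp := by
        simpa using dotProduct_star_self_nonneg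
          (dp x (mfderiv IS2R IS2R (Subtype.val : V → S2 × ℝ) x u)).ofLp
      have h4 := mul_nonneg (Complex.normSq_nonneg (x.1.2 + h x.1.1)) h3
      have h5 := mul_self_nonneg (dz x (mfderiv IS2R IS2R (Subtype.val : V → S2 × ℝ) x u))
      have h6 := mul_self_eq_zero.1 (le_antisymm (by linarith) h5)
      have h7 := (mul_eq_zero.1 (le_antisymm (by linarith) h4)).resolve_left (hN x)
      rw [dotProduct_self_eq_zero] at h7
      exact (injective_iff_map_eq_zero _).1 (mfderiv_subtype_val_injective (I := IS2R) V x) u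
        (eq_zero_of_dp_dz (WithLp.ofLp_injective 2 h7) h6)
    have hsurj := (LinearMap.injective_iff_surjective_of_finrank_eq_finrank (f := Φ)
      (by simp)).1 hinj
    exact ⟨hinj, hsurj⟩
  · have hcr := hh.cauchyRiemann (hV x x.2).1
      (mfderiv IS2R IS2R (Subtype.val : V → S2 × ℝ) x u : EuclideanSpace ℝ (Fin 2) × ℝ).1
      (mfderiv IS2R IS2R (Subtype.val : V → S2 × ℝ) x v : EuclideanSpace ℝ (Fin 2) × ℝ).1
    have hdx : ∀ u, mvfderiv IS2R (fun y : V => coords y.1.1) x u =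
        (dp x (mfderiv IS2R IS2R (Subtype.val : V → S2 × ℝ) x u)).ofLp := by
      intro u
      have h1 := mvfderiv_clm_comp (ContinuousLinearMap.fst ℝ (Fin 3 → ℝ) ℝ)
        ((hF x).mdifferentiableAt (by simp)) u
      rw [hdF] at h1
      exact h1
    have hdη : ∀ u, mvfderiv IS2R (fun y : V => (y.1.2 : ℂ) + h y.1.1) x u =
        dz x (mfderiv IS2R IS2R (Subtype.val : V → S2 × ℝ) x u) + mvfderiv (𝓡 2) h x.1.1
          (mfderiv IS2R IS2R (Subtype.val : V → S2 × ℝ) x u : EuclideanSpace ℝ (Fin 2) × ℝ).1 := by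
      intro u
      have h1 := mvfderiv_comp_mfderiv (I' := IS2R) (g := fun y : S2 × ℝ => (y.2 : ℂ) + h y.1)
        (f := (Subtype.val : V → S2 × ℝ)) ((hη0 x).mdifferentiableAt (by simp))
        ((hval x).mdifferentiableAt (by simp)) u
      have h2 := mvfderiv_clm_comp Complex.ofRealCLM (x := x.1)
        (mdifferentiableAt_snd (I := 𝓡 2) (I' := 𝓘(ℝ, ℝ)))
        (mfderiv IS2R IS2R (Subtype.val : V → S2 × ℝ) x u)
      have h3 := mvfderiv_comp_fst ((hhx x).mdifferentiableAt (by simp))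
        (mfderiv IS2R IS2R (Subtype.val : V → S2 × ℝ) x u)
      have h4 := congrArg (fun A => A (mfderiv IS2R IS2R (Subtype.val : V → S2 × ℝ) x u))
        (mvfderiv_fun_add (I := IS2R) (x := x.1) (g := fun y : S2 × ℝ => (y.2 : ℂ))
          (g' := fun y : S2 × ℝ => h y.1)
          ((Complex.ofRealCLM.contMDiff.contMDiffAt.comp x.1 contMDiffAt_snd).mdifferentiableAt
            (n := ∞) (by simp))
          ((ContMDiffAt.comp x.1 (hhx x) contMDiffAt_fst).mdifferentiableAt (by simp)))
      simp only [_root_.add_apply] at h4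
      refine h1.trans (h4.trans ?_)
      rw [h3]
      congr 1
    have h5 := model_torsion (coords_dotProduct_self x.1.1)
      (hdp x (mfderiv IS2R IS2R (Subtype.val : V → S2 × ℝ) x u))
      (hdp x (mfderiv IS2R IS2R (Subtype.val : V → S2 × ℝ) x v))
      (m := ((x.1.2 : ℂ) + h x.1.1).re) (b := ((x.1.2 : ℂ) + h x.1.1).im)
      (s := dz x (mfderiv IS2R IS2R (Subtype.val : V → S2 × ℝ) x u))
      (t := dz x (mfderiv IS2R IS2R (Subtype.val : V → S2 × ℝ) x v))
      (by rw [sq, sq, ← Complex.normSq_apply]; exact hN x)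
      (by rw [dp_eq, dp_eq]; exact hcr)
    rw [mvfderiv_modelCoframe (hx x) (hη x), mvfderiv_modelCoframe (hx x) (hη x)]
    simp only [weylForm_apply, modelCoframe_apply, hdF, hdx, hdη, _root_.smul_apply,
      ContinuousLinearMap.coe_snd', smul_eq_mul, Complex.add_re, Complex.add_im, Complex.ofReal_re,
      Complex.ofReal_im, zero_add, Complex.normSq_apply, ← sq] at h5 ⊢
    exact h5

theorem HolomorphicOnS2.exists_model {h : S2 → ℂ} {U : Set S2} (hh : HolomorphicOnS2 h U)
    (hU : IsOpen U) (hV : ∀ y ∈ V, y.1 ∈ U ∧ (y.2 : ℂ) + h y.1 ≠ 0) :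
    ∃ W : WeylSpace IS2R V,
        (∀ (x : V) (u v : TangentSpace IS2R x), W.g.inner x u v =
          modelMetric h x (mfderiv IS2R IS2R (Subtype.val : V → S2 × ℝ) x u)
            (mfderiv IS2R IS2R (Subtype.val : V → S2 × ℝ) x v)) ∧
        (∀ (x : V) (u : TangentSpace IS2R x), W.om x u =
          modelForm h x (mfderiv IS2R IS2R (Subtype.val : V → S2 × ℝ) x u)) ∧
        W.IsEinsteinWeyl ∧ W.IsToda ∧ W.IsHyperCR := by
  have hW := hh.isWeylCoframe hU hV
  have hdF : ∀ (x : V) (u : TangentSpace IS2R x), mvfderiv IS2R (fun y : V => prodCoords y) x u =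
      ((dp x (mfderiv IS2R IS2R (Subtype.val : V → S2 × ℝ) x u)).ofLp,
        dz x (mfderiv IS2R IS2R (Subtype.val : V → S2 × ℝ) x u)) := by
    intro x u
    rw [← mvfderiv_prodCoords]
    exact mvfderiv_comp_mfderiv (I' := IS2R) (g := prodCoords) (f := (Subtype.val : V → S2 × ℝ))
      ((contMDiff_prodCoords x.1).mdifferentiableAt (n := ∞) (by simp))
      ((contMDiff_subtype_val x).mdifferentiableAt (n := ∞) (by simp)) u
  have hdp : ∀ (x : V) (w : TangentSpace IS2R x.1), (dp x w).ofLp ⬝ᵥ coords x.1.1 = 0 := by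
    intro x w
    rw [dp_eq]
    exact toAmbient_dotProduct _ _
  have hE : ∀ (x : V) (u : TangentSpace IS2R x), hW.equiv x u = modelCoframe (coords x.1.1)
    (x.1.2 + h x.1.1) (mvfderiv IS2R (fun y : V => prodCoords y) x u) := fun x u => rfl
  refine ⟨hW.weylSpace, fun x u v => ?_, fun x u => ?_, hW.isEinsteinWeyl,
    ⟨_, _, _, _, hW.isShearFreeGeodesic (p := fun y => -coords y.1.1)
      (τ := fun y => -(((y.1.2 : ℂ) + h y.1.1).re / Complex.normSq (y.1.2 + h y.1.1)))
      (σ := fun y => -(((y.1.2 : ℂ) + h y.1.1).im / Complex.normSq (y.1.2 + h y.1.1)))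
      ?_ ?_ ?_, fun x => sub_self _⟩,
    ⟨_, _, _, _, hW.isShearFreeGeodesic (p := fun _ => Pi.single 0 1) (τ := fun _ => 0)
      (σ := fun _ => 0) contMDiff_const (by simp) ?_, fun x => rfl⟩⟩
  · change hW.equiv x u ⬝ᵥ hW.equiv x v = _
    rw [hE, hE, modelCoframe_apply, modelCoframe_apply, hdF, hdF,
      rotate_dotProduct_rotate (coords_dotProduct_self x.1.1) (hdp x _) (hdp x _), modelMetric,
      inner_eq_dotProduct, Complex.normSq_apply, sq, sq]
  · change (-(2 * ((x.1.2 : ℂ) + h x.1.1).re / Complex.normSq (x.1.2 + h x.1.1))) *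
      (mvfderiv IS2R (fun y : V => prodCoords y) x u).2 = _
    rw [hdF, modelForm]
    simp [mul_add]
  · exact ((contMDiff_coords.comp contMDiff_fst).comp contMDiff_subtype_val).neg
  · intro x
    simpa using coords_dotProduct_self x.1.1
  · intro x u
    have h1 := mvfderiv_clm_comp (ContinuousLinearMap.fst ℝ (Fin 3 → ℝ) ℝ)
      ((hW.contMDiff_map x).mdifferentiableAt (by simp)) u
    rw [hdF] at h1
    have h2 : mvfderiv IS2R (fun y : V => coords y.1.1) x u =
      (dp x (mfderiv IS2R IS2R (Subtype.val : V → S2 × ℝ) x u)).ofLp := h1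
    have h3 := model_congruence (coords_dotProduct_self x.1.1)
      (hdp x (mfderiv IS2R IS2R (Subtype.val : V → S2 × ℝ) x u))
      (m := ((x.1.2 : ℂ) + h x.1.1).re) (b := ((x.1.2 : ℂ) + h x.1.1).im)
      (s := dz x (mfderiv IS2R IS2R (Subtype.val : V → S2 × ℝ) x u))
      (by rw [sq, sq, ← Complex.normSq_apply]; simpa using (hV x x.2).2)
    rw [mvfderiv_fun_neg, _root_.neg_apply, h2, h3, hE, modelCoframe_apply, hdF]
    simp only [Complex.normSq_apply, ← sq]
  · intro x u
    simp [mvfderiv_const]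

end ModelSpace

section OrthonormalFrame

open Matrix

variable {E : Type*} [NormedAddCommGroup E] [NormedSpace ℝ E]
  {Ω : Set E} {z₀ : E} {G : E → E →L[ℝ] E →L[ℝ] ℝ}

/-- One step of the Gram-Schmidt process for a smooth family of scalar products. -/
lemma exists_orthonormal_extension (hΩ : IsOpen Ω) (hz : z₀ ∈ Ω) (hG : ContDiffOn ℝ ∞ G Ω)
    (pos : ∀ z ∈ Ω, ∀ v, v ≠ 0 → 0 < G z v v) {n : ℕ} {e : Fin n → E → E}
    (he : ∀ i, ContDiffOn ℝ ∞ (e i) Ω)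
    (orth : ∀ z ∈ Ω, ∀ i j, G z (e i z) (e j z) = if i = j then 1 else 0)
    (hn : n < Module.finrank ℝ E) :
    ∃ Ω' ⊆ Ω, IsOpen Ω' ∧ z₀ ∈ Ω' ∧ ∃ f : E → E, ContDiffOn ℝ ∞ f Ω' ∧
      ∀ z ∈ Ω', G z (f z) (f z) = 1 ∧ ∀ i, G z (e i z) (f z) = 0 := by
  obtain ⟨c, hc⟩ : ∃ c, c ∉ Submodule.span ℝ (Set.range fun i => e i z₀) := by
    by_contra! h
    have h1 : Submodule.span ℝ (Set.range fun i => e i z₀) = ⊤ := by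
      rw [eq_top_iff]; exact fun x _ => h x
    have h2 := finrank_range_le_card (R := ℝ) (fun i => e i z₀)
    rw [Set.finrank, h1, finrank_top, Fintype.card_fin] at h2
    omega
  set v : E → E := fun z => c - ∑ i, G z (e i z) c • e i z with hv
  have hvs : ContDiffOn ℝ ∞ v Ω := contDiffOn_const.sub
    (ContDiffOn.sum fun i _ => ((hG.clm_apply (he i)).clm_apply contDiffOn_const).smul (he i))
  have hvv : ContDiffOn ℝ ∞ (fun z => G z (v z) (v z)) Ω := (hG.clm_apply hvs).clm_apply hvs
  have hv0 : v z₀ ≠ 0 := by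
    intro h0
    apply hc
    rw [sub_eq_zero.1 h0]
    exact Submodule.sum_mem _ fun i _ => Submodule.smul_mem _ _ (Submodule.subset_span ⟨i, rfl⟩)
  have hev : ∀ z ∈ Ω, ∀ i, G z (e i z) (v z) = 0 := by
    intro z hz i
    rw [hv]
    simp only [map_sub, map_sum, map_smul, orth z hz, smul_eq_mul, mul_ite, mul_one, mul_zero]
    rw [Finset.sum_ite_eq]
    simp
  refine ⟨Ω ∩ (fun z => G z (v z) (v z)) ⁻¹' Set.Ioi 0, Set.inter_subset_left,
    hvv.continuousOn.isOpen_inter_preimage hΩ isOpen_Ioi, ⟨hz, pos z₀ hz _ hv0⟩,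
    fun z => (√(G z (v z) (v z)))⁻¹ • v z, ?_, ?_⟩
  · refine ContDiffOn.smul (ContDiffOn.inv ?_ ?_) (hvs.mono Set.inter_subset_left)
    · exact (hvv.mono Set.inter_subset_left).sqrt fun z hz => ne_of_gt hz.2
    · exact fun z hz => ne_of_gt (Real.sqrt_pos.2 hz.2)
  · rintro z ⟨hz, hz'⟩
    have h1 : (0 : ℝ) < G z (v z) (v z) := hz'
    refine ⟨?_, fun i => by simp [hev z hz i]⟩
    simp only [map_smul, _root_.smul_apply, smul_eq_mul]
    rw [← mul_assoc, ← mul_inv, Real.mul_self_sqrt h1.le, inv_mul_cancel₀ h1.ne']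

/-- A smooth family of scalar products on a three-dimensional space has, locally, a smooth
orthonormal frame that begins with a given unit vector field. -/
lemma exists_orthonormal_frame (hΩ : IsOpen Ω) (hz : z₀ ∈ Ω) (hG : ContDiffOn ℝ ∞ G Ω)
    (symm : ∀ z ∈ Ω, ∀ u v, G z u v = G z v u)
    (pos : ∀ z ∈ Ω, ∀ v, v ≠ 0 → 0 < G z v v) {ξ : E → E}
    (hξ : ContDiffOn ℝ ∞ ξ Ω) (unit : ∀ z ∈ Ω, G z (ξ z) (ξ z) = 1)
    (hE : Module.finrank ℝ E = 3) :
    ∃ Ω' ⊆ Ω, IsOpen Ω' ∧ z₀ ∈ Ω' ∧ ∃ e : Fin 3 → E → E, (∀ i, ContDiffOn ℝ ∞ (e i) Ω') ∧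
      e 0 = ξ ∧ ∀ z ∈ Ω', ∀ i j, G z (e i z) (e j z) = if i = j then 1 else 0 := by
  obtain ⟨Ω₁, h1, ho1, hz1, f, hf, hf'⟩ := exists_orthonormal_extension hΩ hz hG pos (e := ![ξ])
    (by simpa using hξ) (fun z hz i j => by simpa [Subsingleton.elim i j] using unit z hz) (by omega)
  obtain ⟨Ω₂, h2, ho2, hz2, k, hk, hk'⟩ := exists_orthonormal_extension ho1 hz1 (hG.mono h1)
    (fun z hz => pos z (h1 hz)) (e := ![ξ, f])
    (by
      intro i
      fin_cases i
      · exact hξ.mono h1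
      · exact hf)
    (by
      intro z hz i j
      have h3 := (hf' z hz).2 0
      have h4 := symm z (h1 hz) (ξ z) (f z)
      simp only [Matrix.cons_val_zero] at h3
      rw [h3] at h4
      fin_cases i <;> fin_cases j <;> simp [unit z (h1 hz), (hf' z hz).1, h3, ← h4])
    (by omega)
  refine ⟨Ω₂, h2.trans h1, ho2, hz2, ![ξ, f, k], ?_, rfl, ?_⟩
  · intro i
    fin_cases i
    · exact hξ.mono (h2.trans h1)
    · exact hf.mono h2
    · exact hk
  · intro z hz i j
    have hz1 := h2 hz
    have h3 := (hf' z hz1).2 0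
    have h4 := symm z (h1 hz1) (ξ z) (f z)
    have h5 := (hk' z hz).2 0
    have h6 := (hk' z hz).2 1
    have h7 := symm z (h1 hz1) (ξ z) (k z)
    have h8 := symm z (h1 hz1) (f z) (k z)
    simp only [Matrix.cons_val_zero, Matrix.cons_val_one] at h3 h5 h6
    rw [h3] at h4
    rw [h5] at h7
    rw [h6] at h8
    fin_cases i <;> fin_cases j <;>
      simp [unit z (h1 hz1), (hf' z hz1).1, (hk' z hz).1, h3, h5, h6, ← h4, ← h7, ← h8]

/-- The coframe of an orthonormal frame. -/
lemma bijective_of_orthonormal [FiniteDimensional ℝ E] {e : Fin 3 → E} {B : E →L[ℝ] E →L[ℝ] ℝ} {L : E →L[ℝ] (Fin 3 → ℝ)}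
    (hE : Module.finrank ℝ E = 3) (hL : ∀ c i, L c i = B (e i) c)
    (orth : ∀ i j, B (e i) (e j) = if i = j then 1 else 0) :
    Function.Bijective L ∧ ∀ c, c = ∑ i, L c i • e i := by
  have h1 : ∀ y : Fin 3 → ℝ, L (∑ i, y i • e i) = y := by
    intro y
    ext i
    rw [hL]
    simp [map_sum, map_smul, orth]
  have hs : Function.Surjective L := fun y => ⟨_, h1 y⟩
  have hi : Function.Injective (L : E →ₗ[ℝ] (Fin 3 → ℝ)) :=
    (LinearMap.injective_iff_surjective_of_finrank_eq_finrank (by simp [hE])).2 hs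
  exact ⟨⟨hi, hs⟩, fun c => hi (h1 (L c)).symm⟩

end OrthonormalFrame

section Adapted

open Matrix

variable {E : Type*} [NormedAddCommGroup E] [NormedSpace ℝ E] [FiniteDimensional ℝ E]
  {H : Type*} [TopologicalSpace H] {I : ModelWithCorners ℝ E H}
  {M : Type*} [TopologicalSpace M] [ChartedSpace H M] [IsManifold I ∞ M]
  {E' : Type*} [NormedAddCommGroup E'] [NormedSpace ℝ E']

namespace WeylSpace

variable {W : WeylSpace I M}

/-- The star operator of `ξ` in an orthonormal frame that begins with `ξ`. -/
lemma IsStar.exists_sign {x : M} {e : Fin 3 → TangentSpace I x}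
    {J : TangentSpace I x →ₗ[ℝ] TangentSpace I x} (h : W.IsStar x (e 0) J)
    (Φ : TangentSpace I x → Fin 3 → ℝ) (hΦ : ∀ i u, Φ u i = W.g.inner x (e i) u)
    (hg : ∀ u v, W.g.inner x u v = Φ u ⬝ᵥ Φ v) :
    ∃ ε : ℝ, ∀ u, W.g.inner x (J u) (e 1) = -(ε * Φ u 2) ∧ W.g.inner x (J u) (e 2) = ε * Φ u 1 := by
  have symm := W.g.symm x
  have hself : ∀ u, W.g.inner x (J u) u = 0 := by
    intro u
    have h1 := h.skew u u
    rw [symm u] at h1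
    linarith
  have hzero : ∀ u, W.g.inner x (J u) (e 0) = 0 := by
    intro u
    rw [h.skew, h.ker, map_zero, neg_zero]
  refine ⟨W.g.inner x (J (e 1)) (e 2), fun u => ⟨?_, ?_⟩⟩
  · rw [h.skew, hg]
    have h1 := hzero (e 1)
    have h2 := hself (e 1)
    simp only [dotProduct, Fin.sum_univ_three, hΦ, symm _ (J (e 1)), h1, h2]
    ring
  · rw [h.skew, hg]
    have h1 := hzero (e 2)
    have h2 := hself (e 2)
    have h3 := h.skew (e 1) (e 2)
    rw [symm (e 1)] at h3
    simp only [dotProduct, Fin.sum_univ_three, hΦ, symm _ (J (e 2)), h1, h2, h3]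
    ring

/-- The connection form in an orthonormal frame that begins with a hyperCR congruence. -/
theorem IsShearFreeGeodesic.exists_connection {ξ : (x : M) → TangentSpace I x} {τ κ : M → ℝ}
    {J : (x : M) → TangentSpace I x →ₗ[ℝ] TangentSpace I x} (h : W.IsShearFreeGeodesic ξ τ κ J)
    (hτ : ∀ x, τ x = 0) {F : M → E'} {T : M → E' →L[ℝ] (Fin 3 → ℝ)} {x : M}
    {e : Fin 3 → (y : M) → TangentSpace I y} (h0 : e 0 = ξ)
    (he : ∀ i, MDifferentiableAt I I.tangent (fun y => (⟨y, e i y⟩ : TangentBundle I M)) x)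
    (hΦ : ∀ᶠ y in 𝓝 x, ∀ i u, T y (mvfderiv I F y u) i = W.g.inner y (e i y) u)
    (hg : ∀ u v, W.g.inner x u v = T x (mvfderiv I F x u) ⬝ᵥ T x (mvfderiv I F x v))
    (orth : ∀ᶠ y in 𝓝 x, ∀ i j, W.g.inner y (e i y) (e j y) = if i = j then 1 else 0)
    (hT : ∀ Y : (y : M) → TangentSpace I y, MDifferentiableAt I I.tangent
      (fun y => (⟨y, Y y⟩ : TangentBundle I M)) x →
      MDifferentiableAt I 𝓘(ℝ, Fin 3 → ℝ) (fun y => T y (mvfderiv I F y (Y y))) x) :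
    ∃ (k : ℝ) (β : TangentSpace I x →L[ℝ] ℝ), ∀ Y : (y : M) → TangentSpace I y,
      MDifferentiableAt I I.tangent (fun y => (⟨y, Y y⟩ : TangentBundle I M)) x →
      ∀ u, T x (mvfderiv I F x (W.D Y x u)) = mvfderiv I (fun y => T y (mvfderiv I F y (Y y))) x u
        + W.om x u • T x (mvfderiv I F x (Y x))
        + (k • T x (mvfderiv I F x u) + β u • Pi.single 0 1) ⨯₃ T x (mvfderiv I F x (Y x)) := by
  have hΦx := hΦ.self_of_nhds
  have orthx := orth.self_of_nhds
  have symm := W.g.symm x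
  obtain ⟨ε, hε⟩ := IsStar.exists_sign (e := fun i => e i x) (by rw [h0]; exact h.star x)
    (fun u => T x (mvfderiv I F x u)) hΦx hg
  have hC : ∀ i j u, W.g.inner x (W.D (e i) x u) (e j x) + W.g.inner x (W.D (e j) x u) (e i x)
      = 2 * W.om x u * if i = j then 1 else 0 := by
    intro i j u
    have h1 := W.conformal (e i) (e j) x u (he i) (he j)
    have h2 : (fun y => W.g.inner y (e i y) (e j y)) =ᶠ[𝓝 x]
        fun _ => (if i = j then 1 else 0 : ℝ) := by
      filter_upwards [orth] with y hy
      exact hy i j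
    rw [h2.mvfderiv_eq, mvfderiv_const, orthx, symm (e i x)] at h1
    simp only [_root_.zero_apply] at h1
    linarith
  have hξ : ∀ u j, j ≠ 0 → W.g.inner x (W.D (e 0) x u) (e j x) =
      κ x * W.g.inner x (J x u) (e j x) := by
    intro u j hj
    have h1 := congrArg (fun v => W.g.inner x v (e j x)) (h.eqn x u)
    subst h0
    have h2 := orthx 0 j
    rw [if_neg hj.symm] at h2
    simpa only [weightlessD, hτ, zero_smul, zero_add, map_sub, map_smul, _root_.sub_apply,
      _root_.smul_apply, smul_eq_mul, h2, mul_zero, sub_zero] using h1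
  refine ⟨-(ε * κ x), (W.g.inner x (e 2 x)).comp (W.D (e 1) x) +
    (ε * κ x) • (W.g.inner x (e 0 x)), fun Y hY u => ?_⟩
  have hcomp : ∀ i, T x (mvfderiv I F x (W.D Y x u)) i =
      mvfderiv I (fun y => T y (mvfderiv I F y (Y y))) x u i
        + 2 * W.om x u * T x (mvfderiv I F x (Y x)) i
        - ∑ j, W.g.inner x (W.D (e i) x u) (e j x) * T x (mvfderiv I F x (Y x)) j := by
    intro i
    have h1 := W.conformal (e i) Y x u (he i) hY
    have h2 : (fun y => W.g.inner y (e i y) (Y y)) =ᶠ[𝓝 x]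
        fun y => ContinuousLinearMap.proj (R := ℝ) (φ := fun _ : Fin 3 => ℝ) i
          (T y (mvfderiv I F y (Y y))) := by
      filter_upwards [hΦ] with y hy
      exact (hy i (Y y)).symm
    rw [h2.mvfderiv_eq, mvfderiv_clm_comp _ (hT Y hY), hg (W.D (e i) x u)] at h1
    simp only [dotProduct, hΦx, ContinuousLinearMap.proj_apply] at h1 ⊢
    simp only [symm _ (e _ x)] 
    linarith
  have c00 := hC 0 0 u
  have c11 := hC 1 1 u
  have c22 := hC 2 2 u
  have c01 := hC 0 1 u
  have c02 := hC 0 2 u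
  have c12 := hC 1 2 u
  have x1 := hξ u 1 (by decide)
  have x2 := hξ u 2 (by decide)
  rw [(hε u).1] at x1
  rw [(hε u).2] at x2
  have hβ : W.g.inner x (e 0 x) u = T x (mvfderiv I F x u) 0 := (hΦx 0 u).symm
  have hs := symm (e 2 x) (W.D (e 1) x u)
  simp only [if_true, mul_one, Fin.isValue, zero_ne_one, if_false, mul_zero] at c00 c11 c22 c01 c02 c12
  ext i
  rw [hcomp]
  simp only [Fin.sum_univ_three, _root_.add_apply, _root_.smul_apply, ContinuousLinearMap.comp_apply,
    hβ, hs, smul_eq_mul]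
  generalize T x (mvfderiv I F x u) = X at *
  generalize T x (mvfderiv I F x (Y x)) = Z at *
  generalize mvfderiv I (fun y => T y (mvfderiv I F y (Y y))) x u = dZ at *
  fin_cases i <;> simp [cross_apply] <;> grind

end WeylSpace

end Adapted

section ChartMetric

open Matrix

variable {E : Type*} [NormedAddCommGroup E] [NormedSpace ℝ E]
  {H : Type*} [TopologicalSpace H] {I : ModelWithCorners ℝ E H}
  {M : Type*} [TopologicalSpace M] [ChartedSpace H M] [IsManifold I ∞ M]

variable (I) in
/-- The vector field with constant components `c` in the chart at `b`. -/
noncomputable def coordField (b : M) (c : E) (y : M) :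
    TangentSpace I y :=
  (trivializationAt E (TangentSpace I : M → Type _) b).symmL ℝ y c

lemma mvfderiv_coordField {b y : M} (hy : y ∈ (chartAt H b).source) (c : E) :
    mvfderiv I (extChartAt I b) y (coordField I b c y) = c := by
  rw [coordField, Bundle.Trivialization.symmL_apply]
  · exact mvfderiv_extChartAt_symm_trivializationAt hy c
  · simpa using hy

lemma coordField_mvfderiv [I.Boundaryless] {b y : M} (hy : y ∈ (chartAt H b).source) (u : TangentSpace I y) :
    coordField I b (mvfderiv I (extChartAt I b) y u) y = u :=
  (mvfderiv_extChartAt_bijective hy).1 (mvfderiv_coordField hy _)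

lemma contMDiffAt_coordField {b y : M} (hy : y ∈ (chartAt H b).source) (c : E) :
    ContMDiffAt I I.tangent ∞ (fun y => (⟨y, coordField I b c y⟩ : TangentBundle I M)) y := by
  rw [contMDiffAt_section_iff_mvfderiv hy]
  refine (contMDiffAt_const (c := c)).congr_of_eventuallyEq ?_
  filter_upwards [(chartAt H b).open_source.mem_nhds hy] with z hz
  exact mvfderiv_coordField hz c

lemma ContMDiffOn.comp_extChartAt_symm' {F : Type*} [NormedAddCommGroup F] [NormedSpace ℝ F]
    {f : M → F} {b : M} (hf : ∀ y ∈ (chartAt H b).source, ContMDiffAt I 𝓘(ℝ, F) ∞ f y) :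
    ContDiffOn ℝ ∞ (fun z => f ((extChartAt I b).symm z)) (extChartAt I b).target := by
  rw [← contMDiffOn_iff_contDiffOn]
  intro z hz
  refine ContMDiffAt.comp_contMDiffWithinAt z (hf _ ?_) (contMDiffOn_extChartAt_symm b z hz)
  rw [← extChartAt_source I]
  exact (extChartAt I b).map_target hz

namespace WeylSpace

variable [FiniteDimensional ℝ E] (W : WeylSpace I M)

/-- The metric in the chart at `b`. -/
noncomputable def chartMetric (b : M) (z : E) : E →L[ℝ] E →L[ℝ] ℝ :=
  let y := (extChartAt I b).symm z
  let B : E →L[ℝ] E →L[ℝ] ℝ := W.g.inner y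
  let A : E →L[ℝ] E := (trivializationAt E (TangentSpace I : M → Type _) b).symmL ℝ y
  B.bilinearComp A A

lemma chartMetric_apply (b : M) (z c d : E) : W.chartMetric b z c d =
    W.g.inner ((extChartAt I b).symm z) (coordField I b c _) (coordField I b d _) := rfl

/-- The one-form in the chart at `b`. -/
noncomputable def chartForm (b : M) (z : E) : E →L[ℝ] ℝ :=
  (W.om ((extChartAt I b).symm z)).comp
    ((trivializationAt E (TangentSpace I : M → Type _) b).symmL ℝ ((extChartAt I b).symm z))

lemma chartForm_apply (b : M) (z c : E) : W.chartForm b z c =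
    W.om ((extChartAt I b).symm z) (coordField I b c _) := rfl

lemma contMDiffAt_inner {y : M} {U V : (y : M) → TangentSpace I y}
    (hU : ContMDiffAt I I.tangent ∞ (fun y => (⟨y, U y⟩ : TangentBundle I M)) y)
    (hV : ContMDiffAt I I.tangent ∞ (fun y => (⟨y, V y⟩ : TangentBundle I M)) y) :
    ContMDiffAt I 𝓘(ℝ, ℝ) ∞ (fun y => W.g.inner y (U y) (V y)) y := by
  have h := ContMDiffAt.clm_bundle_apply₂ (E₃ := Bundle.Trivial M ℝ) (F₁ := E) (F₂ := E) (F₃ := ℝ)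
    (b := id) (W.g.contMDiff y) hU hV
  simp only [contMDiffAt_totalSpace] at h
  exact h.2

lemma contMDiffAt_om {y : M} {U : (y : M) → TangentSpace I y}
    (hU : ContMDiffAt I I.tangent ∞ (fun y => (⟨y, U y⟩ : TangentBundle I M)) y) :
    ContMDiffAt I 𝓘(ℝ, ℝ) ∞ (fun y => W.om y (U y)) y := by
  have h := ContMDiffAt.clm_bundle_apply (E₂ := Bundle.Trivial M ℝ) (F₁ := E) (F₂ := ℝ)
    (b := id) (W.smooth_om y) hU
  simp only [contMDiffAt_totalSpace] at h
  exact h.2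

lemma contDiffOn_chartMetric (b : M) :
    ContDiffOn ℝ ∞ (W.chartMetric b) (extChartAt I b).target := by
  rw [contDiffOn_clm_apply]
  intro c
  rw [contDiffOn_clm_apply]
  intro d
  exact ContMDiffOn.comp_extChartAt_symm' (f := fun y => W.g.inner y (coordField I b c y)
    (coordField I b d y)) fun y hy =>
      W.contMDiffAt_inner (contMDiffAt_coordField hy c) (contMDiffAt_coordField hy d)

lemma contDiffOn_chartForm (b : M) :
    ContDiffOn ℝ ∞ (W.chartForm b) (extChartAt I b).target := by
  rw [contDiffOn_clm_apply]
  intro c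
  exact ContMDiffOn.comp_extChartAt_symm' (f := fun y => W.om y (coordField I b c y)) fun y hy =>
      W.contMDiffAt_om (contMDiffAt_coordField hy c)

lemma chartMetric_mvfderiv [I.Boundaryless] {b x : M} (hx : x ∈ (chartAt H b).source)
    (u v : TangentSpace I x) : W.chartMetric b (extChartAt I b x) (mvfderiv I (extChartAt I b) x u)
      (mvfderiv I (extChartAt I b) x v) = W.g.inner x u v := by
  have hx' : x ∈ (extChartAt I b).source := by rwa [extChartAt_source]
  rw [chartMetric_apply, (extChartAt I b).left_inv hx', coordField_mvfderiv hx,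
    coordField_mvfderiv hx]

lemma chartForm_mvfderiv [I.Boundaryless] {b x : M} (hx : x ∈ (chartAt H b).source)
    (u : TangentSpace I x) : W.chartForm b (extChartAt I b x) (mvfderiv I (extChartAt I b) x u)
      = W.om x u := by
  have hx' : x ∈ (extChartAt I b).source := by rwa [extChartAt_source]
  rw [chartForm_apply, (extChartAt I b).left_inv hx', coordField_mvfderiv hx]

end WeylSpace

end ChartMetric

section LocalCoframe

open Matrix

variable {E : Type*} [NormedAddCommGroup E] [NormedSpace ℝ E] [FiniteDimensional ℝ E]
  {H : Type*} [TopologicalSpace H] {I : ModelWithCorners ℝ E H}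
  {M : Type*} [TopologicalSpace M] [ChartedSpace H M] [IsManifold I ∞ M] [I.Boundaryless]

namespace WeylSpace

variable {W : WeylSpace I M}

/-- Near each point there is an orthonormal coframe in which the connection form is
`ω id + (κ θ + α e₀) ×`. -/
theorem IsShearFreeGeodesic.exists_local_coframe {ξ : (x : M) → TangentSpace I x} {τ κ : M → ℝ}
    {J : (x : M) → TangentSpace I x →ₗ[ℝ] TangentSpace I x} (h : W.IsShearFreeGeodesic ξ τ κ J)
    (hτ : ∀ x, τ x = 0) (hE : Module.finrank ℝ E = 3) (b : M) :
    ∃ (Ω : Set E) (T : E → E →L[ℝ] (Fin 3 → ℝ)), IsOpen Ω ∧ Ω ⊆ (extChartAt I b).target ∧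
      extChartAt I b b ∈ Ω ∧ ContDiffOn ℝ ∞ T Ω ∧ (∀ z ∈ Ω, Function.Bijective (T z)) ∧
      (∀ z ∈ Ω, ∀ c d, W.chartMetric b z c d = T z c ⬝ᵥ T z d) ∧
      ∀ x ∈ (chartAt H b).source, extChartAt I b x ∈ Ω → ∃ (k : ℝ) (α : E →L[ℝ] ℝ),
        W.HasConnectionFormAt (extChartAt I b) (fun y => T (extChartAt I b y))
          (fun _ => weylForm (W.chartForm b (extChartAt I b x)) (k • T (extChartAt I b x) +
            (ContinuousLinearMap.toSpanSingleton ℝ (Pi.single 0 1)).comp α)) x := by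
  set φ := extChartAt I b with hφ
  have hto : IsOpen φ.target := isOpen_extChartAt_target b
  have hbt : φ b ∈ φ.target := mem_extChartAt_target b
  have hsource : φ.source = (chartAt H b).source := extChartAt_source I b
  have hG := W.contDiffOn_chartMetric b
  have hmem : ∀ z ∈ φ.target, φ.symm z ∈ (chartAt H b).source := fun z hz => by
    rw [← hsource]; exact φ.map_target hz
  have hGg : ∀ z ∈ φ.target, ∀ c d, W.chartMetric b z c d =
      W.g.inner (φ.symm z) (coordField I b c _) (coordField I b d _) := fun z _ c d => rfl
  set ξ' : E → E := fun z => mvfderiv I φ (φ.symm z) (ξ (φ.symm z)) with hξ'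
  have hξs : ContDiffOn ℝ ∞ ξ' φ.target :=
    ContMDiffOn.comp_extChartAt_symm' (f := fun y => mvfderiv I φ y (ξ y)) fun y hy =>
      (contMDiffAt_section_iff_mvfderiv hy ξ).1 (h.congruence.smooth y)
  have hGm : ∀ x ∈ (chartAt H b).source, ∀ u v : TangentSpace I x,
      W.chartMetric b (φ x) (mvfderiv I φ x u) (mvfderiv I φ x v) = W.g.inner x u v :=
    fun x hx u v => W.chartMetric_mvfderiv hx u v
  have hφs : ∀ z ∈ φ.target, φ (φ.symm z) = z := fun z hz => φ.right_inv hz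
  obtain ⟨Ω, hΩ, ho, hb, e, hes, he0, orth⟩ := exists_orthonormal_frame hto hbt hG
    (fun z hz u v => by rw [hGg z hz, hGg z hz, W.g.symm])
    (fun z hz v hv => by
      rw [hGg z hz]
      refine W.g.pos _ _ fun h0 => hv ?_
      rw [← mvfderiv_coordField (I := I) (hmem z hz) v, h0, map_zero])
    hξs (fun z hz => by
      have h1 := hGm (φ.symm z) (hmem z hz) (ξ _) (ξ _)
      rw [hφs z hz] at h1
      rw [h1]
      exact h.congruence.unit _) hE
  set T : E → E →L[ℝ] (Fin 3 → ℝ) := fun z =>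
    ContinuousLinearMap.pi fun i => W.chartMetric b z (e i z) with hT
  have hTs : ContDiffOn ℝ ∞ T Ω := by
    rw [contDiffOn_clm_apply]
    intro c
    rw [contDiffOn_pi]
    intro i
    exact ((hG.mono hΩ).clm_apply (hes i)).clm_apply contDiffOn_const
  have hbij := fun z hz => bijective_of_orthonormal (L := T z) hE (fun c i => rfl) (orth z hz)
  have hTG : ∀ z ∈ Ω, ∀ c d, W.chartMetric b z c d = T z c ⬝ᵥ T z d := by
    intro z hz c d
    conv_lhs => rw [(hbij z hz).2 c]
    simp only [map_sum, map_smul, _root_.sum_apply, _root_.smul_apply, smul_eq_mul]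
    rfl
  refine ⟨Ω, T, ho, hΩ, hb, hTs, fun z hz => (hbij z hz).1, hTG, fun x hx hxΩ => ?_⟩
  have hev : ∀ᶠ y in 𝓝 x, y ∈ (chartAt H b).source ∧ φ y ∈ Ω :=
    Filter.Eventually.and ((chartAt H b).open_source.mem_nhds hx)
      ((contMDiffAt_extChartAt' (n := ∞) hx).continuousAt.eventually_mem (ho.mem_nhds hxΩ))
  set X : Fin 3 → (y : M) → TangentSpace I y := fun i y =>
    if i = 0 then ξ y else coordField I b (e i (φ y)) y with hX
  have hXe : ∀ i, ∀ y ∈ (chartAt H b).source, φ y ∈ Ω → mvfderiv I φ y (X i y) = e i (φ y) := by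
    intro i y hy hyΩ
    by_cases hi : i = 0
    · subst hi
      rw [he0, hξ']
      simp only [hX, if_true]
      rw [φ.left_inv (by rwa [hsource])]
    · simp only [hX, if_neg hi]
      exact mvfderiv_coordField hy _
  have hdφ : MDifferentiableAt I 𝓘(ℝ, E) φ x :=
    (contMDiffAt_extChartAt' (n := ∞) hx).mdifferentiableAt (by simp)
  have hsm : ContMDiffAt I 𝓘(ℝ, E →L[ℝ] (Fin 3 → ℝ)) ∞ (fun y => T (φ y)) x :=
    ContMDiffAt.comp x (hTs.contDiffAt (ho.mem_nhds hxΩ)).contMDiffAt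
      (contMDiffAt_extChartAt' (n := ∞) hx)
  obtain ⟨k, β, hkβ⟩ := h.exists_connection hτ (F := φ) (T := fun y => T (φ y)) (x := x) (e := X)
    (by ext y; simp [hX])
    (fun i => by
      rw [mdifferentiableAt_section_iff_mvfderiv hx]
      have h1 : MDifferentiableAt I 𝓘(ℝ, E) (fun y => e i (φ y)) x :=
        (((hes i).contDiffAt (ho.mem_nhds hxΩ)).contMDiffAt.mdifferentiableAt (by simp)).comp x hdφ
      refine h1.congr_of_eventuallyEq ?_
      filter_upwards [hev] with y hy
      exact hXe i y hy.1 hy.2)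
    (by
      filter_upwards [hev] with y hy i u
      rw [← hGm y hy.1, hXe i y hy.1 hy.2]
      rfl)
    (fun u v => by rw [← hGm x hx, hTG _ hxΩ])
    (by
      filter_upwards [hev] with y hy i j
      rw [← hGm y hy.1, hXe i y hy.1 hy.2, hXe j y hy.1 hy.2, orth _ hy.2])
    (fun Y hY => (hsm.mdifferentiableAt (by simp)).clm_apply
      (MDifferentiableAt.mvfderiv_vectorField (contMDiffAt_extChartAt' (n := ∞) hx) hY))
  set β' : E →L[ℝ] ℝ := β.comp
    ((trivializationAt E (TangentSpace I : M → Type _) b).symmL ℝ x) with hβ'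
  have hβa : ∀ u, β' (mvfderiv I φ x u) = β u := by
    intro u
    change β (coordField I b _ x) = _
    rw [coordField_mvfderiv hx]
  refine ⟨k, β', fun Y hY u => ?_⟩
  rw [hkβ Y hY u, weylForm_apply, W.chartForm_mvfderiv hx]
  simp [hβa]
  abel

end WeylSpace

end LocalCoframe

section FrameSmoothness

open Matrix

variable {E : Type*} [NormedAddCommGroup E] [NormedSpace ℝ E]
  {Ω : Set E} {T : E → E →L[ℝ] (Fin 3 → ℝ)} {om : E → E →L[ℝ] ℝ}

/-- The frame that is dual to a smooth coframe. -/
lemma exists_dual_frame [FiniteDimensional ℝ E] (hT : ContDiffOn ℝ ∞ T Ω)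
    (hb : ∀ z ∈ Ω, Function.Bijective (T z)) : ∃ e : Fin 3 → E → E,
      (∀ i, ContDiffOn ℝ ∞ (e i) Ω) ∧ ∀ z ∈ Ω, (∀ i, T z (e i z) = Pi.single i 1) ∧
        ∀ c, c = ∑ i, T z c i • e i z := by
  have h1 : ∀ z ∈ Ω, ∃ Φ : E ≃L[ℝ] (Fin 3 → ℝ), (Φ : E →L[ℝ] (Fin 3 → ℝ)) = T z := by
    intro z hz
    exact ⟨(LinearEquiv.ofBijective (T z : E →ₗ[ℝ] (Fin 3 → ℝ)) (hb z hz)).toContinuousLinearEquiv,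
      by ext; rfl⟩
  refine ⟨fun i z => (T z).inverse (Pi.single i 1), fun i => ?_, fun z hz => ?_⟩
  · have h2 : ContDiffOn ℝ ∞ (fun z => (T z).inverse) Ω := by
      intro z hz
      obtain ⟨Φ, hΦ⟩ := h1 z hz
      have h3 : ContDiffAt ℝ ∞ (ContinuousLinearMap.inverse :
          (E →L[ℝ] (Fin 3 → ℝ)) → (Fin 3 → ℝ) →L[ℝ] E) (T z) := by
        have : CompleteSpace E := FiniteDimensional.complete ℝ E
        rw [← hΦ]
        exact contDiffAt_map_inverse Φ
      exact h3.comp_contDiffWithinAt z (hT z hz)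
    exact h2.clm_apply contDiffOn_const
  · obtain ⟨Φ, hΦ⟩ := h1 z hz
    have h2 : ∀ i, T z ((T z).inverse (Pi.single i 1)) = Pi.single i 1 := by
      intro i
      rw [← hΦ, ContinuousLinearMap.inverse_equiv]
      simp
    refine ⟨h2, fun c => (hb z hz).1 ?_⟩
    ext j
    simp only [map_sum, map_smul, h2]
    simp [Finset.sum_apply, Pi.single_apply]

/-- The torsion-free condition determines the connection form. -/
lemma contDiffOn_of_torsion [FiniteDimensional ℝ E] (hΩ : IsOpen Ω) (hT : ContDiffOn ℝ ∞ T Ω)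
    (hom : ContDiffOn ℝ ∞ om Ω) (hb : ∀ z ∈ Ω, Function.Bijective (T z)) {κ : E → ℝ}
    {α : E → E →L[ℝ] ℝ} (h : ∀ z ∈ Ω, ∀ u v, fderiv ℝ T z u v - fderiv ℝ T z v u
      + weylForm (om z) (κ z • T z + (ContinuousLinearMap.toSpanSingleton ℝ
        (Pi.single 0 1)).comp (α z)) u (T z v)
      - weylForm (om z) (κ z • T z + (ContinuousLinearMap.toSpanSingleton ℝ
        (Pi.single 0 1)).comp (α z)) v (T z u) = 0) :
    ContDiffOn ℝ ∞ κ Ω ∧ ContDiffOn ℝ ∞ α Ω := by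
  obtain ⟨e, he, hTe⟩ := exists_dual_frame hT hb
  have hT' : ContDiffOn ℝ ∞ (fderiv ℝ T) Ω := ((contDiffOn_infty_iff_fderiv_of_isOpen hΩ).1 hT).2
  set θ : Fin 3 → Fin 3 → E → Fin 3 → ℝ := fun i j z => fderiv ℝ T z (e i z) (e j z)
    - fderiv ℝ T z (e j z) (e i z) + om z (e i z) • T z (e j z) - om z (e j z) • T z (e i z) with hθ
  have hθs : ∀ i j k, ContDiffOn ℝ ∞ (fun z => θ i j z k) Ω := by
    intro i j
    rw [← contDiffOn_pi]
    exact (((((hT'.clm_apply (he i)).clm_apply (he j)).sub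
      ((hT'.clm_apply (he j)).clm_apply (he i))).add
      ((hom.clm_apply (he i)).smul (hT.clm_apply (he j)))).sub
      ((hom.clm_apply (he j)).smul (hT.clm_apply (he i))))
  have key : ∀ i j, ∀ z ∈ Ω, θ i j z = -((κ z • Pi.single i 1 + α z (e i z) • Pi.single 0 1) ⨯₃
      Pi.single j 1 - (κ z • Pi.single j 1 + α z (e j z) • Pi.single 0 1) ⨯₃ Pi.single i 1) := by
    intro i j z hz
    have h1 := h z hz (e i z) (e j z)
    simp only [weylForm_apply, (hTe z hz).1, _root_.add_apply, _root_.smul_apply,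
      ContinuousLinearMap.comp_apply, ContinuousLinearMap.toSpanSingleton_apply] at h1
    rw [hθ, ← sub_eq_zero]
    simp only [(hTe z hz).1]
    rw [← h1]
    abel
  have hκ : ∀ z ∈ Ω, κ z = -(1 / 2) * θ 1 2 z 0 := by
    intro z hz
    rw [key 1 2 z hz]
    simp [cross_apply]
    ring
  have h0 : ∀ z ∈ Ω, α z (e 0 z) = -θ 0 1 z 2 + θ 1 2 z 0 := by
    intro z hz
    rw [key 0 1 z hz, key 1 2 z hz]
    simp [cross_apply]
  have h1 : ∀ z ∈ Ω, α z (e 1 z) = θ 1 2 z 1 := by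
    intro z hz
    rw [key 1 2 z hz]
    simp [cross_apply]
  have h2 : ∀ z ∈ Ω, α z (e 2 z) = θ 1 2 z 2 := by
    intro z hz
    rw [key 1 2 z hz]
    simp [cross_apply]
  refine ⟨(contDiffOn_const.mul (hθs 1 2 0)).congr hκ, ?_⟩
  rw [contDiffOn_clm_apply]
  intro c
  have hc : ∀ i, ContDiffOn ℝ ∞ (fun z => T z c i) Ω :=
    contDiffOn_pi.1 (hT.clm_apply contDiffOn_const)
  refine ((((hc 0).mul ((hθs 0 1 2).neg.add (hθs 1 2 0))).add ((hc 1).mul (hθs 1 2 1))).add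
    ((hc 2).mul (hθs 1 2 2))).congr fun z hz => ?_
  conv_lhs => rw [(hTe z hz).2 c, Fin.sum_univ_three]
  simp only [map_add, map_smul, smul_eq_mul, h0 z hz, h1 z hz, h2 z hz]

end FrameSmoothness

section AxialRotation

open Matrix

/-- The projection to the first axis. -/
noncomputable def axisProj : (Fin 3 → ℝ) →L[ℝ] (Fin 3 → ℝ) :=
  (ContinuousLinearMap.proj (R := ℝ) (φ := fun _ : Fin 3 => ℝ) 0).smulRight (Pi.single 0 1)

/-- The rotation about the first axis by the angle `t`. -/
noncomputable def axialRotation (t : ℝ) : (Fin 3 → ℝ) →L[ℝ] (Fin 3 → ℝ) :=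
  axisProj + Real.cos t • (ContinuousLinearMap.id ℝ (Fin 3 → ℝ) - axisProj)
    + Real.sin t • crossL (Pi.single 0 1)

lemma axialRotation_apply (t : ℝ) (a : Fin 3 → ℝ) : axialRotation t a =
    ![a 0, Real.cos t * a 1 - Real.sin t * a 2, Real.sin t * a 1 + Real.cos t * a 2] := by
  ext i
  fin_cases i <;> simp [axialRotation, axisProj, cross_apply] <;> ring

lemma axialRotation_dotProduct (t : ℝ) (a b : Fin 3 → ℝ) :
    axialRotation t a ⬝ᵥ axialRotation t b = a ⬝ᵥ b := by
  have h := Real.sin_sq_add_cos_sq t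
  simp only [axialRotation_apply, dotProduct, Fin.sum_univ_three]
  simp
  linear_combination (a 1 * b 1 + a 2 * b 2) * h

lemma axialRotation_cross (t : ℝ) (a b : Fin 3 → ℝ) :
    axialRotation t (a ⨯₃ b) = axialRotation t a ⨯₃ axialRotation t b := by
  have h := Real.sin_sq_add_cos_sq t
  simp only [axialRotation_apply]
  ext i
  fin_cases i <;> simp [cross_apply] <;> grind

lemma axialRotation_axis (t : ℝ) : axialRotation t (Pi.single 0 1) = Pi.single 0 1 := by
  rw [axialRotation_apply]
  ext i
  fin_cases i <;> simp

lemma axialRotation_bijective (t : ℝ) : Function.Bijective (axialRotation t) := by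
  have hi : Function.Injective (axialRotation t : (Fin 3 → ℝ) →ₗ[ℝ] (Fin 3 → ℝ)) := by
    rw [injective_iff_map_eq_zero]
    intro a ha
    have h1 := axialRotation_dotProduct t a a
    have h2 : axialRotation t a = 0 := ha
    rw [h2, zero_dotProduct] at h1
    exact dotProduct_self_eq_zero.1 h1.symm
  exact ⟨hi, LinearMap.injective_iff_surjective.1 hi⟩

lemma hasDerivAt_axialRotation (t : ℝ) : HasDerivAt axialRotation
    ((crossL (Pi.single 0 1)).comp (axialRotation t)) t := by
  have h := (((Real.hasDerivAt_cos t).smul_const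
    (ContinuousLinearMap.id ℝ (Fin 3 → ℝ) - axisProj)).const_add axisProj).add
    ((Real.hasDerivAt_sin t).smul_const (crossL (Pi.single 0 1)))
  refine h.congr_deriv ?_
  ext a i
  fin_cases i <;> simp [axialRotation_apply, axisProj, cross_apply] <;> ring

lemma contDiff_axialRotation : ContDiff ℝ ∞ axialRotation :=
  (contDiff_const.add (Real.contDiff_cos.smul contDiff_const)).add
    (Real.contDiff_sin.smul contDiff_const)

end AxialRotation

section TodaFrame

open Matrix

variable {E : Type*} [NormedAddCommGroup E] [NormedSpace ℝ E] [FiniteDimensional ℝ E]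
  {H : Type*} [TopologicalSpace H] {I : ModelWithCorners ℝ E H}
  {M : Type*} [TopologicalSpace M] [ChartedSpace H M] [IsManifold I ∞ M] [I.Boundaryless]

namespace WeylSpace

variable {W : WeylSpace I M}

/-- The torsion-free condition in the chart at `b`. -/
lemma HasConnectionFormAt.torsion_chart {b x : M} (hx : x ∈ (chartAt H b).source)
    {T : E → E →L[ℝ] (Fin 3 → ℝ)} (hT : DifferentiableAt ℝ T (extChartAt I b x))
    {A : M → E →L[ℝ] (Fin 3 → ℝ) →L[ℝ] (Fin 3 → ℝ)}
    (h : W.HasConnectionFormAt (extChartAt I b) (fun y => T (extChartAt I b y)) A x) (c d : E) :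
    fderiv ℝ T (extChartAt I b x) c d - fderiv ℝ T (extChartAt I b x) d c
      + A x c (T (extChartAt I b x) d) - A x d (T (extChartAt I b x) c) = 0 := by
  have hφ := contMDiffAt_extChartAt' (I := I) (n := ∞) hx
  have hφd := hφ.mdifferentiableAt (by simp)
  have h1 := h.torsion hφ (hT.mdifferentiableAt.comp x hφd) (coordField I b c x)
    (coordField I b d x)
  have h2 : ∀ u, mvfderiv I (fun y => T (extChartAt I b y)) x u = _ :=
    fun u => mvfderiv_comp_fderiv hT hφd u
  rw [h2, h2, mvfderiv_coordField hx, mvfderiv_coordField hx] at h1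
  exact h1

/-- Einstein-Weyl implies that `α` is closed. -/
lemma IsEinsteinWeyl.formDeriv_eq_zero {E' : Type*} [NormedAddCommGroup E'] [NormedSpace ℝ E']
    (hW : W.IsEinsteinWeyl) {F : M → E'} {T : M → E' →L[ℝ] (Fin 3 → ℝ)}
    {om α : M → E' →L[ℝ] ℝ} {κ : M → ℝ} {x : M}
    (h : ∀ᶠ y in 𝓝 x, W.HasConnectionFormAt F T (fun y => weylForm (om y)
      (κ y • T y + (ContinuousLinearMap.toSpanSingleton ℝ (Pi.single 0 1)).comp (α y))) y)
    (hF : ContMDiffAt I 𝓘(ℝ, E') ∞ F x)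
    (hT : ContMDiffAt I 𝓘(ℝ, E' →L[ℝ] (Fin 3 → ℝ)) ∞ T x)
    (hom : ContMDiffAt I 𝓘(ℝ, E' →L[ℝ] ℝ) ∞ om x)
    (hα : ContMDiffAt I 𝓘(ℝ, E' →L[ℝ] ℝ) ∞ α x)
    (hκ : ContMDiffAt I 𝓘(ℝ, ℝ) ∞ κ x) (Φ : TangentSpace I x ≃ₗ[ℝ] (Fin 3 → ℝ))
    (hΦ : ∀ u, Φ u = T x (mvfderiv I F x u))
    (hg : ∀ u v, W.g.inner x u v = Φ u ⬝ᵥ Φ v) (u v : TangentSpace I x) :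
    formDeriv (I := I) F α x u v = 0 := by
  obtain ⟨s, hs⟩ := hW x
  have hr := (HasConnectionFormAt.ricci h hF hT hom hα hκ Φ hΦ).2
  set A := formDeriv (I := I) F α x with hA
  have hskew : ∀ u v, A u v = -A v u := by
    intro u v
    rw [hA, formDeriv_apply, formDeriv_apply]
    ring
  set e : Fin 3 → TangentSpace I x := fun i => Φ.symm (Pi.single i 1) with he
  have hq : ∀ v w, 2 * κ x ^ 2 * (Φ v ⬝ᵥ Φ w) + (A (Φ.symm (Pi.single 0 1 ⨯₃ Φ w)) v
      + A (Φ.symm (Pi.single 0 1 ⨯₃ Φ v)) w) / 2 = s * (Φ v ⬝ᵥ Φ w) := fun v w => by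
    rw [← hr, hs, hg]
  have e0 : Pi.single 0 1 ⨯₃ Φ (e 0) = 0 := by simp [he]
  have e1 : Pi.single 0 1 ⨯₃ Φ (e 1) = Pi.single 2 1 := by
    simp only [he, LinearEquiv.apply_symm_apply]
    ext i
    fin_cases i <;> simp [cross_apply]
  have e2 : Pi.single 0 1 ⨯₃ Φ (e 2) = -Pi.single 1 1 := by
    simp only [he, LinearEquiv.apply_symm_apply]
    ext i
    fin_cases i <;> simp [cross_apply]
  have q00 := hq (e 0) (e 0)
  have q11 := hq (e 1) (e 1)
  have q01 := hq (e 0) (e 1)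
  have q02 := hq (e 0) (e 2)
  rw [e0] at q00 q01 q02
  rw [e1] at q11 q01
  rw [e2] at q02
  simp only [map_zero, map_neg, LinearMap.zero_apply, LinearMap.neg_apply] at q00 q11 q01 q02
  have hee : ∀ i, Φ.symm (Pi.single i 1) = e i := fun i => rfl
  rw [hee] at q11 q01 q02
  have hΦe : ∀ i, Φ (e i) = Pi.single i 1 := fun i => Φ.apply_symm_apply _
  simp only [hΦe, dotProduct_single, Pi.single_eq_same, mul_one] at q00 q11 q01 q02
  simp at q00 q01 q02
  have a21 : A (e 2) (e 1) = 0 := by linarith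
  have a20 : A (e 2) (e 0) = 0 := by linarith
  have a10 : A (e 1) (e 0) = 0 := by linarith
  have hself : ∀ u, A u u = 0 := fun u => by linarith [hskew u u]
  have hexp : ∀ u, u = ∑ i, Φ u i • e i := by
    intro u
    apply Φ.injective
    ext j
    simp [hΦe, Finset.sum_apply, Pi.single_apply]
  rw [hexp u, hexp v]
  simp only [Fin.sum_univ_three, map_add, map_smul, LinearMap.add_apply, LinearMap.smul_apply,
    hself, a21, a20, a10, hskew (e 0) (e 1), hskew (e 0) (e 2), hskew (e 1) (e 2)]
  simp

/-- A rotation about the first axis changes the connection form by a multiple of `e₀`. -/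
lemma HasConnectionFormAt.axialRotation {E' : Type*} [NormedAddCommGroup E'] [NormedSpace ℝ E']
    {F : M → E'} {T : M → E' →L[ℝ] (Fin 3 → ℝ)} {om α : M → E' →L[ℝ] ℝ} {κ ψ : M → ℝ} {x : M}
    (h : W.HasConnectionFormAt F T (fun y => weylForm (om y)
      (κ y • T y + (ContinuousLinearMap.toSpanSingleton ℝ (Pi.single 0 1)).comp (α y))) x)
    (hF : ContMDiffAt I 𝓘(ℝ, E') ∞ F x)
    (hT : MDifferentiableAt I 𝓘(ℝ, E' →L[ℝ] (Fin 3 → ℝ)) T x)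
    (hψ : MDifferentiableAt I 𝓘(ℝ, ℝ) ψ x)
    (hψα : ∀ u, mvfderiv I ψ x u = α x (mvfderiv I F x u)) :
    W.HasConnectionFormAt F (fun y => (_root_.axialRotation (ψ y)).comp (T y))
      (fun y => weylForm (om y) (κ y • (_root_.axialRotation (ψ y)).comp (T y))) x := by
  intro Y hY u
  have h1 := h Y hY u
  have hd : MDifferentiableAt I 𝓘(ℝ, Fin 3 → ℝ) (fun y => T y (mvfderiv I F y (Y y))) x :=
    hT.clm_apply (MDifferentiableAt.mvfderiv_vectorField hF hY)
  have hR := hasDerivAt_axialRotation (ψ x)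
  have hRd : MDifferentiableAt I 𝓘(ℝ, (Fin 3 → ℝ) →L[ℝ] (Fin 3 → ℝ))
      (fun y => _root_.axialRotation (ψ y)) x :=
    hR.differentiableAt.mdifferentiableAt.comp x hψ
  have h2 := mvfderiv_clm_apply hRd hd u
  have h3 := mvfderiv_comp_fderiv hR.differentiableAt hψ u
  rw [hR.hasFDerivAt.fderiv] at h3
  rw [h3, hψα] at h2
  simp only [ContinuousLinearMap.comp_apply, weylForm_apply, _root_.smul_apply] at h1 h2 ⊢
  rw [h1, h2]
  simp only [map_add, map_smul, axialRotation_cross, _root_.add_apply, LinearMap.add_apply,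
    _root_.smul_apply, LinearMap.smul_apply, ContinuousLinearMap.comp_apply,
    ContinuousLinearMap.toSpanSingleton_apply, axialRotation_axis, crossL_apply]
  abel

end WeylSpace

end TodaFrame

section ExistsTodaFrame

open Matrix

/-- The divergence is smooth. -/
lemma contDiffOn_of_deriv_unit {E : Type*} [NormedAddCommGroup E] [NormedSpace ℝ E]
    [FiniteDimensional ℝ E] {Ω : Set E} {T : E → E →L[ℝ] (Fin 3 → ℝ)} {p : E → Fin 3 → ℝ}
    {κ τ : E → ℝ} (hΩ : IsOpen Ω) (hT : ContDiffOn ℝ ∞ T Ω)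
    (hb : ∀ z ∈ Ω, Function.Bijective (T z)) (hp : ContDiffOn ℝ ∞ p Ω)
    (hpp : ∀ z ∈ Ω, p z ⬝ᵥ p z = 1)
    (h : ∀ z ∈ Ω, ∀ u, fderiv ℝ p z u
      = τ z • (T z u - (T z u ⬝ᵥ p z) • p z) + κ z • (p z ⨯₃ T z u)) : ContDiffOn ℝ ∞ τ Ω := by
  obtain ⟨e, he, hTe⟩ := exists_dual_frame hT hb
  have hp' : ContDiffOn ℝ ∞ (fderiv ℝ p) Ω := ((contDiffOn_infty_iff_fderiv_of_isOpen hΩ).1 hp).2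
  have hs : ∀ i, ContDiffOn ℝ ∞ (fun z => fderiv ℝ p z (e i z) i) Ω := fun i =>
    contDiffOn_pi.1 (hp'.clm_apply (he i)) i
  refine ((contDiffOn_const (c := (1 / 2 : ℝ))).mul (((hs 0).add (hs 1)).add (hs 2))).congr
    fun z hz => ?_
  have h1 := hpp z hz
  simp only [dotProduct, Fin.sum_univ_three] at h1
  rw [h z hz, h z hz, h z hz]
  simp only [(hTe z hz).1]
  simp [cross_apply]
  linear_combination ((1 / 2) * τ z) * h1

variable {E : Type*} [NormedAddCommGroup E] [NormedSpace ℝ E] [FiniteDimensional ℝ E]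
  {H : Type*} [TopologicalSpace H] {I : ModelWithCorners ℝ E H}
  {M : Type*} [TopologicalSpace M] [ChartedSpace H M] [IsManifold I ∞ M] [I.Boundaryless]

namespace WeylSpace

variable {W : WeylSpace I M}

/-- The coframe of `exists_local_coframe`, rotated such that `α` vanishes. -/
theorem IsEinsteinWeyl.exists_twist_coframe (hW : W.IsEinsteinWeyl)
    {ξ : (x : M) → TangentSpace I x} {τ κ : M → ℝ}
    {J : (x : M) → TangentSpace I x →ₗ[ℝ] TangentSpace I x} (h : W.IsShearFreeGeodesic ξ τ κ J)
    (hτ : ∀ x, τ x = 0) (hE : Module.finrank ℝ E = 3) (b : M) :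
    ∃ (Ω : Set E) (T : E → E →L[ℝ] (Fin 3 → ℝ)) (κ : E → ℝ), IsOpen Ω ∧
      Ω ⊆ (extChartAt I b).target ∧ extChartAt I b b ∈ Ω ∧ ContDiffOn ℝ ∞ T Ω ∧
      ContDiffOn ℝ ∞ κ Ω ∧ (∀ z ∈ Ω, Function.Bijective (T z)) ∧
      (∀ z ∈ Ω, ∀ c d, W.chartMetric b z c d = T z c ⬝ᵥ T z d) ∧
      ∀ x ∈ (chartAt H b).source, extChartAt I b x ∈ Ω → W.HasConnectionFormAt (extChartAt I b)
        (fun y => T (extChartAt I b y)) (fun y => weylForm (W.chartForm b (extChartAt I b y))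
          (κ (extChartAt I b y) • T (extChartAt I b y))) x := by
  obtain ⟨Ω, T, hΩ, hΩt, hb, hT, hbij, hg, hcon⟩ := h.exists_local_coframe hτ hE b
  set φ := extChartAt I b with hφ
  have hsource : φ.source = (chartAt H b).source := extChartAt_source I b
  have hmem : ∀ z ∈ Ω, φ.symm z ∈ (chartAt H b).source := fun z hz => by
    rw [← hsource]; exact φ.map_target (hΩt hz)
  have hφs : ∀ z ∈ Ω, φ (φ.symm z) = z := fun z hz => φ.right_inv (hΩt hz)
  have hom : ContDiffOn ℝ ∞ (W.chartForm b) Ω := (W.contDiffOn_chartForm b).mono hΩt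
  have hc1 : ∀ z ∈ Ω, ∃ (k : ℝ) (α : E →L[ℝ] ℝ), W.HasConnectionFormAt φ (fun y => T (φ y))
      (fun _ => weylForm (W.chartForm b z) (k • T z +
        (ContinuousLinearMap.toSpanSingleton ℝ (Pi.single 0 1)).comp α)) (φ.symm z) := by
    intro z hz
    have h1 := hcon (φ.symm z) (hmem z hz)
    rw [hφs z hz] at h1
    exact h1 hz
  choose! κ α hκα using hc1
  have hcon' : ∀ x ∈ (chartAt H b).source, φ x ∈ Ω → W.HasConnectionFormAt φ (fun y => T (φ y))
      (fun y => weylForm (W.chartForm b (φ y)) (κ (φ y) • T (φ y) +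
        (ContinuousLinearMap.toSpanSingleton ℝ (Pi.single 0 1)).comp (α (φ y)))) x := by
    intro x hx hxΩ
    have h1 := hκα (φ x) hxΩ
    rw [φ.left_inv (by rwa [hsource])] at h1
    exact h1
  obtain ⟨hκ, hα⟩ := contDiffOn_of_torsion hΩ hT hom hbij (κ := κ) (α := α) (by
    intro z hz u v
    have h1 := (hκα z hz).torsion_chart (hmem z hz)
      (by rw [← hφ, hφs z hz]; exact (hT.contDiffAt (hΩ.mem_nhds hz)).differentiableAt (by simp)) u v
    rw [← hφ, hφs z hz] at h1
    exact h1)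
  have hφm : ∀ x ∈ (chartAt H b).source, ContMDiffAt I 𝓘(ℝ, E) ∞ φ x :=
    fun x hx => contMDiffAt_extChartAt' hx
  have hev : ∀ x ∈ (chartAt H b).source, φ x ∈ Ω → ∀ᶠ y in 𝓝 x,
      y ∈ (chartAt H b).source ∧ φ y ∈ Ω := fun x hx hxΩ =>
    Filter.Eventually.and ((chartAt H b).open_source.mem_nhds hx)
      ((hφm x hx).continuousAt.eventually_mem (hΩ.mem_nhds hxΩ))
  have hαs : ∀ z ∈ Ω, ∀ c d, fderiv ℝ α z c d = fderiv ℝ α z d c := by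
    intro z hz c d
    have hx := hmem z hz
    have hxΩ : φ (φ.symm z) ∈ Ω := by rwa [hφs z hz]
    have hsm : ∀ {G : Type _} [NormedAddCommGroup G] [NormedSpace ℝ G] {f : E → G},
        ContDiffOn ℝ ∞ f Ω → ContMDiffAt I 𝓘(ℝ, G) ∞ (fun y => f (φ y)) (φ.symm z) :=
      fun hf => ContMDiffAt.comp (φ.symm z) (hf.contDiffAt (hΩ.mem_nhds hxΩ)).contMDiffAt
        (hφm _ hx)
    have hκm : ContMDiffAt I 𝓘(ℝ, ℝ) ∞ (fun y => κ (φ y)) (φ.symm z) :=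
      ContMDiffAt.comp (φ.symm z) (hκ.contDiffAt (hΩ.mem_nhds hxΩ)).contMDiffAt (hφm _ hx)
    have hbx : Function.Bijective ((T (φ (φ.symm z))).comp (mvfderiv I φ (φ.symm z))).toLinearMap :=
      (hbij _ hxΩ).comp (mvfderiv_extChartAt_bijective hx)
    have h1 := hW.formDeriv_eq_zero (x := φ.symm z) (F := φ) (T := fun y => T (φ y))
      (om := fun y => W.chartForm b (φ y)) (α := fun y => α (φ y)) (κ := fun y => κ (φ y))
      (by filter_upwards [hev _ hx hxΩ] with y hy using hcon' y hy.1 hy.2)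
      (hφm _ hx) (hsm hT) (hsm hom) (hsm hα) hκm (LinearEquiv.ofBijective _ hbx)
      (fun u => rfl) (fun u v => by
        rw [← W.chartMetric_mvfderiv hx, hg _ hxΩ]
        rfl) (coordField I b c _) (coordField I b d _)
    have h2 : ∀ u, mvfderiv I (fun y => α (φ y)) (φ.symm z) u = _ := fun u =>
      mvfderiv_comp_fderiv ((hα.contDiffAt (hΩ.mem_nhds hxΩ)).differentiableAt (by simp))
        ((hφm _ hx).mdifferentiableAt (by simp)) u
    rw [formDeriv_apply, h2, h2, mvfderiv_coordField hx, mvfderiv_coordField hx, hφs z hz] at h1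
    linarith
  obtain ⟨r, hr, hrΩ⟩ := Metric.isOpen_iff.1 hΩ _ hb
  obtain ⟨ψ, hψ⟩ := (convex_ball (φ b) r).exists_forall_hasFDerivAt_of_fderiv_symmetric
    Metric.isOpen_ball ((hα.mono hrΩ).differentiableOn (by simp))
    (fun z hz c d => hαs z (hrΩ hz) c d)
  have hψs : ContDiffOn ℝ ∞ ψ (Metric.ball (φ b) r) :=
    contDiffOn_infty_iff_fderiv_of_isOpen Metric.isOpen_ball |>.2
      ⟨fun y hy => (hψ y hy).differentiableAt.differentiableWithinAt,
        (hα.mono hrΩ).congr fun y hy => (hψ y hy).fderiv⟩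
  refine ⟨Metric.ball (φ b) r, fun z => (axialRotation (ψ z)).comp (T z), κ, Metric.isOpen_ball,
    hrΩ.trans hΩt, Metric.mem_ball_self hr,
    (contDiff_axialRotation.comp_contDiffOn hψs).clm_comp (hT.mono hrΩ), hκ.mono hrΩ,
    fun z hz => (axialRotation_bijective _).comp (hbij z (hrΩ hz)), fun z hz c d => ?_,
    fun x hx hxr => ?_⟩
  · rw [hg z (hrΩ hz)]
    exact (axialRotation_dotProduct _ _ _).symm
  · have hψd : MDifferentiableAt I 𝓘(ℝ, ℝ) (fun y => ψ (φ y)) x :=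
      (hψ _ hxr).differentiableAt.mdifferentiableAt.comp x ((hφm x hx).mdifferentiableAt (by simp))
    refine (hcon' x hx (hrΩ hxr)).axialRotation (ψ := fun y => ψ (φ y)) (hφm x hx)
      ?_ hψd fun u => ?_
    · exact ((hT.contDiffAt (hΩ.mem_nhds (hrΩ hxr))).differentiableAt
        (by simp)).mdifferentiableAt.comp x ((hφm x hx).mdifferentiableAt (by simp))
    · have h2 := mvfderiv_comp_fderiv (hψ _ hxr).differentiableAt
        ((hφm x hx).mdifferentiableAt (by simp)) u
      rw [(hψ _ hxr).fderiv] at h2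
      exact h2

/-- An Einstein-Weyl space with a Toda congruence and a hyperCR congruence is locally given by a
Toda frame. -/
theorem IsEinsteinWeyl.exists_isTodaFrame (hW : W.IsEinsteinWeyl)
    {ξ : (x : M) → TangentSpace I x} {τ κ : M → ℝ}
    {J : (x : M) → TangentSpace I x →ₗ[ℝ] TangentSpace I x} (h : W.IsShearFreeGeodesic ξ τ κ J)
    (hτ : ∀ x, τ x = 0) {χ : (x : M) → TangentSpace I x} {σ ν : M → ℝ}
    {J' : (x : M) → TangentSpace I x →ₗ[ℝ] TangentSpace I x} (hχ : W.IsShearFreeGeodesic χ σ ν J')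
    (hν : ∀ x, ν x = 0) (hE : Module.finrank ℝ E = 3) (b : M) :
    ∃ (Ω : Set E) (T : E → E →L[ℝ] (Fin 3 → ℝ)) (κ τ : E → ℝ) (p : E → Fin 3 → ℝ),
      IsTodaFrame Ω T (W.chartForm b) κ τ p ∧
      Ω ⊆ (extChartAt I b).target ∧ extChartAt I b b ∈ Ω ∧
      ∀ x ∈ (chartAt H b).source, extChartAt I b x ∈ Ω →
        W.HasConnectionFormAt (extChartAt I b) (fun y => T (extChartAt I b y))
          (fun y => weylForm (W.chartForm b (extChartAt I b y))
            (κ (extChartAt I b y) • T (extChartAt I b y))) x ∧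
        (∀ u v : TangentSpace I x, W.g.inner x u v =
          T (extChartAt I b x) (mvfderiv I (extChartAt I b) x u) ⬝ᵥ
          T (extChartAt I b x) (mvfderiv I (extChartAt I b) x v)) ∧
        T (extChartAt I b x) (mvfderiv I (extChartAt I b) x (χ x)) = -p (extChartAt I b x) ∧
        τ (extChartAt I b x) = -σ x := by
  obtain ⟨Ω, T, κ, hΩ, hΩt, hb, hT, hκ, hbij, hg, hcon⟩ := hW.exists_twist_coframe h hτ hE b
  set φ := extChartAt I b with hφ
  have hsource : φ.source = (chartAt H b).source := extChartAt_source I b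
  have hmem : ∀ z ∈ Ω, φ.symm z ∈ (chartAt H b).source := fun z hz => by
    rw [← hsource]; exact φ.map_target (hΩt hz)
  have hφs : ∀ z ∈ Ω, φ (φ.symm z) = z := fun z hz => φ.right_inv (hΩt hz)
  have hφm : ∀ x ∈ (chartAt H b).source, ContMDiffAt I 𝓘(ℝ, E) ∞ φ x :=
    fun x hx => contMDiffAt_extChartAt' hx
  set χ' : E → E := fun z => mvfderiv I φ (φ.symm z) (χ (φ.symm z)) with hχ'
  have hχs : ContDiffOn ℝ ∞ χ' Ω :=
    (ContMDiffOn.comp_extChartAt_symm' (f := fun y => mvfderiv I φ y (χ y)) fun y hy =>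
      (contMDiffAt_section_iff_mvfderiv hy χ).1 (hχ.congruence.smooth y)).mono hΩt
  have hχx : ∀ x ∈ (chartAt H b).source, χ' (φ x) = mvfderiv I φ x (χ x) := by
    intro x hx
    simp only [hχ']
    rw [φ.left_inv (by rwa [hsource])]
  have hgm : ∀ x ∈ (chartAt H b).source, φ x ∈ Ω → ∀ u v : TangentSpace I x,
      W.g.inner x u v = T (φ x) (mvfderiv I φ x u) ⬝ᵥ T (φ x) (mvfderiv I φ x v) := by
    intro x hx hxΩ u v
    rw [← W.chartMetric_mvfderiv hx, hg _ hxΩ]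
  set p : E → Fin 3 → ℝ := fun z => -T z (χ' z) with hp
  set τ' : E → ℝ := fun z => -σ (φ.symm z) with hτ'
  have hps : ContDiffOn ℝ ∞ p Ω := (hT.clm_apply hχs).neg
  have hpp : ∀ z ∈ Ω, p z ⬝ᵥ p z = 1 := by
    intro z hz
    have h1 := hgm (φ.symm z) (hmem z hz) (by rwa [hφs z hz]) (χ _) (χ _)
    rw [hχ.congruence.unit, hφs z hz] at h1
    simp only [hp, neg_dotProduct_neg]
    exact h1.symm
  have hdp : ∀ z ∈ Ω, ∀ c, fderiv ℝ p z c
      = τ' z • (T z c - (T z c ⬝ᵥ p z) • p z) + κ z • (p z ⨯₃ T z c) := by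
    intro z hz c
    have hx := hmem z hz
    have hxΩ : φ (φ.symm z) ∈ Ω := by rwa [hφs z hz]
    set x := φ.symm z with hxd
    have h1 := hcon x hx hxΩ χ ((hχ.congruence.smooth x).mdifferentiableAt (by simp))
      (coordField I b c x)
    have h2 : (fun y => T (φ y) (mvfderiv I φ y (χ y))) =ᶠ[𝓝 x] fun y => -p (φ y) := by
      filter_upwards [(chartAt H b).open_source.mem_nhds hx] with y hy
      simp only [hp, hχx y hy, neg_neg]
    have h3 := mvfderiv_comp_fderiv (f := fun z => -p z) (s := φ) (x := x)
      ((hps.neg.contDiffAt (hΩ.mem_nhds hxΩ)).differentiableAt (by simp))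
      ((hφm x hx).mdifferentiableAt (by simp)) (coordField I b c x)
    have h4 := hχ.eqn x (coordField I b c x)
    rw [hν, zero_smul, add_zero, weightlessD] at h4
    have h5 := congrArg (fun v => T (φ x) (mvfderiv I φ x v)) h4
    have h6 : T (φ x) (mvfderiv I φ x (χ x)) = -p (φ x) := h2.self_of_nhds
    have hom := W.chartForm_mvfderiv hx (coordField I b c x)
    have hdc : mvfderiv I φ x (coordField I b c x) = c := mvfderiv_coordField hx c
    rw [h2.mvfderiv_eq, h3, h6, hdc] at h1
    rw [hdc, hφs z hz] at hom
    simp only [map_sub, map_smul] at h5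
    rw [h1, hgm x hx hxΩ, h6, hdc, hφs z hz] at h5
    have hxz : φ x = z := hφs z hz
    simp only [fderiv_fun_neg, weylForm_apply, _root_.neg_apply, _root_.smul_apply, hxz, hom] at h5
    simp only [map_neg, map_smul, LinearMap.smul_apply, neg_dotProduct] at h5
    have hτx : τ' z = -σ x := rfl
    rw [dotProduct_comm (T z c), ← cross_anticomm, hτx]
    linear_combination (norm := module) -h5
  refine ⟨Ω, T, κ, τ', p, ⟨hΩ, hT, (W.contDiffOn_chartForm b).mono hΩt, hκ,
    contDiffOn_of_deriv_unit hΩ hT hbij hps hpp hdp, hps, hbij, ?_, hpp, hdp⟩, hΩt, hb,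
    fun x hx hxΩ => ⟨hcon x hx hxΩ, hgm x hx hxΩ, ?_, ?_⟩⟩
  · intro z hz u v
    have h1 := (hcon _ (hmem z hz) (by rwa [hφs z hz])).torsion_chart (hmem z hz)
      (by rw [← hφ, hφs z hz]; exact (hT.contDiffAt (hΩ.mem_nhds hz)).differentiableAt (by simp)) u v
    rw [← hφ, hφs z hz] at h1
    simp only [weylForm_apply, _root_.smul_apply, map_smul, LinearMap.smul_apply] at h1
    rw [← cross_anticomm (T z u) (T z v)] at h1
    rw [← sub_eq_zero, ← h1]
    module
  · simp only [hp, hχx x hx, neg_neg]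
  · simp only [hτ']
    rw [φ.left_inv (by rwa [hsource])]

end WeylSpace

end ExistsTodaFrame

section ModelChart

open Matrix S2

lemma dotProduct_self_deriv {p X : Fin 3 → ℝ} (hp : p ⬝ᵥ p = 1) (t k : ℝ) (Y : Fin 3 → ℝ) :
    (t • (X - (X ⬝ᵥ p) • p) + k • (p ⨯₃ X)) ⬝ᵥ (t • (Y - (Y ⬝ᵥ p) • p) + k • (p ⨯₃ Y))
      = (t ^ 2 + k ^ 2) * (X ⬝ᵥ Y - (X ⬝ᵥ p) * (Y ⬝ᵥ p)) := by
  simp only [dotProduct, Fin.sum_univ_three, cross_apply, Pi.add_apply, Pi.smul_apply,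
    Pi.sub_apply, smul_eq_mul, cons_val_zero, cons_val_one, cons_val] at hp ⊢
  grind

variable {B : Type*} [TopologicalSpace B] [ChartedSpace (EuclideanSpace ℝ (Fin 3)) B]
    [IsManifold (𝓡 3) ∞ B] {W : WeylSpace (𝓡 3) B} {χ : (x : B) → TangentSpace (𝓡 3) x}

/-- The sphere-valued chart given by stereographic and affine coordinates. -/
noncomputable def sphereChart {ε : ℝ} (hε : ε ^ 2 = 1) {X : Type*} [TopologicalSpace X]
    [ChartedSpace (EuclideanSpace ℝ (Fin 3)) X] [IsManifold (𝓡 3) ∞ X] (b : X)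
    (e : OpenPartialHomeomorph (EuclideanSpace ℝ (Fin 3)) (ℂ × ℝ))
    (hs : e.source ⊆ (extChartAt (𝓡 3) b).target) (h : ContDiffOn ℝ ∞ e e.source)
    (h' : ContDiffOn ℝ ∞ e.symm e.target) : PartialDiffeomorph (𝓡 3) IS2R X (S2 × ℝ) ∞ where
  toFun x := (invStereo hε (e (extChartAt (𝓡 3) b x)).1, (e (extChartAt (𝓡 3) b x)).2)
  invFun q := (extChartAt (𝓡 3) b).symm (e.symm (stereo ε (coords q.1), q.2))
  source := (chartAt (EuclideanSpace ℝ (Fin 3)) b).source ∩ extChartAt (𝓡 3) b ⁻¹' e.source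
  target := {q | 1 - ε * coords q.1 0 ≠ 0 ∧ (stereo ε (coords q.1), q.2) ∈ e.target}
  map_source' := by
    rintro x ⟨hx, hxe⟩
    refine ⟨?_, ?_⟩
    · rw [coords_invStereo]
      exact one_sub_invStereoCoords_ne_zero hε _
    · simp only [coords_invStereo, stereo_invStereoCoords hε]
      exact e.map_source hxe
  map_target' := by
    rintro q ⟨hq, hqe⟩
    have h1 := e.map_target hqe
    refine ⟨?_, ?_⟩
    · rw [← extChartAt_source (𝓡 3)]
      exact (extChartAt (𝓡 3) b).map_target (hs h1)
    · rw [Set.mem_preimage, (extChartAt (𝓡 3) b).right_inv (hs h1)]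
      exact h1
  left_inv' := by
    rintro x ⟨hx, hxe⟩
    rw [← extChartAt_source (𝓡 3)] at hx
    simp only [coords_invStereo, stereo_invStereoCoords hε, Prod.mk.eta]
    rw [e.left_inv hxe, (extChartAt (𝓡 3) b).left_inv hx]
  right_inv' := by
    rintro q ⟨hq, hqe⟩
    rw [(extChartAt (𝓡 3) b).right_inv (hs (e.map_target hqe)), e.right_inv hqe]
    simp only [invStereo_stereo hε hq, Prod.mk.eta]
  open_source := (contMDiffOn_extChartAt (I := 𝓡 3) (n := ∞) (x := b)).continuousOn.isOpen_inter_preimage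
    (chartAt (EuclideanSpace ℝ (Fin 3)) b).open_source e.open_source
  open_target := by
    rw [isOpen_iff_mem_nhds]
    rintro q ⟨hq, hqe⟩
    have h0 : Continuous fun q : S2 × ℝ => 1 - ε * coords q.1 0 :=
      continuous_const.sub (continuous_const.mul
        ((continuous_apply 0).comp (contMDiff_coords.continuous.comp continuous_fst)))
    have h1 : ContinuousAt (fun q : S2 × ℝ => (stereo ε (coords q.1), q.2)) q :=
      ((contMDiffAt_stereo hq).continuousAt.comp continuousAt_fst).prodMk continuousAt_snd
    filter_upwards [h0.continuousAt.eventually_ne hq,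
      h1.eventually_mem (e.open_target.mem_nhds hqe)] with q h1 h2
    exact ⟨h1, h2⟩
  contMDiffOn_toFun := by
    rintro x ⟨hx, hxe⟩
    have h1 : ContMDiffAt (𝓡 3) 𝓘(ℝ, ℂ × ℝ) ∞ (fun x => e (extChartAt (𝓡 3) b x)) x :=
      ContMDiffAt.comp x (h.contDiffAt (e.open_source.mem_nhds hxe)).contMDiffAt
        (contMDiffAt_extChartAt' hx)
    have h2 : ContMDiffAt (𝓡 3) 𝓘(ℝ, ℂ) ∞ (fun x => (e (extChartAt (𝓡 3) b x)).1) x :=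
      contDiff_fst.contMDiff.contMDiffAt.comp x h1
    have h3 : ContMDiffAt (𝓡 3) 𝓘(ℝ, ℝ) ∞ (fun x => (e (extChartAt (𝓡 3) b x)).2) x :=
      contDiff_snd.contMDiff.contMDiffAt.comp x h1
    exact (((contMDiff_invStereo hε).contMDiffAt.comp x h2).prodMk h3).contMDiffWithinAt
  contMDiffOn_invFun := by
    rintro q ⟨hq, hqe⟩
    have h1 : ContMDiffAt IS2R 𝓘(ℝ, ℂ × ℝ) ∞
        (fun q : S2 × ℝ => (stereo ε (coords q.1), q.2)) q :=
      (ContMDiffAt.comp q (contMDiffAt_stereo hq) contMDiffAt_fst).prodMk_space contMDiffAt_snd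
    have h2 : ContMDiffAt IS2R 𝓘(ℝ, EuclideanSpace ℝ (Fin 3)) ∞
        (fun q : S2 × ℝ => e.symm (stereo ε (coords q.1), q.2)) q :=
      ContMDiffAt.comp q (h'.contDiffAt (e.open_target.mem_nhds hqe)).contMDiffAt h1
    exact (((contMDiffOn_extChartAt_symm b).contMDiffAt
      (extChartAt_target_mem_nhds' (hs (e.map_target hqe)))).comp q h2).contMDiffWithinAt

/-- Where `τ + i κ` does not vanish, a Weyl space with a Toda frame is locally a model space. -/
theorem IsTodaFrame.isModelNear {b x₀ : B} {Ω : Set (EuclideanSpace ℝ (Fin 3))}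
    {T : EuclideanSpace ℝ (Fin 3) → EuclideanSpace ℝ (Fin 3) →L[ℝ] (Fin 3 → ℝ)}
    {κ τ : EuclideanSpace ℝ (Fin 3) → ℝ} {p : EuclideanSpace ℝ (Fin 3) → Fin 3 → ℝ}
    (h : IsTodaFrame Ω T (W.chartForm b) κ τ p) (hΩ : Ω ⊆ (extChartAt (𝓡 3) b).target)
    (hx₀ : x₀ ∈ (chartAt (EuclideanSpace ℝ (Fin 3)) b).source)
    (hx₀Ω : extChartAt (𝓡 3) b x₀ ∈ Ω) (hlam : lam κ τ (extChartAt (𝓡 3) b x₀) ≠ 0)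
    (hg : ∀ x ∈ (chartAt (EuclideanSpace ℝ (Fin 3)) b).source, extChartAt (𝓡 3) b x ∈ Ω →
      (∀ u v : TangentSpace (𝓡 3) x, W.g.inner x u v =
          T (extChartAt (𝓡 3) b x) (mvfderiv (𝓡 3) (extChartAt (𝓡 3) b) x u) ⬝ᵥ
          T (extChartAt (𝓡 3) b x) (mvfderiv (𝓡 3) (extChartAt (𝓡 3) b) x v)) ∧
        T (extChartAt (𝓡 3) b x) (mvfderiv (𝓡 3) (extChartAt (𝓡 3) b) x (χ x)) =
          -p (extChartAt (𝓡 3) b x)) :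
    IsModelNear W χ x₀ := by
  obtain ⟨ε, hε, hD⟩ := exists_one_sub_mul_ne_zero (p (extChartAt (𝓡 3) b x₀) 0)
  obtain ⟨e, r, s, F, f, z, hbe, heΩ, he, het, hes, hF, hf, hz, hall⟩ :=
    h.exists_holomorphic_chart hε hx₀Ω hD hlam
  set φ := extChartAt (𝓡 3) b with hφ
  have hec : ContDiffOn ℝ ∞ e e.source := by
    have h1 : ContDiffOn ℝ ∞ (fun y => (stereo ε (p y), z y)) e.source := by
      refine ContDiffOn.prodMk (fun y hy => ?_) hz
      exact ((contDiffAt_stereo (hall y hy).1).comp y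
        (h.contDiffAt_p (heΩ hy))).contDiffWithinAt
    exact h1.congr fun y _ => he y
  set ψ := sphereChart hε b e (heΩ.trans hΩ) hec hes with hψ
  have hco : ∀ x ∈ ψ.source, prodCoords (ψ x) = (p (φ x), z (φ x)) := by
    rintro x ⟨hx, hxe⟩
    have h1 : ψ x = (invStereo hε (e (φ x)).1, (e (φ x)).2) := rfl
    rw [h1, he, prodCoords]
    refine Prod.ext ?_ rfl
    exact invStereoCoords_stereo hε (h.unit _ (heΩ hxe)) (hall _ hxe).1
  have hφm : ∀ x ∈ ψ.source, ContMDiffAt (𝓡 3) 𝓘(ℝ, EuclideanSpace ℝ (Fin 3)) ∞ φ x :=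
    fun x hx => contMDiffAt_extChartAt' hx.1
  have hdco : ∀ x ∈ ψ.source, ∀ u : TangentSpace (𝓡 3) x,
      (dp (ψ x) (mfderiv (𝓡 3) IS2R ψ x u)).ofLp = fderiv ℝ p (φ x) (mvfderiv (𝓡 3) φ x u) ∧
      dz (ψ x) (mfderiv (𝓡 3) IS2R ψ x u) = fderiv ℝ z (φ x) (mvfderiv (𝓡 3) φ x u) := by
    intro x hx u
    have hxe : φ x ∈ e.source := hx.2
    have h1 := mvfderiv_comp_mfderiv (I' := 𝓡 3) (g := prodCoords) (f := ψ) (x := x)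
      ((contMDiff_prodCoords _).mdifferentiableAt (n := ∞) (by simp))
      (ψ.mdifferentiableAt (by simp) hx) u
    rw [mvfderiv_prodCoords] at h1
    have h2 : prodCoords ∘ ψ =ᶠ[𝓝 x] fun y => (p (φ y), z (φ y)) := by
      filter_upwards [ψ.open_source.mem_nhds hx] with y hy using hco y hy
    have hpd := (h.contDiffAt_p (heΩ hxe)).differentiableAt (n := ∞) (by simp)
    have hzd := (hz.contDiffAt (e.open_source.mem_nhds hxe)).differentiableAt (n := ∞) (by simp)
    have h3 := mvfderiv_comp_fderiv (f := fun y => (p y, z y)) (s := φ) (x := x)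
      (hpd.prodMk hzd) ((hφm x hx).mdifferentiableAt (by simp)) u
    rw [h2.mvfderiv_eq, h3, hpd.fderiv_prodMk hzd] at h1
    exact ⟨(congrArg Prod.fst h1).symm, (congrArg Prod.snd h1).symm⟩
  have hFs : ∀ x ∈ ψ.source, ((ψ x).2 : ℂ) + F (stereo ε (coords (ψ x).1)) =
      Real.exp (f (φ x)) * (lam κ τ (φ x))⁻¹ := by
    intro x hx
    have h1 := hco x hx
    rw [show coords (ψ x).1 = p (φ x) from congrArg Prod.fst h1,
      show (ψ x).2 = z (φ x) from congrArg Prod.snd h1]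
    rw [(hall _ hx.2).2.2.1, Complex.ofReal_exp]
  refine ⟨{q | 1 - ε * coords q 0 ≠ 0 ∧ stereo ε (coords q) ∈
      Metric.ball (stereo ε (p (φ x₀))) r}, fun q => F (stereo ε (coords q)), ψ,
    fun x => -f (φ x), isOpen_stereo_mem Metric.isOpen_ball,
    hF.holomorphicOnS2 hε Metric.isOpen_ball, ⟨hx₀, hbe⟩, ?_, ?_, ?_⟩
  · intro q hq
    have hq' : 1 - ε * coords q.1 0 ≠ 0 ∧ (stereo ε (coords q.1), q.2) ∈ e.target := hq
    refine ⟨⟨hq'.1, ?_⟩, ?_⟩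
    · have h1 := hq'.2
      rw [het] at h1
      exact h1.1
    · have h1 := ψ.map_target hq
      have h2 := hFs _ h1
      have h3 : ψ (ψ.toPartialEquiv.symm q) = q := ψ.right_inv hq
      rw [h3] at h2
      rw [h2]
      exact mul_ne_zero (Complex.ofReal_ne_zero.2 (Real.exp_pos _).ne')
        (inv_ne_zero (hall _ h1.2).2.1)
  · intro x hx
    exact (ContMDiffAt.comp x (hf.neg.contDiffAt
      (e.open_source.mem_nhds hx.2)).contMDiffAt (hφm x hx)).contMDiffWithinAt
  · intro x hx
    have hxe : φ x ∈ e.source := hx.2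
    have hxΩ : φ x ∈ Ω := heΩ hxe
    obtain ⟨h1, h2, h3, h4, h5⟩ := hall _ hxe
    obtain ⟨h6, h7⟩ := hg x hx.1 hxΩ
    have hpp := h.unit _ hxΩ
    have hN : (lam κ τ (φ x)).re ^ 2 + (lam κ τ (φ x)).im ^ 2 ≠ 0 := by
      rw [← Complex.normSq_add_mul_I, Complex.re_add_im]
      exact (Complex.normSq_pos.2 h2).ne'
    have hre : (lam κ τ (φ x)).re = τ (φ x) := by simp [lam]
    have him : (lam κ τ (φ x)).im = κ (φ x) := by simp [lam]
    rw [hre, him] at hN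
    have hns : Complex.normSq (((ψ x).2 : ℂ) + F (stereo ε (coords (ψ x).1))) =
        Real.exp (f (φ x)) ^ 2 / (τ (φ x) ^ 2 + κ (φ x) ^ 2) := by
      rw [hFs x hx, Complex.normSq_mul, Complex.normSq_inv, Complex.normSq_apply (lam _ _ _), hre,
        him, Complex.normSq_ofReal]
      field_simp
    have hE := (Real.exp_pos (f (φ x))).ne'
    have hE2 : Real.exp (2 * -f (φ x)) = (Real.exp (f (φ x)) ^ 2)⁻¹ := by
      rw [← Real.exp_nat_mul, ← Real.exp_neg]
      congr 1
      push_cast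
      ring
    refine ⟨fun u v => ?_, fun u => ?_, ?_, ?_⟩
    · rw [modelMetric, hns, inner_eq_dotProduct, (hdco x hx u).1, (hdco x hx v).1, (hdco x hx u).2,
        (hdco x hx v).2, h.deriv_p _ hxΩ, h.deriv_p _ hxΩ, h5, h5, dotProduct_self_deriv hpp,
        h6, hE2]
      field_simp
      ring
    · have h8 : mvfderiv (𝓡 3) (fun x => -f (φ x)) x u =
          -(fderiv ℝ f (φ x) (mvfderiv (𝓡 3) φ x u)) := by
        have h9 := mvfderiv_comp_fderiv (f := fun y => -f y) (s := φ) (x := x)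
          ((hf.neg.contDiffAt (e.open_source.mem_nhds hxe)).differentiableAt (by simp))
          ((hφm x hx).mdifferentiableAt (by simp)) u
        rw [h9, fderiv_fun_neg]
        rfl
      have h10 : (ψ x).2 + (F (stereo ε (coords (ψ x).1))).re =
          Real.exp (f (φ x)) * (τ (φ x) / (τ (φ x) ^ 2 + κ (φ x) ^ 2)) := by
        have h11 := congrArg Complex.re (hFs x hx)
        rw [Complex.re_ofReal_mul, Complex.inv_re, hre, Complex.normSq_apply, hre, him] at h11
        simp only [Complex.add_re, Complex.ofReal_re] at h11
        rw [h11]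
        ring
      rw [h8, modelForm, hns, ← mul_add, h10, (hdco x hx u).2, h5, h4,
        W.chartForm_mvfderiv hx.1]
      field_simp
      ring
    · apply WithLp.ofLp_injective
      rw [(hdco x hx _).1, h.deriv_p _ hxΩ, h7]
      simp [hpp]
    · rw [(hdco x hx _).2, h5, h7]
      simp [hpp]

end ModelChart

section ParallelCongruence

open Matrix S2

variable {E : Type*} [NormedAddCommGroup E] [NormedSpace ℝ E] [FiniteDimensional ℝ E]
  {H : Type*} [TopologicalSpace H] {I : ModelWithCorners ℝ E H}
  {M : Type*} [TopologicalSpace M] [ChartedSpace H M] [IsManifold I ∞ M] [I.Boundaryless]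

/-- A parallel congruence preserves the conformal structure of its orthogonal planes. If the metric
is locally `r |dF₁|² + s dF₂²` and the congruence is tangent to the fibres of `F₁`, this determines
the derivative of `r` along the congruence. -/
lemma WeylSpace.mvfderiv_eq_of_parallel (W : WeylSpace I M) {χ : (x : M) → TangentSpace I x} {x : M}
    (hχ : MDifferentiableAt I I.tangent (fun y => (⟨y, χ y⟩ : TangentBundle I M)) x)
    (hpar : ∀ u, W.weightlessD χ x u = 0) {F : M → (Fin 3 → ℝ) × ℝ}
    (hF : ContMDiffAt I 𝓘(ℝ, (Fin 3 → ℝ) × ℝ) ∞ F x) {r s : M → ℝ}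
    (hr : MDifferentiableAt I 𝓘(ℝ, ℝ) r x) (hs : MDifferentiableAt I 𝓘(ℝ, ℝ) s x)
    (hg : ∀ᶠ y in 𝓝 x, ∀ u v : TangentSpace I y, W.g.inner y u v =
      r y * ((mvfderiv I F y u).1 ⬝ᵥ (mvfderiv I F y v).1)
        + s y * ((mvfderiv I F y u).2 * (mvfderiv I F y v).2))
    (hFχ : ∀ᶠ y in 𝓝 x, (mvfderiv I F y (χ y)).1 = 0) {u : TangentSpace I x} (hu : u ≠ 0)
    (hu2 : (mvfderiv I F x u).2 = 0) :
    mvfderiv I r x (χ x) = -2 * W.om x (χ x) * r x := by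
  have : CompleteSpace E := FiniteDimensional.complete ℝ E
  have hX := FiberBundle.mdifferentiableAt_extend I E u
  set U : (y : M) → TangentSpace I y := FiberBundle.extend E u with hUd
  have hUx : U x = u := FiberBundle.extend_apply_self _ _
  set a : M → Fin 3 → ℝ := fun y => (mvfderiv I F y (U y)).1 with ha
  set c : M → ℝ := fun y => (mvfderiv I F y (U y)).2 with hc
  have hdU := MDifferentiableAt.mvfderiv_vectorField hF hX
  have had : MDifferentiableAt I 𝓘(ℝ, Fin 3 → ℝ) a x :=
    (ContinuousLinearMap.fst ℝ (Fin 3 → ℝ) ℝ).differentiableAt.mdifferentiableAt.comp x hdU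
  have hcd : MDifferentiableAt I 𝓘(ℝ, ℝ) c x :=
    (ContinuousLinearMap.snd ℝ (Fin 3 → ℝ) ℝ).differentiableAt.mdifferentiableAt.comp x hdU
  have hcx : c x = 0 := by simp only [hc, hUx]; exact hu2
  have hax : a x = (mvfderiv I F x u).1 := by simp only [ha, hUx]
  -- the derivative of `g(U, U)`
  have h1 : (fun y => W.g.inner y (U y) (U y)) =ᶠ[𝓝 x] fun y => r y * (a y ⬝ᵥ a y) +
      s y * (c y * c y) := by
    filter_upwards [hg] with y hy using hy _ _
  have h2 : mvfderiv I (fun y => W.g.inner y (U y) (U y)) x (χ x) =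
      mvfderiv I r x (χ x) * (a x ⬝ᵥ a x) + 2 * r x * (mvfderiv I a x (χ x) ⬝ᵥ a x) := by
    have haa : MDifferentiableAt I 𝓘(ℝ, ℝ) (fun y => a y ⬝ᵥ a y) x :=
      (dotL.mdifferentiableAt.comp x had).clm_apply had
    have hcc : MDifferentiableAt I 𝓘(ℝ, ℝ) (fun y => c y * c y) x := hcd.mul hcd
    have e1 := congrArg (fun A => A (χ x)) (mvfderiv_add (hr.mul haa) (hs.mul hcc))
    have e2 := congrArg (fun A => A (χ x)) (mvfderiv_mul hr haa)
    have e3 := congrArg (fun A => A (χ x)) (mvfderiv_mul hs hcc)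
    have e4 : mvfderiv I (fun y => c y * c y) x (χ x) = (c x • mvfderiv I c x
        + c x • mvfderiv I c x) (χ x) := congrArg (fun A => A (χ x)) (mvfderiv_mul hcd hcd)
    have e5 := mvfderiv_dotProduct had had (χ x)
    rw [h1.mvfderiv_eq]
    refine e1.trans ?_
    simp only [_root_.add_apply, _root_.smul_apply, smul_eq_mul] at e2 e3 e4 ⊢
    rw [e2, e3, e4, e5, hcx, dotProduct_comm (a x) (mvfderiv I a x (χ x))]
    ring
  have h3 := W.conformal U U x (χ x) hX hX
  have hDU : ∀ v : TangentSpace I x, W.g.inner x (W.D U x (χ x)) v = W.g.inner x (W.D χ x u) v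
      + W.g.inner x (VectorField.mlieBracket I χ U x) v := by
    intro v
    have h4 := W.D.torsion_apply hχ hX
    rw [W.torsion_free, hUx] at h4
    have h5 : W.D U x (χ x) = W.D χ x u + VectorField.mlieBracket I χ U x := by
      rw [← sub_eq_zero, ← sub_sub]
      exact h4.symm
    rw [h5, map_add]
    rfl
  have hbr : (mvfderiv I F x (VectorField.mlieBracket I χ U x)).1 = mvfderiv I a x (χ x) := by
    have h4 := mvfderiv_form_mlieBracket (T := fun _ => ContinuousLinearMap.fst ℝ (Fin 3 → ℝ) ℝ)
      hF mdifferentiableAt_const hχ hX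
    have h5 : (fun y => ContinuousLinearMap.fst ℝ (Fin 3 → ℝ) ℝ (mvfderiv I F y (χ y)))
        =ᶠ[𝓝 x] fun _ => 0 := hFχ
    rw [h5.mvfderiv_eq, mvfderiv_const, mvfderiv_const] at h4
    exact (sub_eq_zero.1 (by simpa using h4)).symm
  have hDχ : W.D χ x u = W.om x u • χ x := sub_eq_zero.1 (hpar u)
  have hgx := hg.self_of_nhds
  have hgχ : W.g.inner x (χ x) u = 0 := by
    rw [hgx, hFχ.self_of_nhds, hu2]
    simp
  have h5 := hDU u
  rw [hDχ, map_smul] at h5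
  have h6 : W.g.inner x (VectorField.mlieBracket I χ U x) u =
      r x * (mvfderiv I a x (χ x) ⬝ᵥ a x) := by
    rw [hgx, hbr, hu2, hax]
    ring
  have h7 : W.g.inner x u u = r x * (a x ⬝ᵥ a x) := by
    rw [hgx, hu2, hax]
    ring
  have h8 : r x * (a x ⬝ᵥ a x) ≠ 0 := by
    rw [← h7]
    exact (W.g.pos x u hu).ne'
  have h9 : W.g.inner x u (W.D U x (χ x)) = W.g.inner x (W.D U x (χ x)) u := W.g.symm x _ _
  rw [hUx, h9, h5, h2, h6, h7, _root_.smul_apply, hgχ, smul_zero] at h3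
  have h10 : a x ⬝ᵥ a x ≠ 0 := right_ne_zero_of_mul h8
  refine mul_right_cancel₀ h10 ?_
  linear_combination h3

variable {B : Type*} [TopologicalSpace B] [ChartedSpace (EuclideanSpace ℝ (Fin 3)) B]
    [IsManifold (𝓡 3) ∞ B] {W : WeylSpace (𝓡 3) B} {χ : (x : B) → TangentSpace (𝓡 3) x}

lemma mvfderiv_normSq_comp {w : M → ℂ} {x : M} (hw : MDifferentiableAt I 𝓘(ℝ, ℂ) w x)
    (u : TangentSpace I x) : mvfderiv I (fun y => Complex.normSq (w y)) x u =
      2 * ((w x).re * (mvfderiv I w x u).re + (w x).im * (mvfderiv I w x u).im) := by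
  have h1 : MDifferentiableAt I 𝓘(ℝ, ℝ) (fun y => (w y).re) x :=
    Complex.reCLM.mdifferentiableAt.comp x hw
  have h2 : MDifferentiableAt I 𝓘(ℝ, ℝ) (fun y => (w y).im) x :=
    Complex.imCLM.mdifferentiableAt.comp x hw
  have e1 := congrArg (fun A => A u) (mvfderiv_add (h1.mul h1) (h2.mul h2))
  have e2 := congrArg (fun A => A u) (mvfderiv_mul h1 h1)
  have e3 := congrArg (fun A => A u) (mvfderiv_mul h2 h2)
  have e4 : mvfderiv I (fun y => (w y).re) x u = (mvfderiv I w x u).re :=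
    mvfderiv_clm_comp Complex.reCLM hw u
  have e5 : mvfderiv I (fun y => (w y).im) x u = (mvfderiv I w x u).im :=
    mvfderiv_clm_comp Complex.imCLM hw u
  refine e1.trans ?_
  simp only [_root_.add_apply, _root_.smul_apply, smul_eq_mul, e4, e5] at e2 e3 ⊢
  rw [e2, e3]
  ring

/-- The congruence `∂/∂z` of a model space is not parallel. -/
theorem IsModelNear.not_eventually_parallel {b : B} (hm : IsModelNear W χ b)
    (hχ : W.IsCongruence χ) : ¬ ∀ᶠ x in 𝓝 b, ∀ u, W.weightlessD χ x u = 0 := by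
  intro hpar
  obtain ⟨U, h, ψ, f, hU, hh, hb, hψU, hf, hall⟩ := hm
  have hψd : ∀ x ∈ ψ.source, MDifferentiableAt (𝓡 3) IS2R ψ x := fun x hx =>
    ψ.mdifferentiableAt (by simp) hx
  have hψs : ∀ x ∈ ψ.source, ContMDiffAt (𝓡 3) IS2R ∞ ψ x := fun x hx =>
    (ψ.contMDiffOn x hx).contMDiffAt (ψ.open_source.mem_nhds hx)
  set F : B → (Fin 3 → ℝ) × ℝ := prodCoords ∘ ψ with hFd
  have hF : ∀ x ∈ ψ.source, ContMDiffAt (𝓡 3) 𝓘(ℝ, (Fin 3 → ℝ) × ℝ) ∞ F x := fun x hx =>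
    (contMDiff_prodCoords _).comp x (hψs x hx)
  have hdF : ∀ x ∈ ψ.source, ∀ u : TangentSpace (𝓡 3) x, mvfderiv (𝓡 3) F x u =
      ((dp (ψ x) (mfderiv (𝓡 3) IS2R ψ x u)).ofLp, dz (ψ x) (mfderiv (𝓡 3) IS2R ψ x u)) := by
    intro x hx u
    rw [← mvfderiv_prodCoords]
    exact mvfderiv_comp_mfderiv (I' := 𝓡 3) (g := prodCoords) (f := ψ)
      ((contMDiff_prodCoords _).mdifferentiableAt (n := ∞) (by simp)) (hψd x hx) u
  set w : B → ℂ := fun x => ((ψ x).2 : ℂ) + h (ψ x).1 with hwd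
  have hmem : ∀ x ∈ ψ.source, (ψ x).1 ∈ U ∧ w x ≠ 0 := fun x hx => hψU _ (ψ.map_source hx)
  have hgd : ∀ q : S2 × ℝ, q.1 ∈ U →
      MDifferentiableAt IS2R 𝓘(ℝ, ℂ) (fun q : S2 × ℝ => (q.2 : ℂ)) q ∧
      MDifferentiableAt IS2R 𝓘(ℝ, ℂ) (fun q : S2 × ℝ => h q.1) q := fun q hq =>
    ⟨MDifferentiableAt.comp q Complex.ofRealCLM.mdifferentiableAt mdifferentiableAt_snd,
      MDifferentiableAt.comp q (hh _ hq).1 mdifferentiableAt_fst⟩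
  have hw : ∀ x ∈ ψ.source, MDifferentiableAt (𝓡 3) 𝓘(ℝ, ℂ) w x := fun x hx =>
    MDifferentiableAt.comp x ((hgd _ (hmem x hx).1).1.add (hgd _ (hmem x hx).1).2) (hψd x hx)
  have hwχ : ∀ x ∈ ψ.source, mvfderiv (𝓡 3) w x (χ x) = (Real.exp (-f x) : ℂ) := by
    intro x hx
    obtain ⟨h1, h2⟩ := hgd _ (hmem x hx).1
    have e1 := mvfderiv_comp_mfderiv (I' := 𝓡 3) (h1.add h2) (hψd x hx) (χ x)
    refine e1.trans ?_
    rw [mvfderiv_add h1 h2, _root_.add_apply, mvfderiv_comp_fst (hh _ (hmem x hx).1).1]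
    have e2 := mvfderiv_clm_comp Complex.ofRealCLM (s := fun q : S2 × ℝ => q.2) (x := ψ x)
      (I := IS2R) mdifferentiableAt_snd (mfderiv (𝓡 3) IS2R ψ x (χ x))
    have e3 := (hall x hx).2.2.1
    rw [dp_eq] at e3
    have e4 : (mfderiv (𝓡 3) IS2R ψ x (χ x) : EuclideanSpace ℝ (Fin 2) × ℝ).1 = 0 := by
      refine toAmbient_injective _ (e3.trans ?_)
      exact (map_zero (mvfderiv (𝓡 2) (fun q : S2 => (q : EuclideanSpace ℝ (Fin 3))) _)).symm
    have e5 := (hall x hx).2.2.2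
    rw [dz] at e5
    rw [e5] at e2
    rw [e4]
    refine (congrArg₂ (· + ·) e2 (map_zero (mvfderiv (𝓡 2) h (ψ x).1))).trans ?_
    simp
  have hre : ∀ᶠ x in 𝓝 b, (w x).re = 0 := by
    filter_upwards [ψ.open_source.mem_nhds hb, hpar] with x hx hpx
    obtain ⟨h1, h2, h3, h4⟩ := hall x hx
    have hfd : MDifferentiableAt (𝓡 3) 𝓘(ℝ, ℝ) f x :=
      (hf.contMDiffAt (ψ.open_source.mem_nhds hx)).mdifferentiableAt (by simp)
    have hN : MDifferentiableAt (𝓡 3) 𝓘(ℝ, ℝ) (fun y => Complex.normSq (w y)) x :=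
      MDifferentiableAt.comp x
        (Complex.contDiff_normSq.differentiable (by simp) _).mdifferentiableAt (hw x hx)
    have hEd : DifferentiableAt ℝ (fun t : ℝ => Real.exp (2 * t)) (f x) := by fun_prop
    have hE : MDifferentiableAt (𝓡 3) 𝓘(ℝ, ℝ) (fun y => Real.exp (2 * f y)) x :=
      hEd.mdifferentiableAt.comp x hfd
    have hEχ := mvfderiv_comp_fderiv hEd hfd (χ x)
    have hEv : fderiv ℝ (fun t : ℝ => Real.exp (2 * t)) (f x) = 
        (2 * Real.exp (2 * f x)) • ContinuousLinearMap.id ℝ ℝ := by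
      have := ((hasDerivAt_id (f x)).const_mul 2).exp.hasFDerivAt.fderiv
      simp only [id] at this
      rw [this]
      ext
      simp
      ring
    rw [hEv] at hEχ
    simp only [_root_.smul_apply, ContinuousLinearMap.id_apply, smul_eq_mul] at hEχ
    obtain ⟨u, hu, hu2⟩ : ∃ u : TangentSpace (𝓡 3) x, u ≠ 0 ∧ (mvfderiv (𝓡 3) F x u).2 = 0 := by
      have h5 : ∀ L : EuclideanSpace ℝ (Fin 3) →L[ℝ] ℝ, LinearMap.ker L.toLinearMap ≠ ⊥ :=
        fun L => LinearMap.ker_ne_bot_of_finrank_lt (by simp)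
      obtain ⟨u, hu, hu0⟩ := (Submodule.ne_bot_iff _).1
        (h5 ((ContinuousLinearMap.snd ℝ (Fin 3 → ℝ) ℝ).comp (mvfderiv (𝓡 3) F x)))
      exact ⟨u, hu0, hu⟩
    have key := W.mvfderiv_eq_of_parallel ((hχ.smooth x).mdifferentiableAt (by simp)) hpx
      (hF x hx) (r := (fun y => Real.exp (2 * f y)) * fun y => Complex.normSq (w y))
      (s := fun y => Real.exp (2 * f y)) (hE.mul hN) hE
      (by
        filter_upwards [ψ.open_source.mem_nhds hx] with y hy u v
        rw [(hall y hy).1, hdF y hy, hdF y hy, modelMetric, inner_eq_dotProduct]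
        simp only [Pi.mul_apply, hwd]
        ring)
      (by
        filter_upwards [ψ.open_source.mem_nhds hx] with y hy
        rw [hdF y hy, (hall y hy).2.2.1]
        rfl) hu hu2
    rw [mvfderiv_mul hE hN, _root_.add_apply, _root_.smul_apply, _root_.smul_apply,
      mvfderiv_normSq_comp (hw x hx), hwχ x hx, hEχ, h2, modelForm, h4] at key
    have hNne : Complex.normSq (w x) ≠ 0 := (Complex.normSq_pos.2 (hmem x hx).2).ne'
    have hre' : 2 * (ψ x).2 + 2 * (h (ψ x).1).re = 2 * (w x).re := by simp [hwd]; ring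
    have hNw : Complex.normSq (((ψ x).2 : ℂ) + h (ψ x).1) = Complex.normSq (w x) := rfl
    rw [hre', hNw] at key
    have hr1 := (Real.exp_pos (-f x)).ne'
    have hr2 := (Real.exp_pos (2 * f x)).ne'
    simp only [Pi.mul_apply, smul_eq_mul, Complex.ofReal_re, Complex.ofReal_im] at key
    field_simp at key
    have h6 : (w x).re * Real.exp (-f x) = 0 := by
      linear_combination -key
    exact (mul_eq_zero.1 h6).resolve_right hr1
  have h1 : (fun x => Complex.reCLM (w x)) =ᶠ[𝓝 b] fun _ => 0 := hre
  have h2 := mvfderiv_clm_comp Complex.reCLM (hw b hb) (χ b)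
  rw [h1.mvfderiv_eq, mvfderiv_const, hwχ b hb] at h2
  rw [Complex.reCLM_apply, Complex.ofReal_re] at h2
  exact (Real.exp_pos (-f b)).ne h2

end ParallelCongruence

section Flatness

open Matrix

variable {E : Type*} [NormedAddCommGroup E] [NormedSpace ℝ E] [FiniteDimensional ℝ E]
  {H : Type*} [TopologicalSpace H] {I : ModelWithCorners ℝ E H}
  {M : Type*} [TopologicalSpace M] [ChartedSpace H M] [IsManifold I ∞ M] [I.Boundaryless]
  {W : WeylSpace I M}

/-- If the twist and the divergence vanish, then the Weyl connection is flat. -/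
lemma IsTodaFrame.curvature_eq_zero {b x : M} {Ω : Set E} {T : E → E →L[ℝ] (Fin 3 → ℝ)}
    {κ τ : E → ℝ} {p : E → Fin 3 → ℝ} (h : IsTodaFrame Ω T (W.chartForm b) κ τ p)
    (hcon : ∀ x ∈ (chartAt H b).source, extChartAt I b x ∈ Ω →
      W.HasConnectionFormAt (extChartAt I b) (fun y => T (extChartAt I b y))
        (fun y => weylForm (W.chartForm b (extChartAt I b y))
          (κ (extChartAt I b y) • T (extChartAt I b y))) x)
    (hx : x ∈ (chartAt H b).source) (hxΩ : extChartAt I b x ∈ Ω)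
    (hlam : ∀ᶠ y in 𝓝 (extChartAt I b x), κ y = 0 ∧ τ y = 0) (u v w : TangentSpace I x) :
    W.curvature x u v w = 0 := by
  set φ := extChartAt I b with hφ
  have hφm : ContMDiffAt I 𝓘(ℝ, E) ∞ φ x := contMDiffAt_extChartAt' hx
  have hφd := hφm.mdifferentiableAt (by simp)
  have hbx : Function.Bijective ((T (φ x)).comp (mvfderiv I φ x)).toLinearMap :=
    (h.bijective _ hxΩ).comp (mvfderiv_extChartAt_bijective hx)
  have hev : ∀ᶠ y in 𝓝 x, y ∈ (chartAt H b).source ∧ φ y ∈ Ω :=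
    Filter.Eventually.and ((chartAt H b).open_source.mem_nhds hx)
      (hφm.continuousAt.eventually_mem (h.isOpen.mem_nhds hxΩ))
  have hκ0 : (fun y => κ (φ y)) =ᶠ[𝓝 x] fun _ => 0 := by
    filter_upwards [hφm.continuousAt.eventually hlam] with y hy using hy.1
  have hτ0 : τ =ᶠ[𝓝 (φ x)] fun _ => 0 := by
    filter_upwards [hlam] with y hy using hy.2
  have h1 := (WeylSpace.HasConnectionFormAt.ricci (W := W) (x := x) (F := φ)
    (T := fun y => T (φ y)) (om := fun y => W.chartForm b (φ y)) (α := fun _ => 0)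
    (κ := fun y => κ (φ y))
    (by
      filter_upwards [hev] with y hy
      have h2 := hcon y hy.1 hy.2
      simpa only [WeylSpace.HasConnectionFormAt, ContinuousLinearMap.comp_zero, add_zero] using h2)
    hφm ((h.contDiffAt_T hxΩ).contMDiffAt.comp x hφm)
    ((h.contDiffAt_om hxΩ).contMDiffAt.comp x hφm) contMDiffAt_const
    ((h.contDiffAt_κ hxΩ).contMDiffAt.comp x hφm) (LinearEquiv.ofBijective _ hbx)
    (fun u => rfl)).1 u v w
  have h2 : ∀ u, mvfderiv I (fun y => W.chartForm b (φ y)) x u = _ := fun u =>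
    mvfderiv_comp_fderiv ((h.contDiffAt_om hxΩ).differentiableAt (by simp)) hφd u
  have h3 := h.deriv_om hxΩ (mvfderiv I φ x u) (mvfderiv I φ x v)
  rw [hτ0.fderiv_eq, hτ0.self_of_nhds] at h3
  have h4 : WeylSpace.formDeriv (I := I) φ (fun _ => (0 : E →L[ℝ] ℝ)) x u v = 0 := by
    rw [WeylSpace.formDeriv_apply, mvfderiv_const]
    simp
  have hκx : κ (φ x) = 0 := hκ0.self_of_nhds
  rw [h4, WeylSpace.formDeriv_apply, h2, h2, h3, hκ0.mvfderiv_eq, mvfderiv_const, hκx] at h1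
  refine (LinearEquiv.ofBijective _ hbx).injective (h1.trans ?_)
  simp

end Flatness

section Main

variable {B : Type*} [TopologicalSpace B] [ChartedSpace (EuclideanSpace ℝ (Fin 3)) B]
  [IsManifold (𝓡 3) ∞ B] {W : WeylSpace (𝓡 3) B} {χ : (x : B) → TangentSpace (𝓡 3) x}

/-- Locally, the models are dense or the congruence is parallel and the connection is flat. -/
theorem WeylSpace.IsEinsteinWeyl.eventually_parallel_or_mem_interior (hW : W.IsEinsteinWeyl)
    (hχ : W.IsTodaCongruence χ) (hH : W.IsHyperCR) (b : B) :
    (∀ᶠ x in 𝓝 b, (∀ u, W.weightlessD χ x u = 0) ∧ ∀ u v w, W.curvature x u v w = 0) ∨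
      b ∈ interior (closure {b : B | IsModelNear W χ b}) := by
  obtain ⟨σ, ν, J', hχ, hν⟩ := hχ
  obtain ⟨ξ, τ₀, κ₀, J, hξ, hτ₀⟩ := hH
  obtain ⟨Ω, T, κ, τ, p, h, hΩ, hb, hall⟩ := hW.exists_isTodaFrame hξ hτ₀ hχ hν (by simp) b
  have hbs := mem_chart_source (EuclideanSpace ℝ (Fin 3)) b
  set φ := extChartAt (𝓡 3) b with hφ
  have hφc : ContinuousAt φ b := (contMDiffAt_extChartAt' (n := ∞) hbs).continuousAt
  have hev : ∀ᶠ x in 𝓝 b, x ∈ (chartAt (EuclideanSpace ℝ (Fin 3)) b).source ∧ φ x ∈ Ω :=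
    Filter.Eventually.and ((chartAt (EuclideanSpace ℝ (Fin 3)) b).open_source.mem_nhds hbs)
      (hφc.eventually_mem (h.isOpen.mem_nhds hb))
  obtain ⟨ε, hε, hD⟩ := exists_one_sub_mul_ne_zero (p (φ b) 0)
  have hlam : ∀ y, IsTodaFrame.lam κ τ y = 0 ↔ κ y = 0 ∧ τ y = 0 := by
    intro y
    rw [Complex.ext_iff]
    simp [IsTodaFrame.lam, and_comm]
  by_cases hf : ∃ᶠ y in 𝓝 (φ b), ∀ᶠ y' in 𝓝 y, IsTodaFrame.lam κ τ y' = 0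
  · left
    have h1 := (h.eventually_eq_zero_of_frequently hε hb hD hf).eventually_nhds
    filter_upwards [hev, hφc.eventually h1] with x hx hx'
    have h2 : ∀ᶠ y in 𝓝 (φ x), κ y = 0 ∧ τ y = 0 := by
      filter_upwards [hx'] with y hy using (hlam y).1 hy
    refine ⟨fun u => ?_, fun u v w => h.curvature_eq_zero (fun y hy hyΩ => (hall y hy hyΩ).1)
      hx.1 hx.2 h2 u v w⟩
    have h3 := (hall x hx.1 hx.2).2.2.2
    rw [h2.self_of_nhds.2] at h3
    rw [hχ.eqn, hν, show σ x = 0 by linarith]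
    simp
  · right
    rw [Filter.not_frequently] at hf
    rw [mem_interior_iff_mem_nhds]
    filter_upwards [hev, hφc.eventually hf] with x hx hx'
    rw [Filter.not_eventually] at hx'
    rw [mem_closure_iff_frequently]
    have hxs : x ∈ φ.source := by rw [hφ, extChartAt_source]; exact hx.1
    have ht : Filter.Tendsto φ.symm (𝓝 (φ x)) (𝓝 x) := by
      have := continuousAt_extChartAt_symm' (I := 𝓡 3) hxs
      rwa [ContinuousAt, φ.left_inv hxs] at this
    refine ht.frequently ((hx'.and_eventually (h.isOpen.mem_nhds hx.2)).mono ?_)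
    rintro y ⟨hy, hyΩ⟩
    have hyt : φ (φ.symm y) = y := φ.right_inv (hΩ hyΩ)
    have hys : φ.symm y ∈ (chartAt (EuclideanSpace ℝ (Fin 3)) b).source := by
      rw [← extChartAt_source (𝓡 3)]
      exact φ.map_target (hΩ hyΩ)
    exact h.isModelNear hΩ hys (by rwa [hyt]) (by rwa [hyt]) fun x hx hxΩ =>
      ⟨(hall x hx hxΩ).2.1, (hall x hx hxΩ).2.2.1⟩

/-- On a connected space, the models are dense unless the congruence is parallel on flat space. -/
theorem WeylSpace.IsEinsteinWeyl.dense_isModelNear [PreconnectedSpace B] (hW : W.IsEinsteinWeyl)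
    (hχ : W.IsTodaCongruence χ) (hH : W.IsHyperCR) (hn : ¬ (W.IsFlat ∧ W.IsParallel χ)) :
    Dense {b : B | IsModelNear W χ b} := by
  set N := {b : B | IsModelNear W χ b} with hN
  set K := {b : B | ∀ᶠ x in 𝓝 b, (∀ u, W.weightlessD χ x u = 0) ∧
    ∀ u v w, W.curvature x u v w = 0} with hK
  have hKo : IsOpen K := isOpen_setOfPred_eventually_nhds
  have hKN : Disjoint K (closure N) := by
    refine Disjoint.closure_right (Set.disjoint_left.2 fun b hbK hbN => ?_) hKo
    obtain ⟨σ, ν, J', hχ', -⟩ := hχ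
    exact hbN.not_eventually_parallel hχ'.congruence (hbK.mono fun x hx => hx.1)
  have hcov : ∀ b, b ∈ K ∨ b ∈ interior (closure N) := fun b =>
    hW.eventually_parallel_or_mem_interior hχ hH b
  intro b
  by_contra hb
  have hbK : b ∈ K := (hcov b).resolve_right fun h => hb (interior_subset h)
  refine hn ?_
  have hall : ∀ x, x ∈ K := by
    intro x
    by_contra hx
    obtain ⟨y, -, hy1, hy2⟩ := isPreconnected_univ K (interior (closure N)) hKo isOpen_interior
      (fun y _ => hcov y) ⟨b, Set.mem_univ b, hbK⟩
      ⟨x, Set.mem_univ x, (hcov x).resolve_left hx⟩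
    exact Set.disjoint_left.1 hKN hy1 (interior_subset hy2)
  exact ⟨fun x => (hall x).self_of_nhds.2, fun x => (hall x).self_of_nhds.1⟩

end Main

theorem theorem1 :
    (∀ (U : Set S2) (h : S2 → ℂ) (V : TopologicalSpace.Opens (S2 × ℝ)),
      IsOpen U → HolomorphicOnS2 h U →
      (∀ y ∈ V, y.1 ∈ U ∧ (y.2 : ℂ) + h y.1 ≠ 0) →
      ∃ W : WeylSpace IS2R V,
        (∀ (x : V) (u v : TangentSpace IS2R x), W.g.inner x u v =
          modelMetric h x (mfderiv IS2R IS2R (Subtype.val : V → S2 × ℝ) x u)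
            (mfderiv IS2R IS2R (Subtype.val : V → S2 × ℝ) x v)) ∧
        (∀ (x : V) (u : TangentSpace IS2R x), W.om x u =
          modelForm h x (mfderiv IS2R IS2R (Subtype.val : V → S2 × ℝ) x u)) ∧
        W.IsEinsteinWeyl ∧ W.IsToda ∧ W.IsHyperCR) ∧
    (∀ (B : Type*) [TopologicalSpace B] [ChartedSpace (EuclideanSpace ℝ (Fin 3)) B]
      [IsManifold (𝓡 3) ∞ B] [ConnectedSpace B] (W : WeylSpace (𝓡 3) B)
      (χ : (x : B) → TangentSpace (𝓡 3) x),
      W.IsEinsteinWeyl → W.IsTodaCongruence χ → W.IsHyperCR →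
      (¬ (W.IsFlat ∧ W.IsParallel χ) → Dense {b : B | IsModelNear W χ b}) ∧
      (W.IsFlat ∧ W.IsParallel χ → ∀ b : B, ¬ IsModelNear W χ b)) := by
  refine ⟨fun U h V hU hh hV => hh.exists_model hU hV, ?_⟩
  intro B _ _ _ _ W χ hW hχ hH
  refine ⟨hW.dense_isModelNear hχ hH, fun hp b hb => ?_⟩
  obtain ⟨σ, ν, J, hχ', -⟩ := hχ
  exact hb.not_eventually_parallel hχ'.congruence (Filter.Eventually.of_forall hp.2)
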